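/- Let $k$ be a field and $H$ a finite-dimensional cocommutative Hopf algebra over $k$ with antipode $S$, and let $\omega\colon H\otimes H\otimes H\to k$ be a convolution invertible normalized $3$-cocycle: for all $x,y,z,t\in H$, $$\omega(x_1,y_1,z_1t_1)\,\omega(x_2y_2,z_2,t_2)=\omega(y_1,z_1,t_1)\,\omega(x_1,y_2z_2,t_2)\,\omega(x_2,y_3,z_3),$$ $$\omega(1,x,y)=\omega(x,1,y)=\omega(x,y,1)=\varepsilon(x)\varepsilon(y).$$ Let $\beta\in H^*$, $\beta(h)=\omega(h_1,S(h_2),h_3)$. Let $H^*_\omega$ be the quasi-Hopf algebra whose underlying algebra is $H^*$ with the convolution product, whose comultiplication is dual to the product of $H$, whose counit is $\varphi\mapsto\varphi(1_H)$, whose reassociator is $\Phi=\omega^{-1}\in (H\otimes H\otimes H)^*=H^*\otimes H^*\otimes H^*$, whose antipode is $\varphi\mapsto\varphi\circ S$, and whose distinguished elements are $\alpha=\varepsilon$ and $\beta$. **Conventions.** For a finite-dimensional quasi-Hopf algebra $K=(K,\Delta,\varepsilon,\Phi,S,\alpha,\beta)$, with $(\mathrm{id}\otimes\Delta)\Delta(h)\,\Phi=\Phi\,(\Delta\otimes\mathrm{id})\Delta(h)$,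 write $\Phi=X^1\otimes X^2\otimes X^3$ (further copies $Y^1\otimes Y^2\otimes Y^3$), $\Phi^{-1}=x^1\otimes x^2\otimes x^3$ (further copies $y^1\otimes y^2\otimes y^3$), and $$p_R=p^1\otimes p^2=x^1\otimes x^2\beta S(x^3),\qquad q_R=q^1\otimes q^2=X^1\otimes S^{-1}(\alpha X^3)X^2 .$$ Let $f=f^1\otimes f^2$ be the Drinfeld twist and $f^{-1}=g^1\otimes g^2$ its inverse: $$f=(S\otimes S)(\Delta^{\rm cop}(x^1))\,\gamma\,\Delta(x^2\beta S(x^3)),\qquad f^{-1}=\Delta(S(x^1)\alpha x^2)\,\delta\,(S\otimes S)(\Delta^{\rm cop}(x^3)),$$ with $\gamma=S(A^2)\alpha A^3\otimes S(A^1)\alpha A^4$ for $A^1\otimes A^2\otimes A^3\otimes A^4=(\Phi\otimes1)(\Delta\otimes\mathrm{id}\otimes\mathrm{id})(\Phi^{-1})$ and $\delta=B^1\beta S(B^4)\otimes B^2\beta S(B^3)$ for $B^1\otimes B^2\otimes B^3\otimes B^4=(\Delta\otimes\mathrm{id}\otimes\mathrm{id})(\Phi)(\Phi^{-1}\otimes1)$.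 Put $$U=g^1S(q^2)\otimes g^2S(q^1),\qquad V=S^{-1}(f^2p^2)\otimes S^{-1}(f^1p^1).$$ * An element $t\in K$ is a left (right) integral if $ht=\varepsilon(h)t$ (respectively $th=\varepsilon(h)t$) for all $h\in K$. The functional $\mu_K\in K^*$ is defined by $th=\mu_K(h)t$ for all $h \in K$, with $t\neq0$ a left integral. The same definitions apply to the Hopf algebra $H$ and give $\mu_H\in H^*$. * A functional $\lambda\in K^*$ is a left cointegral if $\lambda(V^2h_2U^2)\,V^1h_1U^1=\mu_K(x^1)\,\lambda(hS(x^2))\,x^3$ for all $h\in K$. * The modular element of $K$ is $\underline{g}_K=\lambda(V^1r_1U^1)\,V^2r_2U^2$, where $\lambda$ is a left cointegral and $r$ is a right integral with $\lambda(r)=1$. * The quantum double $D(K)$ is the vector space $K^*\otimes K$, with elements $\varphi\bowtie h$, and the following operations. For $a,b\in K$ let $(a\rightharpoonup\varphi\leftharpoonup b)(x)=\varphi(bxa)$; the product of $K^*$ is $(\varphi\psi)(x)=\varphi(x_1)\psi(x_2)$, and $\varphi_1\otimes\varphi_2$ is given by $\varphi(xy)=\varphi_1(x)\varphi_2(y)$.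 Let $X^1_{(1,1)}\otimes X^1_{(1,2)}\otimes X^1_2=(\Delta\otimes\mathrm{id})\Delta(X^1)$, similarly for $h$, and let $$\Omega=X^1_{(1,1)}y^1x^1\otimes X^1_{(1,2)}y^2x^2_1\otimes X^1_2y^3x^2_2\otimes S^{-1}(f^1X^2x^3)\otimes S^{-1}(f^2X^3).$$ The product is $$(\varphi\bowtie h)(\psi\bowtie h')=(\Omega^1\rightharpoonup\varphi\leftharpoonup\Omega^5)(\Omega^2h_{(1,1)}\rightharpoonup\psi\leftharpoonup S^{-1}(h_2)\Omega^4)\bowtie\Omega^3h_{(1,2)}h',$$ with unit $\varepsilon\bowtie1$; the comultiplication, counit and antipode are $$\Delta(\varphi\bowtie h)=(\varepsilon\bowtie X^1Y^1)(p^1_1x^1\rightharpoonup\varphi_2\leftharpoonup Y^2S^{-1}(p^2)\bowtie p^1_2x^2h_1)\otimes(X^2_1\rightharpoonup\varphi_1\leftharpoonup S^{-1}(X^3)\bowtie X^2_2Y^3x^3h_2),$$ $$\varepsilon(\varphi\bowtie h)=\varphi(S^{-1}(\alpha))\varepsilon(h),\qquad S(\varphi\bowtie h)=(\varepsilon\bowtie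 S(h)f^1)(p^1_1U^1\rightharpoonup\varphi\circ S^{-1}\leftharpoonup f^2S^{-1}(p^2)\bowtie p^1_2U^2);$$ the reassociator and the distinguished elements are the images of $\Phi,\alpha,\beta$ under $h\mapsto\varepsilon\bowtie h$. **Statement.** There is exactly one functional $\mu_H$ as above, and: 1. The modular element of $H^*_\omega$ exists, is unique, and equals $\beta^2\mu_H$ (convolution product). 2. The modular element of $D(H^*_\omega)=(H^*_\omega)^*\bowtie H^*_\omega$ exists, is unique, and equals $1_H\bowtie\beta^2\mu_H$, where $1_H$ is regarded as an element of $(H^*_\omega)^*$ by evaluation. 3. For $K=H^*_\omega$ and for $K=D(H^*_\omega)$, the element $\lambda(S^{-1}(q^2t_2p^2))\,q^1t_1p^1$, where $\lambda$ is a left cointegral on $K$ and $t$ is a left integral in $K$ with $\lambda(S^{-1}(t))=1$, exists and is unique; it equals $(\beta^2\mu_H)\circ S$ (that is, the convolution inverse of $\beta^2\mu_H$) and $1_H\bowtie\big((\beta^2\mu_H)\circ S\big)$, respectively. -/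

import Mathlib

open scoped TensorProduct

noncomputable section

namespace QuasiHopf

/-! ### Auxiliary maps on tensors

Tensors of higher order are bracketed to the right, `A ⊗ (A ⊗ A)`, unless stated otherwise. -/

section Tensors

variable {k : Type*} [Field k]

section
variable {M N P B : Type*} [AddCommMonoid M] [Module k M] [AddCommMonoid N] [Module k N]
  [AddCommMonoid P] [Module k P]
  [NonUnitalNonAssocSemiring B] [Module k B] [SMulCommClass k B B] [IsScalarTower k B B]

/-- `m ⊗ n ↦ f m * g n`. -/
def mulMap₂ (f : M →ₗ[k] B) (g : N →ₗ[k] B) : M ⊗[k] N →ₗ[k] B :=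
  LinearMap.mul' k B ∘ₗ TensorProduct.map f g

@[simp] theorem mulMap₂_tmul (f : M →ₗ[k] B) (g : N →ₗ[k] B) (m : M) (n : N) :
    mulMap₂ f g (m ⊗ₜ n) = f m * g n := rfl

/-- `m ⊗ (n ⊗ p) ↦ f m * (g n * h p)`. -/
def mulMap₃ (f : M →ₗ[k] B) (g : N →ₗ[k] B) (h : P →ₗ[k] B) : M ⊗[k] (N ⊗[k] P) →ₗ[k] B :=
  mulMap₂ f (mulMap₂ g h)

@[simp] theorem mulMap₃_tmul (f : M →ₗ[k] B) (g : N →ₗ[k] B) (h : P →ₗ[k] B)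
    (m : M) (n : N) (p : P) : mulMap₃ f g h (m ⊗ₜ (n ⊗ₜ p)) = f m * (g n * h p) := rfl

/-- `m ⊗ n ↦ φ(m) n`. -/
def contractLeft (φ : M →ₗ[k] k) : M ⊗[k] N →ₗ[k] N :=
  (TensorProduct.lid k N).toLinearMap ∘ₗ LinearMap.rTensor N φ

@[simp] theorem contractLeft_tmul (φ : M →ₗ[k] k) (m : M) (n : N) :
    contractLeft φ (m ⊗ₜ[k] n) = φ m • n := by simp [contractLeft]

/-- `m ⊗ n ↦ φ(n) m`. -/
def contractRight (φ : N →ₗ[k] k) : M ⊗[k] N →ₗ[k] M :=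
  (TensorProduct.rid k M).toLinearMap ∘ₗ LinearMap.lTensor M φ

@[simp] theorem contractRight_tmul (φ : N →ₗ[k] k) (m : M) (n : N) :
    contractRight φ (m ⊗ₜ[k] n) = φ n • m := by simp [contractRight]

end

end Tensors

/-! ### Integrals -/

section Integrals

variable {k A : Type*} [Field k] [NonUnitalNonAssocRing A] [Module k A]

/-- `t` is a left integral with respect to `ε`: `h t = ε(h) t` for all `h`. -/
def IsLeftIntegral (ε : A →ₗ[k] k) (t : A) : Prop := ∀ h : A, h * t = ε h • t

/-- `r` is a right integral with respect to `ε`: `r h = ε(h) r` for all `h`. -/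
def IsRightIntegral (ε : A →ₗ[k] k) (r : A) : Prop := ∀ h : A, r * h = ε h • r

/-- `μ` is the modular functional (the modular element in the dual space):
`t h = μ(h) t` for all `h`, where `t` is a non-zero left integral. -/
def IsModularFunctional (ε μ : A →ₗ[k] k) : Prop :=
  ∃ t : A, t ≠ 0 ∧ IsLeftIntegral ε t ∧ ∀ h : A, t * h = μ h • t

end Integrals

/-! ### Quasi-Hopf algebras -/

/-- The operations of a quasi-Hopf algebra on the `k`-algebra `A`, in the convention
`(id ⊗ Δ)(Δ(h)) Φ = Φ (Δ ⊗ id)(Δ(h))`, `S(h₁) α h₂ = ε(h) α`, `h₁ β S(h₂) = ε(h) β`. (The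
multiplication is not required to be associative here, so that the operations can be written down
for an algebra whose multiplication is given by a formula.) -/
structure QuasiHopfData (k A : Type*) [Field k] [NonUnitalNonAssocRing A] [One A]
    [Module k A] where
  /-- comultiplication -/
  comul : A →ₗ[k] A ⊗[k] A
  /-- counit -/
  counit : A →ₗ[k] k
  /-- the reassociator `Φ = X¹ ⊗ X² ⊗ X³` -/
  Φ : A ⊗[k] (A ⊗[k] A)
  /-- its inverse `Φ⁻¹ = x¹ ⊗ x² ⊗ x³` -/
  Φinv : A ⊗[k] (A ⊗[k] A)
  /-- antipode `S` -/
  antipode : A →ₗ[k] A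
  /-- the distinguished element `α` -/
  α : A
  /-- the distinguished element `β` -/
  β : A

namespace QuasiHopfData

section Operations

variable {k A : Type*} [Field k] [NonUnitalNonAssocRing A] [One A] [Module k A]
  [SMulCommClass k A A] [IsScalarTower k A A] (Q : QuasiHopfData k A)

/-- The inverse `S⁻¹` of the antipode (`0` if the antipode is not bijective). -/
def antipodeInv : A →ₗ[k] A := Ring.inverse (M₀ := Module.End k A) Q.antipode

/-- `a ⊗ b ↦ S(a) α b`. -/
def evα : A ⊗[k] A →ₗ[k] A :=
  mulMap₂ (LinearMap.mulRight k Q.α ∘ₗ Q.antipode) LinearMap.id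

@[simp] theorem evα_tmul (a b : A) : Q.evα (a ⊗ₜ b) = Q.antipode a * Q.α * b := rfl

/-- `a ⊗ b ↦ a β S(b)`. -/
def evβ : A ⊗[k] A →ₗ[k] A := mulMap₂ (LinearMap.mulRight k Q.β) Q.antipode

@[simp] theorem evβ_tmul (a b : A) : Q.evβ (a ⊗ₜ b) = a * Q.β * Q.antipode b := rfl

/-- `(Δ ⊗ id) Δ`, with values in `A ⊗ (A ⊗ A)`. -/
def comulLeft : A →ₗ[k] A ⊗[k] (A ⊗[k] A) :=
  (TensorProduct.assoc k A A A).toLinearMap ∘ₗ LinearMap.rTensor A Q.comul ∘ₗ Q.comul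

/-- `(id ⊗ Δ) Δ`. -/
def comulRight : A →ₗ[k] A ⊗[k] (A ⊗[k] A) := LinearMap.lTensor A Q.comul ∘ₗ Q.comul

/-- `(S ⊗ S) Δᶜᵒᵖ`. -/
def antipodeComulOp : A →ₗ[k] A ⊗[k] A :=
  TensorProduct.map Q.antipode Q.antipode ∘ₗ (TensorProduct.comm k A A).toLinearMap ∘ₗ Q.comul

/-- `X ↦ X ⊗ 1`. -/
def appendOne : A ⊗[k] (A ⊗[k] A) →ₗ[k] A ⊗[k] (A ⊗[k] (A ⊗[k] A)) :=
  LinearMap.lTensor A (LinearMap.lTensor A ((TensorProduct.mk k A A).flip 1))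

/-- `Δ ⊗ id ⊗ id`. -/
def comulFirst : A ⊗[k] (A ⊗[k] A) →ₗ[k] A ⊗[k] (A ⊗[k] (A ⊗[k] A)) :=
  (TensorProduct.assoc k A A (A ⊗[k] A)).toLinearMap ∘ₗ LinearMap.rTensor (A ⊗[k] A) Q.comul

/-- `p_R = x¹ ⊗ x² β S(x³)`. -/
def pR : A ⊗[k] A := LinearMap.lTensor A Q.evβ Q.Φinv

/-- `q_R = X¹ ⊗ S⁻¹(α X³) X²`. -/
def qR : A ⊗[k] A :=
  LinearMap.lTensor A
    (mulMap₂ (Q.antipodeInv ∘ₗ LinearMap.mulLeft k Q.α) LinearMap.id ∘ₗ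
      (TensorProduct.comm k A A).toLinearMap) Q.Φ

/-- `a ⊗ b ⊗ c ⊗ d ↦ S(b) α c ⊗ S(a) α d`. -/
def γMap : A ⊗[k] (A ⊗[k] (A ⊗[k] A)) →ₗ[k] A ⊗[k] A :=
  LinearMap.lTensor A Q.evα ∘ₗ (TensorProduct.leftComm k A A A).toLinearMap ∘ₗ
    LinearMap.lTensor A
      (LinearMap.rTensor A Q.evα ∘ₗ (TensorProduct.assoc k A A A).symm.toLinearMap)

theorem γMap_tmul (a b c d : A) : Q.γMap (a ⊗ₜ (b ⊗ₜ (c ⊗ₜ d))) =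
    (Q.antipode b * Q.α * c) ⊗ₜ (Q.antipode a * Q.α * d) := rfl

/-- `γ = S(A²) α A³ ⊗ S(A¹) α A⁴`, where `A¹ ⊗ A² ⊗ A³ ⊗ A⁴ = (Φ ⊗ 1)(Δ ⊗ id ⊗ id)(Φ⁻¹)`. -/
def γ : A ⊗[k] A := Q.γMap (appendOne Q.Φ * Q.comulFirst Q.Φinv)

/-- `a ⊗ b ⊗ c ⊗ d ↦ a β S(d) ⊗ b β S(c)`. -/
def δMap : A ⊗[k] (A ⊗[k] (A ⊗[k] A)) →ₗ[k] A ⊗[k] A :=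
  (TensorProduct.comm k A A).toLinearMap ∘ₗ LinearMap.lTensor A Q.evβ ∘ₗ
    (TensorProduct.leftComm k A A A).toLinearMap ∘ₗ
    LinearMap.lTensor A
      (LinearMap.rTensor A Q.evβ ∘ₗ (TensorProduct.assoc k A A A).symm.toLinearMap)

theorem δMap_tmul (a b c d : A) : Q.δMap (a ⊗ₜ (b ⊗ₜ (c ⊗ₜ d))) =
    (a * Q.β * Q.antipode d) ⊗ₜ (b * Q.β * Q.antipode c) := rfl

/-- `δ = B¹ β S(B⁴) ⊗ B² β S(B³)`, where `B¹ ⊗ B² ⊗ B³ ⊗ B⁴ = (Δ ⊗ id ⊗ id)(Φ)(Φ⁻¹ ⊗ 1)`. -/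
def δ : A ⊗[k] A := Q.δMap (Q.comulFirst Q.Φ * appendOne Q.Φinv)

/-- The Drinfeld twist `f = (S ⊗ S)(Δᶜᵒᵖ(x¹)) γ Δ(x² β S(x³))`. -/
def f : A ⊗[k] A :=
  mulMap₂ (LinearMap.mulRight k Q.γ ∘ₗ Q.antipodeComulOp) (Q.comul ∘ₗ Q.evβ) Q.Φinv

/-- The inverse Drinfeld twist `f⁻¹ = Δ(S(x¹) α x²) δ (S ⊗ S)(Δᶜᵒᵖ(x³))`. -/
def fInv : A ⊗[k] A :=
  mulMap₂ (LinearMap.mulRight k Q.δ ∘ₗ Q.comul ∘ₗ Q.evα) Q.antipodeComulOp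
    ((TensorProduct.assoc k A A A).symm Q.Φinv)

/-- `U = g¹ S(q²) ⊗ g² S(q¹)`, where `f⁻¹ = g¹ ⊗ g²` and `q_R = q¹ ⊗ q²`. -/
def U : A ⊗[k] A :=
  Q.fInv * TensorProduct.map Q.antipode Q.antipode (TensorProduct.comm k A A Q.qR)

/-- `V = S⁻¹(f² p²) ⊗ S⁻¹(f¹ p¹)`, where `f = f¹ ⊗ f²` and `p_R = p¹ ⊗ p²`. -/
def V : A ⊗[k] A :=
  TensorProduct.comm k A A (TensorProduct.map Q.antipodeInv Q.antipodeInv (Q.f * Q.pR))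

/-- `λ` is a left cointegral: `λ(V² h₂ U²) V¹ h₁ U¹ = μ(x¹) λ(h S(x²)) x³` for all `h`, where `μ`
is the modular functional. -/
def IsLeftCointegral (l : A →ₗ[k] k) : Prop :=
  ∃ μ : A →ₗ[k] k, IsModularFunctional Q.counit μ ∧ ∀ h : A,
    contractRight l (Q.V * Q.comul h * Q.U) =
      contractLeft (l ∘ₗ LinearMap.mulLeft k h ∘ₗ Q.antipode) (contractLeft μ Q.Φinv)

/-- `g` is the modular element `λ(V¹ r₁ U¹) V² r₂ U²`, where `λ` is a left cointegral and `r` is a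
right integral with `λ(r) = 1`. -/
def IsModularElement (g : A) : Prop :=
  ∃ (l : A →ₗ[k] k) (r : A), Q.IsLeftCointegral l ∧ IsRightIntegral Q.counit r ∧ l r = 1 ∧
    g = contractLeft l (Q.V * Q.comul r * Q.U)

/-- `g` is the element `λ(S⁻¹(q² t₂ p²)) q¹ t₁ p¹`, where `λ` is a left cointegral and `t` is a
left integral with `λ(S⁻¹(t)) = 1`. -/
def IsLeftIntegralContraction (g : A) : Prop :=
  ∃ (l : A →ₗ[k] k) (t : A), Q.IsLeftCointegral l ∧ IsLeftIntegral Q.counit t ∧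
    l (Q.antipodeInv t) = 1 ∧
    g = contractRight (l ∘ₗ Q.antipodeInv) (Q.qR * Q.comul t * Q.pR)

end Operations

end QuasiHopfData

/-! ### The quantum double -/

section QuantumDouble

variable {k A : Type*} [Field k] [Ring A] [Algebra k A]

/-- The action of `A ⊗ Aᵒᵖ` on `A*`: `biact (a ⊗ b) φ = a ⇀ φ ↼ b`, that is, `x ↦ φ(b x a)`. -/
def biact : A ⊗[k] A →ₗ[k] Module.End k (Module.Dual k A) :=
  TensorProduct.lift
    (((LinearMap.mul k (Module.End k A)).compl₁₂ (LinearMap.mul k A)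
      (LinearMap.mul k A).flip).flip.compr₂ (Module.Dual.transpose (R := k)))

@[simp] theorem biact_tmul (a b x : A) (φ : Module.Dual k A) :
    biact (a ⊗ₜ[k] b) φ x = φ (b * (x * a)) := rfl

/-- The action on `A* ⊗ A` given by `(a ⊗ b) ⊗ c : φ ⊗ h ↦ (a ⇀ φ ↼ b) ⊗ c h`. -/
def biactMul : (A ⊗[k] A) ⊗[k] A →ₗ[k] Module.End k (Module.Dual k A ⊗[k] A) :=
  TensorProduct.homTensorHomMap (.id k) _ _ _ _ ∘ₗ TensorProduct.map biact (LinearMap.mul k A)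

@[simp] theorem biactMul_tmul (a b c h : A) (φ : Module.Dual k A) :
    biactMul ((a ⊗ₜ[k] b) ⊗ₜ[k] c) (φ ⊗ₜ[k] h) = biact (a ⊗ₜ[k] b) φ ⊗ₜ[k] (c * h) := rfl

/-- `(A ⊗ A) ⊗ A`, the tensors that act on `A* ⊗ A`. -/
abbrev Triple (k A : Type*) [Field k] [Ring A] [Algebra k A] : Type _ := (A ⊗[k] A) ⊗[k] A

instance : Ring (Triple k A) := inferInstance

instance : Algebra k (Triple k A) := inferInstance

instance : Ring (Triple k A ⊗[k] Triple k A) := inferInstance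

instance : Algebra k (Triple k A ⊗[k] Triple k A) := inferInstance

/-- The inclusions of `A` in the three factors of `(A ⊗ A) ⊗ A`. -/
def inl : A →ₗ[k] (A ⊗[k] A) ⊗[k] A :=
  (TensorProduct.mk k (A ⊗[k] A) A).flip 1 ∘ₗ (TensorProduct.mk k A A).flip 1

/-- See `QuasiHopf.inl`. -/
def inr : A →ₗ[k] (A ⊗[k] A) ⊗[k] A :=
  (TensorProduct.mk k (A ⊗[k] A) A).flip 1 ∘ₗ TensorProduct.mk k A A 1

/-- See `QuasiHopf.inl`. -/
def inm : A →ₗ[k] (A ⊗[k] A) ⊗[k] A := TensorProduct.mk k (A ⊗[k] A) A (1 ⊗ₜ 1)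

namespace QuasiHopfData

variable (Q : QuasiHopfData k A)

/-- The convolution product of `A*`, `(φψ)(h) = φ(h₁) ψ(h₂)`, as a map on `A* ⊗ A*`. -/
def dualMul : Module.Dual k A ⊗[k] Module.Dual k A →ₗ[k] Module.Dual k A :=
  Module.Dual.transpose (R := k) Q.comul ∘ₗ TensorProduct.dualDistrib k A A

/-- `Ω = X¹₍₁,₁₎ y¹ x¹ ⊗ X¹₍₁,₂₎ y² x²₁ ⊗ X¹₂ y³ x²₂ ⊗ S⁻¹(f¹ X² x³) ⊗ S⁻¹(f² X³)`, where
`Ω¹ ⊗ Ω² ⊗ Ω³ ⊗ Ω⁴ ⊗ Ω⁵` is stored in the order `(Ω¹ ⊗ Ω⁵) ⊗ ((Ω² ⊗ Ω⁴) ⊗ Ω³)`. -/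
def Ω : (A ⊗[k] A) ⊗[k] ((A ⊗[k] A) ⊗[k] A) :=
  let i₁ : A →ₗ[k] (A ⊗[k] A) ⊗[k] Triple k A :=
    (TensorProduct.mk k (A ⊗[k] A) (Triple k A)).flip 1 ∘ₗ (TensorProduct.mk k A A).flip 1
  let i₅ : A →ₗ[k] (A ⊗[k] A) ⊗[k] Triple k A :=
    (TensorProduct.mk k (A ⊗[k] A) (Triple k A)).flip 1 ∘ₗ TensorProduct.mk k A A 1
  let i₂ : A →ₗ[k] (A ⊗[k] A) ⊗[k] Triple k A := TensorProduct.mk k (A ⊗[k] A) (Triple k A) 1 ∘ₗ inl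
  let i₄ : A →ₗ[k] (A ⊗[k] A) ⊗[k] Triple k A := TensorProduct.mk k (A ⊗[k] A) (Triple k A) 1 ∘ₗ inr
  let i₃ : A →ₗ[k] (A ⊗[k] A) ⊗[k] Triple k A := TensorProduct.mk k (A ⊗[k] A) (Triple k A) 1 ∘ₗ inm
  TensorProduct.map (LinearMap.lTensor A Q.antipodeInv)
      (LinearMap.rTensor A (LinearMap.lTensor A Q.antipodeInv))
    (mulMap₂ i₄ i₅ Q.f *
      mulMap₃ (mulMap₃ i₁ i₂ i₃ ∘ₗ Q.comulLeft) i₄ i₅ Q.Φ *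
      mulMap₃ i₁ i₂ i₃ Q.Φinv *
      mulMap₃ i₁ (mulMap₂ i₂ i₃ ∘ₗ Q.comul) i₄ Q.Φinv)

/-- `φ ⊗ (ψ ⊗ h) ↦ (Ω¹ ⇀ φ ↼ Ω⁵)(Ω² ⇀ ψ ↼ Ω⁴) ⊗ Ω³ h`. -/
def ΩAct : Module.Dual k A ⊗[k] (Module.Dual k A ⊗[k] A) →ₗ[k] Module.Dual k A ⊗[k] A :=
  LinearMap.rTensor A Q.dualMul ∘ₗ
    (TensorProduct.assoc k (Module.Dual k A) (Module.Dual k A) A).symm.toLinearMap ∘ₗ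
    (TensorProduct.homTensorHomMap (.id k) _ _ _ _ ∘ₗ TensorProduct.map biact biactMul) Q.Ω

/-- `h ↦ (h₍₁,₁₎ ⊗ S⁻¹(h₂)) ⊗ h₍₁,₂₎`. -/
def splitComul : A →ₗ[k] (A ⊗[k] A) ⊗[k] A :=
  LinearMap.rTensor A (LinearMap.lTensor A Q.antipodeInv) ∘ₗ
    (TensorProduct.rightComm k A A A).toLinearMap ∘ₗ LinearMap.rTensor A Q.comul ∘ₗ Q.comul

/-- The multiplication of the diagonal crossed product `A* ⋈ A`:
`(φ ⋈ h)(ψ ⋈ h') = (Ω¹ ⇀ φ ↼ Ω⁵)(Ω² h₍₁,₁₎ ⇀ ψ ↼ S⁻¹(h₂) Ω⁴) ⋈ Ω³ h₍₁,₂₎ h'`. -/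
def doubleMul : Module.Dual k A ⊗[k] A →ₗ[k] Module.Dual k A ⊗[k] A →ₗ[k]
    Module.Dual k A ⊗[k] A :=
  TensorProduct.lift
    ((LinearMap.llcomp k (Module.Dual k A ⊗[k] A) (Module.Dual k A ⊗[k] A)
        (Module.Dual k A ⊗[k] A)).compl₁₂
      ((TensorProduct.mk k (Module.Dual k A) (Module.Dual k A ⊗[k] A)).compr₂ Q.ΩAct)
      (biactMul ∘ₗ Q.splitComul))

theorem doubleMul_tmul (φ : Module.Dual k A) (h : A) (y : Module.Dual k A ⊗[k] A) :
    Q.doubleMul (φ ⊗ₜ h) y = Q.ΩAct (φ ⊗ₜ biactMul (Q.splitComul h) y) := rfl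

end QuasiHopfData

/-- The underlying space `A* ⊗ A` of the quantum double `D(A) = A* ⋈ A` of a finite-dimensional
quasi-Hopf algebra. -/
def QuantumDouble (_Q : QuasiHopfData k A) : Type _ := Module.Dual k A ⊗[k] A

namespace QuantumDouble

variable (Q : QuasiHopfData k A)

instance : AddCommGroup (QuantumDouble Q) :=
  inferInstanceAs (AddCommGroup (Module.Dual k A ⊗[k] A))

instance : Module k (QuantumDouble Q) :=
  inferInstanceAs (Module k (Module.Dual k A ⊗[k] A))

instance : NonUnitalNonAssocRing (QuantumDouble Q) where
  mul x y := Q.doubleMul x y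
  left_distrib x y z := map_add (Q.doubleMul x) y z
  right_distrib x y z := LinearMap.map_add₂ Q.doubleMul x y z
  zero_mul x := LinearMap.map_zero₂ Q.doubleMul x
  mul_zero x := map_zero (Q.doubleMul x)

instance : SMulCommClass k (QuantumDouble Q) (QuantumDouble Q) where
  smul_comm c x y := ((Q.doubleMul x).map_smul c y).symm

instance : IsScalarTower k (QuantumDouble Q) (QuantumDouble Q) where
  smul_assoc c x y := LinearMap.map_smul₂ Q.doubleMul c x y

/-- The element `φ ⋈ h`. -/
def bowtie : Module.Dual k A →ₗ[k] A →ₗ[k] QuantumDouble Q :=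
  TensorProduct.mk k (Module.Dual k A) A

/-- The unit `ε ⋈ 1`. -/
instance : One (QuantumDouble Q) where
  one := bowtie Q Q.counit 1

/-- The inclusion `h ↦ ε ⋈ h` of `A`. -/
def incl : A →ₗ[k] QuantumDouble Q := bowtie Q Q.counit

/-- `a ↦ (x ↦ (ε ⋈ a) x)`. -/
def leftMulIncl : A →ₗ[k] Module.End k (QuantumDouble Q) :=
  LinearMap.mul k (QuantumDouble Q) ∘ₗ incl Q

/-- `QuasiHopf.biactMul` on the quantum double:
`(a ⊗ b) ⊗ c : φ ⋈ h ↦ (a ⇀ φ ↼ b) ⋈ c h`. -/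
def act : (A ⊗[k] A) ⊗[k] A →ₗ[k] Module.End k (QuantumDouble Q) := biactMul

/-- The element `X¹Y¹ ⊗ p¹₁x¹ ⊗ Y²S⁻¹(p²) ⊗ p¹₂x² ⊗ X²₁ ⊗ S⁻¹(X³) ⊗ X²₂Y³x³`, with its tensor factors
placed in an algebra `B` by means of the maps `i₀, …, i₆`. -/
def comulEltIn {B : Type*} [Ring B] [Algebra k B] (i₀ i₁ i₂ i₃ i₄ i₅ i₆ : A →ₗ[k] B) : B :=
  mulMap₃ i₀ (mulMap₂ i₄ i₆ ∘ₗ Q.comul) (i₅ ∘ₗ Q.antipodeInv) Q.Φ *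
    mulMap₃ i₀ i₂ i₆ Q.Φ *
    mulMap₂ (mulMap₂ i₁ i₃ ∘ₗ Q.comul) (i₂ ∘ₗ Q.antipodeInv) Q.pR *
    mulMap₃ i₁ i₃ i₆ Q.Φinv

set_option synthInstance.maxHeartbeats 200000 in
/-- The element
`X¹Y¹ ⊗ (((p¹₁x¹ ⊗ Y²S⁻¹(p²)) ⊗ p¹₂x²) ⊗ ((X²₁ ⊗ S⁻¹(X³)) ⊗ X²₂Y³x³))`. -/
def comulElt : A ⊗[k] (Triple k A ⊗[k] Triple k A) :=
  let left : Triple k A →ₗ[k] A ⊗[k] (Triple k A ⊗[k] Triple k A) :=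
    TensorProduct.mk k A (Triple k A ⊗[k] Triple k A) 1 ∘ₗ
      (TensorProduct.mk k (Triple k A) (Triple k A)).flip 1
  let right : Triple k A →ₗ[k] A ⊗[k] (Triple k A ⊗[k] Triple k A) :=
    TensorProduct.mk k A (Triple k A ⊗[k] Triple k A) 1 ∘ₗ
      TensorProduct.mk k (Triple k A) (Triple k A) 1
  comulEltIn Q (B := A ⊗[k] (Triple k A ⊗[k] Triple k A))
    ((TensorProduct.mk k A (Triple k A ⊗[k] Triple k A)).flip 1)
    (left ∘ₗ inl) (left ∘ₗ inr) (left ∘ₗ inm) (right ∘ₗ inl) (right ∘ₗ inr) (right ∘ₗ inm)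

/-- `s ⊗ (u ⊗ v)` acts on `D ⊗ D` by `x ⊗ y ↦ (ε ⋈ s)(u • x) ⊗ (v • y)`, where `•` is
`QuasiHopf.QuantumDouble.act`. -/
def comulAct : A ⊗[k] (((A ⊗[k] A) ⊗[k] A) ⊗[k] ((A ⊗[k] A) ⊗[k] A)) →ₗ[k]
    Module.End k (QuantumDouble Q ⊗[k] QuantumDouble Q) :=
  TensorProduct.homTensorHomMap (.id k) _ _ _ _ ∘ₗ
    TensorProduct.map (mulMap₂ (leftMulIncl Q) (act Q)) (act Q) ∘ₗ
    (TensorProduct.assoc k A ((A ⊗[k] A) ⊗[k] A) ((A ⊗[k] A) ⊗[k] A)).symm.toLinearMap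

theorem comulAct_tmul (s : A) (u v : (A ⊗[k] A) ⊗[k] A) (x y : QuantumDouble Q) :
    comulAct Q (s ⊗ₜ (u ⊗ₜ v)) (x ⊗ₜ y) = (incl Q s * act Q u x) ⊗ₜ act Q v y := rfl

/-- The comultiplication `φ ↦ φ₁ ⊗ φ₂` of `A*`, where `φ(ab) = φ₁(a) φ₂(b)`. -/
def dualComul (k A : Type*) [Field k] [Ring A] [Algebra k A] [Module.Finite k A] :
    Module.Dual k A →ₗ[k] Module.Dual k A ⊗[k] Module.Dual k A :=
  (TensorProduct.dualDistribEquiv k A A).symm.toLinearMap ∘ₗ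
    Module.Dual.transpose (R := k) (LinearMap.mul' k A)

/-- The comultiplication of the quantum double:
`Δ(φ ⋈ h) = (ε ⋈ X¹Y¹)(p¹₁x¹ ⇀ φ₂ ↼ Y²S⁻¹(p²) ⋈ p¹₂x²h₁) ⊗ (X²₁ ⇀ φ₁ ↼ S⁻¹(X³) ⋈ X²₂Y³x³h₂)`. -/
def comul [Module.Finite k A] :
    QuantumDouble Q →ₗ[k] QuantumDouble Q ⊗[k] QuantumDouble Q :=
  comulAct Q (comulElt Q) ∘ₗ
    (TensorProduct.tensorTensorTensorComm k (Module.Dual k A) (Module.Dual k A) A A).toLinearMap ∘ₗ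
    TensorProduct.map ((TensorProduct.comm k _ _).toLinearMap ∘ₗ dualComul k A) Q.comul

/-- The counit of the quantum double: `ε(φ ⋈ h) = φ(S⁻¹(α)) ε(h)`. -/
def counit : QuantumDouble Q →ₗ[k] k :=
  LinearMap.mul' k k ∘ₗ
    TensorProduct.map (Module.Dual.eval k A (Q.antipodeInv Q.α)) Q.counit

/-- The element `f¹ ⊗ ((p¹₁U¹ ⊗ f²S⁻¹(p²)) ⊗ p¹₂U²)`. -/
def antipodeElt : A ⊗[k] Triple k A :=
  let i₀ : A →ₗ[k] A ⊗[k] Triple k A := (TensorProduct.mk k A (Triple k A)).flip 1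
  let i₁ : A →ₗ[k] A ⊗[k] Triple k A := TensorProduct.mk k A (Triple k A) 1 ∘ₗ inl
  let i₂ : A →ₗ[k] A ⊗[k] Triple k A := TensorProduct.mk k A (Triple k A) 1 ∘ₗ inr
  let i₃ : A →ₗ[k] A ⊗[k] Triple k A := TensorProduct.mk k A (Triple k A) 1 ∘ₗ inm
  mulMap₂ i₀ i₂ Q.f *
    mulMap₂ (mulMap₂ i₁ i₃ ∘ₗ Q.comul) (i₂ ∘ₗ Q.antipodeInv) Q.pR *
    mulMap₂ i₁ i₃ Q.U

/-- `h ⊗ (s ⊗ u)` acts by `x ↦ (ε ⋈ S(h) s)(u • x)`. -/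
def antipodeAct : A ⊗[k] (A ⊗[k] ((A ⊗[k] A) ⊗[k] A)) →ₗ[k] Module.End k (QuantumDouble Q) :=
  mulMap₂ (leftMulIncl Q ∘ₗ mulMap₂ Q.antipode LinearMap.id) (act Q) ∘ₗ
    (TensorProduct.assoc k A A ((A ⊗[k] A) ⊗[k] A)).symm.toLinearMap

theorem antipodeAct_tmul (h s : A) (u : (A ⊗[k] A) ⊗[k] A) (x : QuantumDouble Q) :
    antipodeAct Q (h ⊗ₜ (s ⊗ₜ u)) x = incl Q (Q.antipode h * s) * act Q u x := rfl

/-- The antipode of the quantum double: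
`S(φ ⋈ h) = (ε ⋈ S(h)f¹)(p¹₁U¹ ⇀ φ ∘ S⁻¹ ↼ f²S⁻¹(p²) ⋈ p¹₂U²)`. -/
def antipode : QuantumDouble Q →ₗ[k] QuantumDouble Q :=
  TensorProduct.lift
    ((LinearMap.applyₗ (R := k) (M := QuantumDouble Q) (M₂ := QuantumDouble Q)).compl₁₂
      ((bowtie Q).flip 1 ∘ₗ Module.Dual.transpose (R := k) Q.antipodeInv)
      (antipodeAct Q ∘ₗ (TensorProduct.mk k A _).flip (antipodeElt Q)))

theorem antipode_bowtie (φ : Module.Dual k A) (h : A) :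
    antipode Q (bowtie Q φ h) =
      antipodeAct Q (h ⊗ₜ antipodeElt Q) (bowtie Q (φ ∘ₗ Q.antipodeInv) 1) := rfl

end QuantumDouble

/-- The quantum double `D(A)` of a finite-dimensional quasi-Hopf algebra `A`. Its reassociator and
its distinguished elements are those of `A`. -/
def quantumDouble [Module.Finite k A] (Q : QuasiHopfData k A) :
    QuasiHopfData k (QuantumDouble Q) where
  comul := QuantumDouble.comul Q
  counit := QuantumDouble.counit Q
  Φ := TensorProduct.map (QuantumDouble.incl Q)
    (TensorProduct.map (QuantumDouble.incl Q) (QuantumDouble.incl Q)) Q.Φ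
  Φinv := TensorProduct.map (QuantumDouble.incl Q)
    (TensorProduct.map (QuantumDouble.incl Q) (QuantumDouble.incl Q)) Q.Φinv
  antipode := QuantumDouble.antipode Q
  α := QuantumDouble.incl Q Q.α
  β := QuantumDouble.incl Q Q.β

end QuantumDouble

/-! ### The quasi-Hopf algebra `H*_ω` -/

section HopfDual

open WithConv

variable {k H : Type*} [Field k] [Ring H] [HopfAlgebra k H]

/-- The dual `H*` of a Hopf algebra with its convolution product, `(φψ)(h) = φ(h₁)ψ(h₂)`. -/
def HopfDual (k H : Type*) [Field k] [Ring H] [HopfAlgebra k H] : Type _ :=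
  WithConv (H →ₗ[k] k)

instance : Ring (HopfDual k H) := inferInstanceAs (Ring (WithConv (H →ₗ[k] k)))

instance : Algebra k (HopfDual k H) := inferInstanceAs (Algebra k (WithConv (H →ₗ[k] k)))

/-- The identity map from `H*` with its convolution product to the space of functionals on `H`. -/
def toDual (k H : Type*) [Field k] [Ring H] [HopfAlgebra k H] :
    HopfDual k H ≃ₗ[k] Module.Dual k H where
  toFun φ := ofConv (show WithConv (H →ₗ[k] k) from φ)
  invFun φ := show WithConv (H →ₗ[k] k) from toConv φ
  map_add' _ _ := rfl
  map_smul' _ _ := rfl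
  left_inv _ := rfl
  right_inv _ := rfl

theorem toDual_mul (φ ψ : HopfDual k H) : toDual k H (φ * ψ) =
    LinearMap.mul' k k ∘ₗ TensorProduct.map (toDual k H φ) (toDual k H ψ) ∘ₗ Coalgebra.comul := rfl

theorem toDual_one : toDual k H 1 = Coalgebra.counit := rfl

/-- Functionals on `H ⊗ H ⊗ H` with the convolution product. -/
abbrev ThreeCochain (k H : Type*) [Field k] [Ring H] [HopfAlgebra k H] : Type _ :=
  WithConv (H ⊗[k] (H ⊗[k] H) →ₗ[k] k)

instance [Module.Finite k H] : Module.Finite k (HopfDual k H) :=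
  Module.Finite.equiv (toDual k H).symm

/-- A normalized 3-cocycle in the Sweedler cohomology of `H` with coefficients in `k`: a
convolution invertible `ω : H ⊗ H ⊗ H → k` such that
`ω(x₁, y₁, z₁t₁) ω(x₂y₂, z₂, t₂) = ω(y₁, z₁, t₁) ω(x₁, y₂z₂, t₂) ω(x₂, y₃, z₃)` and
`ω(1, x, y) = ω(x, 1, y) = ω(x, y, 1) = ε(x) ε(y)`. -/
structure IsNormalizedThreeCocycle (ω : (ThreeCochain k H)ˣ) : Prop where
  /-- The factors are the functionals `ω(x, y, zt)`, `ω(xy, z, t)`, `ε(x)ω(y, z, t)`,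
  `ω(x, yz, t)` and `ω(x, y, z)ε(t)` of `x ⊗ y ⊗ z ⊗ t`; the product is convolution. -/
  cocycle :
    let m : H ⊗[k] H →ₗ[k] H := LinearMap.mul' k H
    let ω' : H ⊗[k] (H ⊗[k] H) →ₗ[k] k := (ω : ThreeCochain k H).ofConv
    (toConv (ω' ∘ₗ LinearMap.lTensor H (LinearMap.lTensor H m)) *
        toConv (ω' ∘ₗ LinearMap.rTensor (H ⊗[k] H) m ∘ₗ
          (TensorProduct.assoc k H H (H ⊗[k] H)).symm.toLinearMap) :
        WithConv (H ⊗[k] (H ⊗[k] (H ⊗[k] H)) →ₗ[k] k)) =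
      toConv (ω' ∘ₗ contractLeft Coalgebra.counit) *
        toConv (ω' ∘ₗ LinearMap.lTensor H (LinearMap.rTensor H m ∘ₗ
          (TensorProduct.assoc k H H H).symm.toLinearMap)) *
        toConv (ω' ∘ₗ LinearMap.lTensor H (LinearMap.lTensor H
          (contractRight Coalgebra.counit)))
  normalized_left : ∀ x y : H, (ω : ThreeCochain k H) (1 ⊗ₜ (x ⊗ₜ y)) =
    Coalgebra.counit (R := k) x * Coalgebra.counit (R := k) y
  normalized_middle : ∀ x y : H, (ω : ThreeCochain k H) (x ⊗ₜ (1 ⊗ₜ y)) =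
    Coalgebra.counit (R := k) x * Coalgebra.counit (R := k) y
  normalized_right : ∀ x y : H, (ω : ThreeCochain k H) (x ⊗ₜ (y ⊗ₜ 1)) =
    Coalgebra.counit (R := k) x * Coalgebra.counit (R := k) y

/-- The element `β ∈ H*`, `β(h) = ω(h₁, S(h₂), h₃)`. -/
def cocycleβ (ω : (ThreeCochain k H)ˣ) : HopfDual k H :=
  (toDual k H).symm ((ω : ThreeCochain k H).ofConv ∘ₗ
    LinearMap.lTensor H (LinearMap.rTensor H (HopfAlgebra.antipode k (A := H)) ∘ₗ
      Coalgebra.comul) ∘ₗ Coalgebra.comul)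

variable [Module.Finite k H]

/-- The identification `H* ⊗ H* = (H ⊗ H)*`. -/
def dualTensor₂ (k H : Type*) [Field k] [Ring H] [HopfAlgebra k H] [Module.Finite k H] :
    HopfDual k H ⊗[k] HopfDual k H ≃ₗ[k] Module.Dual k (H ⊗[k] H) :=
  (TensorProduct.congr (toDual k H) (toDual k H))
    ≪≫ₗ TensorProduct.dualDistribEquiv k H H

theorem dualTensor₂_tmul (φ ψ : HopfDual k H) (x y : H) :
    dualTensor₂ k H (φ ⊗ₜ ψ) (x ⊗ₜ y) = toDual k H φ x * toDual k H ψ y := by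
  simp [dualTensor₂, TensorProduct.dualDistribEquiv, TensorProduct.dualDistribEquivOfBasis]

/-- The identification `H* ⊗ H* ⊗ H* = (H ⊗ H ⊗ H)*`. -/
def dualTensor₃ (k H : Type*) [Field k] [Ring H] [HopfAlgebra k H] [Module.Finite k H] :
    HopfDual k H ⊗[k] (HopfDual k H ⊗[k] HopfDual k H) ≃ₗ[k]
      Module.Dual k (H ⊗[k] (H ⊗[k] H)) :=
  (TensorProduct.congr (toDual k H) (dualTensor₂ k H))
    ≪≫ₗ TensorProduct.dualDistribEquiv k H (H ⊗[k] H)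

theorem dualTensor₃_tmul (φ ψ χ : HopfDual k H) (x y z : H) :
    dualTensor₃ k H (φ ⊗ₜ (ψ ⊗ₜ χ)) (x ⊗ₜ (y ⊗ₜ z)) = toDual k H φ x * (toDual k H ψ y * toDual k H χ z) := by
  rw [← dualTensor₂_tmul]
  simp [dualTensor₃, TensorProduct.dualDistribEquiv, TensorProduct.dualDistribEquivOfBasis]

/-- The quasi-Hopf algebra `H*_ω`: the convolution algebra `H*` with the comultiplication
`φ ↦ φ₁ ⊗ φ₂`, `φ(xy) = φ₁(x) φ₂(y)`, the counit `φ ↦ φ(1)`, the reassociator `Φ = ω⁻¹`, the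
antipode `φ ↦ φ ∘ S`, and the distinguished elements `α = ε` (the unit of `H*`) and `β`. -/
def hopfDual (ω : (ThreeCochain k H)ˣ) : QuasiHopfData k (HopfDual k H) where
  comul := (dualTensor₂ k H).symm.toLinearMap ∘ₗ
    Module.Dual.transpose (R := k) (LinearMap.mul' k H) ∘ₗ
    (toDual k H).toLinearMap
  counit := Module.Dual.eval k H 1 ∘ₗ (toDual k H).toLinearMap
  Φ := (dualTensor₃ k H).symm ((ω⁻¹ : (ThreeCochain k H)ˣ) : ThreeCochain k H).ofConv
  Φinv := (dualTensor₃ k H).symm (ω : ThreeCochain k H).ofConv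
  antipode := (toDual k H).symm.toLinearMap ∘ₗ
    Module.Dual.transpose (R := k) (HopfAlgebra.antipode k (A := H)) ∘ₗ
    (toDual k H).toLinearMap
  α := 1
  β := cocycleβ ω

/-- The canonical map `H → (H*_ω)*`, `h ↦ (φ ↦ φ(h))`. -/
def evalHopfDual (h : H) : Module.Dual k (HopfDual k H) :=
  Module.Dual.eval k H h ∘ₗ (toDual k H).toLinearMap

end HopfDual

end QuasiHopf

end

/-! As `H` is cocommutative, `A = H*` is a commutative Hopf algebra: the functions on a finite group
scheme `G`, on which `ω` is a 3-cocycle with invertible values. A tensor in `A ⊗ ... ⊗ A` is a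
function of several points of `G` and is determined by its value at the universal tuple of points
(`eq_of_ev₂`). So every Sweedler formula in the definitions becomes a product of values of `ω`,
`ω⁻¹` and `β`, and products in `A ⊗ A` may be reordered freely.

The cocycle identity at `(x, x⁻¹, x, x⁻¹)` gives `β(x⁻¹) = β(x)⁻¹`. Values of `ω` and `ω⁻¹` then
cancel in pairs, leaving `(VU)(x, y) = β((xy)⁻¹) β(y)` and `(q p)(x, y) = β(y)` (`V_mul_U`,
`q_mul_p`). A commutative algebra is unimodular, so the cointegral equation says that `λ(β · )` is a
left invariant functional on `A`; hence `λ = m(β⁻¹ · )` up to a scalar, where `m` is the invariant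
functional, unique up to scalars. Let `r` be the integral with `m(r) = 1`. In `λ(V¹r₁U¹) V²r₂U²` one
factor `β` comes from `VU`, and a second one from moving `β⁻¹` across `Δ(r)` by `(b ⊗ 1)Δ(r) = (1 ⊗
S(b))Δ(r)`. What remains is `m(r₁) r₂`. This is `μ_H`, because `m` is evaluation at a left integral
of `H`. The element in the third statement is computed in the same way.

On the double `A* ⊗ A` all twists act through functions of a point `x` (acting on `A*`) and a point
`g` (acting on `A`): left multiplication by `ε ⋈ a` is the function `a(xgx⁻¹)` and right
multiplication is `a(g)`. Up to scalars `m ⋈ r` is the only left and the only right integral; it is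
two-sided because the factor `S(μ_H)` produced by conjugating `r` cancels the factor `μ_H` by which
`m` fails to be right invariant. The cointegrals are `φ ⋈ h ↦ φ(r) λ(h)` with `λ` a cointegral of
`A`. Pairing with `r` sets `x = 1`, where all additional cocycle factors are 1, and `p_R`, `q_R`,
`U`, `V` of the double are images of those of `A`. So the computation in the double reduces to the
one in `A`. -/

open scoped TensorProduct

noncomputable section

namespace QuasiHopf

/-! ### Points of a commutative Hopf algebra -/

section Points

variable {k A R : Type*} [Field k] [CommRing A] [HopfAlgebra k A] [CommRing R] [Algebra k R]

/-- The `R`-valued points of the group scheme of a commutative Hopf algebra `A`. -/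
def Point (k A R : Type*) [Field k] [CommRing A] [HopfAlgebra k A] [CommRing R] [Algebra k R] :
    Type _ := A →ₐ[k] R

namespace Point

instance : FunLike (Point k A R) A R := inferInstanceAs (FunLike (A →ₐ[k] R) A R)

instance : AlgHomClass (Point k A R) k A R := inferInstanceAs (AlgHomClass (A →ₐ[k] R) k A R)

/-- A point as an algebra homomorphism. -/
def toAlgHom (x : Point k A R) : A →ₐ[k] R := x

@[simp] theorem toAlgHom_apply (x : Point k A R) (a : A) : x.toAlgHom a = x a := rfl

@[ext] theorem ext {x y : Point k A R} (h : ∀ a, x a = y a) : x = y := DFunLike.ext _ _ h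

/-- Evaluation of an element of `A ⊗ A` at a pair of points. -/
def ev₂ (x y : Point k A R) : A ⊗[k] A →ₐ[k] R :=
  Algebra.TensorProduct.lift x.toAlgHom y.toAlgHom fun _ _ => .all _ _

/-- Evaluation of an element of `A ⊗ A ⊗ A` at a triple of points. -/
def ev₃ (x y z : Point k A R) : A ⊗[k] (A ⊗[k] A) →ₐ[k] R :=
  Algebra.TensorProduct.lift x.toAlgHom (ev₂ y z) fun _ _ => .all _ _

/-- Evaluation of an element of `A ⊗ A ⊗ A ⊗ A` at a quadruple of points. -/
def ev₄ (x y z t : Point k A R) : A ⊗[k] (A ⊗[k] (A ⊗[k] A)) →ₐ[k] R :=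
  Algebra.TensorProduct.lift x.toAlgHom (ev₃ y z t) fun _ _ => .all _ _

@[simp] theorem ev₂_tmul (x y : Point k A R) (a b : A) : ev₂ x y (a ⊗ₜ b) = x a * y b := by
  simp [ev₂]

@[simp] theorem ev₃_tmul (x y z : Point k A R) (a : A) (b : A ⊗[k] A) :
    ev₃ x y z (a ⊗ₜ b) = x a * ev₂ y z b := by
  simp [ev₃]

@[simp] theorem ev₄_tmul (x y z t : Point k A R) (a : A) (b : A ⊗[k] (A ⊗[k] A)) :
    ev₄ x y z t (a ⊗ₜ b) = x a * ev₃ y z t b := by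
  simp [ev₄]

instance : One (Point k A R) where
  one := (1 : WithConv (A →ₐ[k] R)).ofConv

instance : Mul (Point k A R) where
  mul x y := (WithConv.toConv x.toAlgHom * WithConv.toConv y.toAlgHom : WithConv (A →ₐ[k] R)).ofConv

instance : Inv (Point k A R) where
  inv x := x.toAlgHom.comp (HopfAlgebra.antipodeAlgHom k A)

theorem one_apply (a : A) :
    (1 : Point k A R) a = algebraMap k R (Coalgebra.counit a) := rfl

theorem mul_apply (x y : Point k A R) (a : A) :
    (x * y) a = ev₂ x y (Coalgebra.comul a) :=
  AlgHom.convMul_apply (WithConv.toConv x.toAlgHom) (WithConv.toConv y.toAlgHom) a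

theorem antipode_mul_apply (x : Point k A R) (a : A ⊗[k] A) :
    x (LinearMap.mul' k A (LinearMap.rTensor A (HopfAlgebra.antipode k) a)) = ev₂ x⁻¹ x a := by
  induction a with
  | zero => simp
  | add a b ha hb => simp only [map_add, ha, hb]
  | tmul a b =>
    simp only [LinearMap.rTensor_tmul, LinearMap.mul'_apply, map_mul, ev₂_tmul]
    rfl

instance : Group (Point k A R) :=
  Group.ofLeftAxioms
    (fun x y z => congrArg (WithConv.ofConv (A := A →ₐ[k] R))
      (mul_assoc (WithConv.toConv x.toAlgHom : WithConv (A →ₐ[k] R)) (WithConv.toConv y.toAlgHom)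
        (WithConv.toConv z.toAlgHom)))
    (fun x => congrArg (WithConv.ofConv (A := A →ₐ[k] R))
      (one_mul (WithConv.toConv x.toAlgHom : WithConv (A →ₐ[k] R))))
    (fun x => by
      ext a
      rw [mul_apply, ← antipode_mul_apply, HopfAlgebra.mul_antipode_rTensor_comul_apply,
        AlgHomClass.commutes, one_apply])

theorem apply_antipode (x : Point k A R) (a : A) : x (HopfAlgebra.antipode k a) = x⁻¹ a := rfl

end Point

/-- The antipode of a commutative Hopf algebra is an involution. -/
theorem antipode_antipode (a : A) :
    HopfAlgebra.antipode k (HopfAlgebra.antipode k a) = a := by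
  -- At the universal point the value of `S(S(a))` is `x⁻¹⁻¹ a`, and inversion in a group is an
  -- involution.
  let x : Point k A A := AlgHom.id k A
  have h : x⁻¹⁻¹ a = x a := by rw [inv_inv]
  exact h

namespace Point

theorem ev₂_comul (x y : Point k A R) (a : A) : ev₂ x y (Coalgebra.comul a) = (x * y) a :=
  (mul_apply x y a).symm

theorem ev₃_assoc_comul (x y z : Point k A R) (F : A ⊗[k] A) :
    ev₃ x y z (TensorProduct.assoc k A A A (LinearMap.rTensor A Coalgebra.comul F)) =
      ev₂ (x * y) z F := by
  have h : ∀ (G : A ⊗[k] A) (c : A), ev₃ x y z (TensorProduct.assoc k A A A (G ⊗ₜ c)) =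
      ev₂ x y G * z c := by
    intro G c
    induction G with
    | zero => simp
    | add a b ha hb => simp only [TensorProduct.add_tmul, map_add, ha, hb, add_mul]
    | tmul a b => simp [mul_assoc]
  induction F with
  | zero => simp
  | add a b ha hb => simp only [map_add, ha, hb]
  | tmul a b => simp [h, ev₂_comul]

theorem ev₃_lTensor_comul (x y z : Point k A R) (F : A ⊗[k] A) :
    ev₃ x y z (LinearMap.lTensor A Coalgebra.comul F) = ev₂ x (y * z) F := by
  induction F with
  | zero => simp
  | add a b ha hb => simp only [map_add, ha, hb]
  | tmul a b => simp [ev₂_comul]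

theorem ev₂_one_left (y : Point k A R) (F : A ⊗[k] A) :
    ev₂ 1 y F = y (contractLeft Coalgebra.counit F) := by
  induction F with
  | zero => simp
  | add a b ha hb => simp only [map_add, ha, hb]
  | tmul a b => simp [one_apply, Algebra.smul_def, AlgHomClass.commutes]

theorem ev₂_one_right (x : Point k A R) (F : A ⊗[k] A) :
    ev₂ x 1 F = x (contractRight Coalgebra.counit F) := by
  induction F with
  | zero => simp
  | add a b ha hb => simp only [map_add, ha, hb]
  | tmul a b => simp [one_apply, Algebra.smul_def, mul_comm, AlgHomClass.commutes]

theorem ev₃_one_left (y z : Point k A R) (F : A ⊗[k] (A ⊗[k] A)) :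
    ev₃ 1 y z F = ev₂ y z (contractLeft Coalgebra.counit F) := by
  induction F with
  | zero => simp
  | add a b ha hb => simp only [map_add, ha, hb]
  | tmul a b => simp [one_apply, Algebra.smul_def, AlgHomClass.commutes]

theorem ev₃_one_middle (x z : Point k A R) (F : A ⊗[k] (A ⊗[k] A)) :
    ev₃ x 1 z F = ev₂ x z (LinearMap.lTensor A (contractLeft Coalgebra.counit) F) := by
  induction F with
  | zero => simp
  | add a b ha hb => simp only [map_add, ha, hb]
  | tmul a b => simp [ev₂_one_left]

theorem ev₃_one_right (x y : Point k A R) (F : A ⊗[k] (A ⊗[k] A)) :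
    ev₃ x y 1 F = ev₂ x y (LinearMap.lTensor A (contractRight Coalgebra.counit) F) := by
  induction F with
  | zero => simp
  | add a b ha hb => simp only [map_add, ha, hb]
  | tmul a b => simp [ev₂_one_right]

/-- The first projection, as a point with values in `A ⊗ A`. -/
def fst₂ : Point k A (A ⊗[k] A) := Algebra.TensorProduct.includeLeft

/-- The second projection, as a point with values in `A ⊗ A`. -/
def snd₂ : Point k A (A ⊗[k] A) := Algebra.TensorProduct.includeRight

theorem fst₂_apply (a : A) : fst₂ a = a ⊗ₜ[k] (1 : A) := rfl

theorem snd₂_apply (a : A) : snd₂ a = (1 : A) ⊗ₜ[k] a := rfl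

theorem ev₂_universal (F : A ⊗[k] A) : ev₂ fst₂ snd₂ F = F := by
  induction F with
  | zero => simp
  | add a b ha hb => simp only [map_add, ha, hb]
  | tmul a b => simp [fst₂_apply, snd₂_apply]

/-- Yoneda: the pair of projections is the universal pair of points, and evaluation there is the
identity of `A ⊗ A`. Identities between tensors thus become identities in a group with a commutative
coefficient ring. -/
theorem eq_of_ev₂ {F G : A ⊗[k] A}
    (h : ∀ x y : Point k A (A ⊗[k] A), ev₂ x y F = ev₂ x y G) : F = G := by
  rw [← ev₂_universal F, h, ev₂_universal]

theorem eq_of_apply {a b : A} (h : ∀ x : Point k A A, x a = x b) : a = b :=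
  h (AlgHom.id k A : Point k A A)

section Map

variable {R' : Type*} [CommRing R'] [Algebra k R'] (e : R →ₐ[k] R')

/-- The image of a point under a homomorphism of coefficient algebras. -/
def comp (x : Point k A R) : Point k A R' := e.comp x.toAlgHom

theorem comp_apply (x : Point k A R) (a : A) : comp e x a = e (x a) := rfl

/-- Naturality in the coefficient algebra. It evaluates maps such as `conj₂`, which are given by
their effect on the universal pair of points. -/
theorem map_ev₂ (x y : Point k A R) (F : A ⊗[k] A) :
    e (ev₂ x y F) = ev₂ (comp e x) (comp e y) F := by
  induction F with
  | zero => simp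
  | add a b ha hb => simp only [map_add, ha, hb]
  | tmul a b => simp [comp_apply]

theorem comp_mul (x y : Point k A R) : comp e (x * y) = comp e x * comp e y := by
  ext a
  rw [mul_apply, comp_apply, mul_apply, map_ev₂]

theorem comp_inv (x : Point k A R) : comp e x⁻¹ = (comp e x)⁻¹ := rfl

theorem comp_fst₂ (x y : Point k A R) : comp (ev₂ x y) fst₂ = x := by
  ext a
  simp [comp_apply, fst₂_apply]

theorem comp_snd₂ (x y : Point k A R) : comp (ev₂ x y) snd₂ = y := by
  ext a
  simp [comp_apply, snd₂_apply]

end Map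

end Point

/-! Evaluation of products formed with `mulMap₂` and `mulMap₃` -/

section MulMap

variable {B : Type*} [Ring B] [Algebra k B] (e : B →ₐ[k] R)

open Point

/-- Here `i` and `j` place the legs of a tensor in factors of a larger algebra `B`. Once `e` turns
each placement into a point, the value of a long Sweedler expression is found by substituting
points; `Ω`, `comulElt` and `antipodeElt` are treated in this way. -/
theorem map_mulMap₂ {i j : A →ₗ[k] B} {x y : Point k A R} (hi : ∀ a, e (i a) = x a)
    (hj : ∀ a, e (j a) = y a) (F : A ⊗[k] A) : e (mulMap₂ i j F) = ev₂ x y F := by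
  induction F with
  | zero => simp
  | add a b ha hb => simp only [map_add, ha, hb]
  | tmul a b => simp [hi, hj]

theorem map_mulMap₃ {i j l : A →ₗ[k] B} {x y z : Point k A R} (hi : ∀ a, e (i a) = x a)
    (hj : ∀ a, e (j a) = y a) (hl : ∀ a, e (l a) = z a) (F : A ⊗[k] (A ⊗[k] A)) :
    e (mulMap₃ i j l F) = ev₃ x y z F := by
  have h := map_mulMap₂ e hj hl
  induction F with
  | zero => simp
  | add a b ha hb => simp only [map_add, ha, hb]
  | tmul a b =>
    change e (mulMap₂ i (mulMap₂ j l) (a ⊗ₜ b)) = _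
    simp [hi, h]

end MulMap

end Points

/-! ### Commutative twists -/

section Twist

open Point

variable {k A : Type*} [Field k] [CommRing A] [HopfAlgebra k A]

/-- The quasi-Hopf algebra structures obtained from a commutative Hopf algebra `A` and a normalized
3-cocycle `Φ⁻¹` on its group scheme, with `α = 1` and `β(x) = Φ⁻¹(x, x⁻¹, x)`. -/
structure IsTwist (Q : QuasiHopfData k A) : Prop where
  comul_eq : Q.comul = Coalgebra.comul
  counit_eq : Q.counit = Coalgebra.counit
  antipode_eq : Q.antipode = HopfAlgebra.antipode k
  α_eq : Q.α = 1
  β_eq : Q.β = mulMap₃ LinearMap.id (HopfAlgebra.antipode k) LinearMap.id Q.Φinv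
  Φ_mul_Φinv : Q.Φ * Q.Φinv = 1
  cocycle : LinearMap.lTensor A (LinearMap.lTensor A Q.comul) Q.Φinv * Q.comulFirst Q.Φinv =
    (1 ⊗ₜ Q.Φinv) * LinearMap.lTensor A
      ((TensorProduct.assoc k A A A).toLinearMap ∘ₗ LinearMap.rTensor A Q.comul) Q.Φinv *
      QuasiHopfData.appendOne Q.Φinv
  normalized_left : contractLeft Coalgebra.counit Q.Φinv = 1
  normalized_middle : LinearMap.lTensor A (contractLeft Coalgebra.counit) Q.Φinv = 1
  normalized_right : LinearMap.lTensor A (contractRight Coalgebra.counit) Q.Φinv = 1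

namespace IsTwist

variable {Q : QuasiHopfData k A} (hQ : IsTwist Q)
variable {R : Type*} [CommRing R] [Algebra k R]

/-- The value of the 3-cocycle `Φ⁻¹` at a triple of points. -/
abbrev w (Q : QuasiHopfData k A) (x y z : Point k A R) : R := ev₃ x y z Q.Φinv

/-- The value of `Φ` at a triple of points. -/
abbrev v (Q : QuasiHopfData k A) (x y z : Point k A R) : R := ev₃ x y z Q.Φ

include hQ

theorem v_mul_w (x y z : Point k A R) : v Q x y z * w Q x y z = 1 := by
  rw [v, w, ← map_mul, hQ.Φ_mul_Φinv, map_one]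

end IsTwist

end Twist

/-! ### Values of the canonical elements of a commutative twist -/

section TwistValues

open Point

variable {k A : Type*} [Field k] [CommRing A] [HopfAlgebra k A]

namespace IsTwist

variable {Q : QuasiHopfData k A} (hQ : IsTwist Q)
variable {R : Type*} [CommRing R] [Algebra k R]

include hQ

theorem w_mul_v (x y z : Point k A R) : w Q x y z * v Q x y z = 1 := by
  rw [mul_comm, hQ.v_mul_w]

theorem w_one_left (y z : Point k A R) : w Q 1 y z = 1 := by
  rw [w, ev₃_one_left, hQ.normalized_left, map_one]

theorem w_one_middle (x z : Point k A R) : w Q x 1 z = 1 := by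
  rw [w, ev₃_one_middle, hQ.normalized_middle, map_one]

theorem w_one_right (x y : Point k A R) : w Q x y 1 = 1 := by
  rw [w, ev₃_one_right, hQ.normalized_right, map_one]

theorem v_one_left (y z : Point k A R) : v Q 1 y z = 1 := by
  simpa [hQ.w_one_left] using hQ.v_mul_w 1 y z

theorem v_one_middle (x z : Point k A R) : v Q x 1 z = 1 := by
  simpa [hQ.w_one_middle] using hQ.v_mul_w x 1 z

theorem v_one_right (x y : Point k A R) : v Q x y 1 = 1 := by
  simpa [hQ.w_one_right] using hQ.v_mul_w x y 1

omit hQ in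
theorem ev₄_appendOne (x y z t : Point k A R) (F : A ⊗[k] (A ⊗[k] A)) :
    ev₄ x y z t (QuasiHopfData.appendOne F) = ev₃ x y z F := by
  have h : ∀ G : A ⊗[k] A,
      ev₃ y z t (LinearMap.lTensor A ((TensorProduct.mk k A A).flip 1) G) = ev₂ y z G := by
    intro G
    induction G with
    | zero => simp
    | add a b ha hb => simp only [map_add, ha, hb]
    | tmul a b => simp
  induction F with
  | zero => simp
  | add a b ha hb => simp only [map_add, ha, hb]
  | tmul a b => simp [QuasiHopfData.appendOne, h]

theorem ev₄_comulFirst (x y z t : Point k A R) (F : A ⊗[k] (A ⊗[k] A)) :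
    ev₄ x y z t (Q.comulFirst F) = ev₃ (x * y) z t F := by
  have h : ∀ (G : A ⊗[k] A) (H : A ⊗[k] A),
      ev₄ x y z t (TensorProduct.assoc k A A (A ⊗[k] A) (G ⊗ₜ H)) = ev₂ x y G * ev₂ z t H := by
    intro G H
    induction G with
    | zero => simp
    | add a b ha hb => simp only [TensorProduct.add_tmul, map_add, ha, hb, add_mul]
    | tmul a b => simp [mul_assoc]
  induction F with
  | zero => simp
  | add a b ha hb => simp only [map_add, ha, hb]
  | tmul a b => simp [QuasiHopfData.comulFirst, h, hQ.comul_eq, ev₂_comul]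

theorem w_cocycle (x y z t : Point k A R) :
    w Q x y (z * t) * w Q (x * y) z t = w Q y z t * w Q x (y * z) t * w Q x y z := by
  have h1 : ∀ F : A ⊗[k] (A ⊗[k] A), ev₄ x y z t
      (LinearMap.lTensor A (LinearMap.lTensor A Q.comul) F) = ev₃ x y (z * t) F := by
    intro F
    induction F with
    | zero => simp
    | add a b ha hb => simp only [map_add, ha, hb]
    | tmul a b => simp [hQ.comul_eq, ev₃_lTensor_comul]
  have h2 : ∀ F : A ⊗[k] (A ⊗[k] A), ev₄ x y z t (LinearMap.lTensor A
      ((TensorProduct.assoc k A A A).toLinearMap ∘ₗ LinearMap.rTensor A Q.comul) F) =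
      ev₃ x (y * z) t F := by
    intro F
    induction F with
    | zero => simp
    | add a b ha hb => simp only [map_add, ha, hb]
    | tmul a b => simp [hQ.comul_eq, ev₃_assoc_comul]
  have h := congrArg (ev₄ x y z t) hQ.cocycle
  simpa [h1, h2, hQ.ev₄_comulFirst, ev₄_appendOne] using h

theorem β_apply (x : Point k A R) : x Q.β = w Q x x⁻¹ x := by
  rw [hQ.β_eq]
  exact map_mulMap₃ x.toAlgHom (fun _ => rfl) (fun _ => rfl) (fun _ => rfl) _

/-- The cocycle identity at `(x, x⁻¹, x, x⁻¹)`: three of its five factors have an argument equal to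
1 and disappear by normalization. -/
theorem w_inv_mul_β (x : Point k A R) : w Q x⁻¹ x x⁻¹ * x Q.β = 1 := by
  have h := hQ.w_cocycle x x⁻¹ x x⁻¹
  simp only [mul_inv_cancel, inv_mul_cancel, hQ.w_one_left, hQ.w_one_middle, hQ.w_one_right] at h
  rw [hQ.β_apply]
  simpa using h.symm

/-- In other words `S(β) = β⁻¹`, the only consequence of the cocycle identity that the computation
needs. -/
theorem β_inv_mul_β (x : Point k A R) : x⁻¹ Q.β * x Q.β = 1 := by
  rw [hQ.β_apply x⁻¹, inv_inv, hQ.w_inv_mul_β]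

theorem β_mul_β_inv (x : Point k A R) : x Q.β * x⁻¹ Q.β = 1 := by
  rw [mul_comm, hQ.β_inv_mul_β]

theorem antipodeInv_eq : Q.antipodeInv = HopfAlgebra.antipode k := by
  have h : (HopfAlgebra.antipode k : Module.End k A) * HopfAlgebra.antipode k = 1 :=
    LinearMap.ext antipode_antipode
  rw [QuasiHopfData.antipodeInv, hQ.antipode_eq]
  exact Ring.inverse_unit ⟨_, _, h, h⟩

/-- The factors of `x² β S(x³)` are multiplied in one copy of `A`, so all are evaluated at `y`, and
`S` replaces `y` by `y⁻¹`. The formulas for `q_R`, `γ` and `δ` arise in the same way. -/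
theorem ev₂_pR (x y : Point k A R) : ev₂ x y Q.pR = w Q x y y⁻¹ * y Q.β := by
  have h' : ∀ F : A ⊗[k] A, y (Q.evβ F) = ev₂ y y⁻¹ F * y Q.β := by
    intro F
    induction F with
    | zero => simp
    | add a b ha hb => simp only [map_add, ha, hb, add_mul]
    | tmul a b => simp [hQ.antipode_eq, apply_antipode, mul_right_comm]
  have h : ∀ F : A ⊗[k] (A ⊗[k] A), ev₂ x y (LinearMap.lTensor A Q.evβ F) =
      ev₃ x y y⁻¹ F * y Q.β := by
    intro F
    induction F with
    | zero => simp
    | add a b ha hb => simp only [map_add, ha, hb, add_mul]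
    | tmul a b => simp [h', mul_assoc]
  exact h _

theorem ev₂_qR (x y : Point k A R) : ev₂ x y Q.qR = v Q x y y⁻¹ := by
  have h' : ∀ F : A ⊗[k] A, y (mulMap₂ (Q.antipodeInv ∘ₗ LinearMap.mulLeft k Q.α) LinearMap.id
      (TensorProduct.comm k A A F)) = ev₂ y y⁻¹ F := by
    intro F
    induction F with
    | zero => simp
    | add a b ha hb => simp only [map_add, ha, hb]
    | tmul a b => simp [hQ.antipodeInv_eq, hQ.α_eq, apply_antipode, mul_comm]
  have h : ∀ F : A ⊗[k] (A ⊗[k] A), ev₂ x y (LinearMap.lTensor A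
      (mulMap₂ (Q.antipodeInv ∘ₗ LinearMap.mulLeft k Q.α) LinearMap.id ∘ₗ
      (TensorProduct.comm k A A).toLinearMap) F) = ev₃ x y y⁻¹ F := by
    intro F
    induction F with
    | zero => simp
    | add a b ha hb => simp only [map_add, ha, hb]
    | tmul a b => simp [h']
  exact h _

theorem ev₂_γMap (x y : Point k A R) (F : A ⊗[k] (A ⊗[k] (A ⊗[k] A))) :
    ev₂ x y (Q.γMap F) = ev₄ y⁻¹ x⁻¹ x y F := by
  induction F with
  | zero => simp
  | add a b ha hb => simp only [map_add, ha, hb]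
  | tmul a F =>
    induction F with
    | zero => simp
    | add a b ha hb => simp only [TensorProduct.tmul_add, map_add, ha, hb]
    | tmul b F =>
      induction F with
      | zero => simp
      | add a b ha hb => simp only [TensorProduct.tmul_add, map_add, ha, hb]
      | tmul c d =>
        simp only [QuasiHopfData.γMap_tmul, ev₂_tmul, ev₃_tmul, ev₄_tmul, hQ.α_eq, mul_one,
          map_mul, hQ.antipode_eq, apply_antipode]
        ring

theorem ev₂_γ (x y : Point k A R) :
    ev₂ x y Q.γ = v Q y⁻¹ x⁻¹ x * w Q (y⁻¹ * x⁻¹) x y := by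
  rw [QuasiHopfData.γ, hQ.ev₂_γMap, map_mul, ev₄_appendOne, hQ.ev₄_comulFirst]

theorem ev₂_δMap (x y : Point k A R) (F : A ⊗[k] (A ⊗[k] (A ⊗[k] A))) :
    ev₂ x y (Q.δMap F) = ev₄ x y y⁻¹ x⁻¹ F * (x Q.β * y Q.β) := by
  induction F with
  | zero => simp
  | add a b ha hb => simp only [map_add, ha, hb, add_mul]
  | tmul a F =>
    induction F with
    | zero => simp
    | add a b ha hb => simp only [TensorProduct.tmul_add, map_add, ha, hb, add_mul]
    | tmul b F =>
      induction F with
      | zero => simp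
      | add a b ha hb => simp only [TensorProduct.tmul_add, map_add, ha, hb, add_mul]
      | tmul c d =>
        simp only [QuasiHopfData.δMap_tmul, ev₂_tmul, ev₃_tmul, ev₄_tmul,
          map_mul, hQ.antipode_eq, apply_antipode]
        ring

theorem ev₂_δ (x y : Point k A R) :
    ev₂ x y Q.δ = v Q (x * y) y⁻¹ x⁻¹ * w Q x y y⁻¹ * (x Q.β * y Q.β) := by
  rw [QuasiHopfData.δ, hQ.ev₂_δMap, map_mul, ev₄_appendOne, hQ.ev₄_comulFirst]

theorem ev₂_antipodeComulOp (x y : Point k A R) (a : A) :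
    ev₂ x y (Q.antipodeComulOp a) = (x * y)⁻¹ a := by
  have h : ∀ F : A ⊗[k] A, ev₂ x y (TensorProduct.map Q.antipode Q.antipode
      (TensorProduct.comm k A A F)) = ev₂ y⁻¹ x⁻¹ F := by
    intro F
    induction F with
    | zero => simp
    | add a b ha hb => simp only [map_add, ha, hb]
    | tmul a b => simp [hQ.antipode_eq, apply_antipode, mul_comm]
  rw [mul_inv_rev, ← ev₂_comul, ← h, ← hQ.comul_eq]
  rfl

/-- With `z = xy`, the factors around `γ` contribute `ω(z⁻¹, z, z⁻¹) β(z) = 1`, so the Drinfeld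
twist is just `γ`. -/
theorem ev₂_f (x y : Point k A R) :
    ev₂ x y Q.f = v Q y⁻¹ x⁻¹ x * w Q (y⁻¹ * x⁻¹) x y := by
  have h' : ∀ F : A ⊗[k] A, ev₂ x y (Q.comul (Q.evβ F)) =
      ev₂ (x * y) (x * y)⁻¹ F * (x * y) Q.β := by
    intro F
    induction F with
    | zero => simp
    | add a b ha hb => simp only [map_add, ha, hb, add_mul]
    | tmul a b => simp [hQ.comul_eq, ev₂_comul, hQ.antipode_eq, apply_antipode, mul_right_comm]
  have h : ∀ F : A ⊗[k] (A ⊗[k] A), ev₂ x y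
      (mulMap₂ (LinearMap.mulRight k Q.γ ∘ₗ Q.antipodeComulOp) (Q.comul ∘ₗ Q.evβ) F) =
      ev₃ (x * y)⁻¹ (x * y) (x * y)⁻¹ F * (x * y) Q.β * ev₂ x y Q.γ := by
    intro F
    induction F with
    | zero => simp
    | add a b ha hb => simp only [map_add, ha, hb, add_mul]
    | tmul a b =>
      simp only [mulMap₂_tmul, LinearMap.comp_apply, LinearMap.mulRight_apply, map_mul, h',
        hQ.ev₂_antipodeComulOp, ev₃_tmul]
      ring
  rw [QuasiHopfData.f, h, hQ.w_inv_mul_β, one_mul, hQ.ev₂_γ]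

/-- With `z = xy`, the factors around `δ` contribute `ω(z⁻¹, z, z⁻¹)`, which is `β(z⁻¹)`. -/
theorem ev₂_fInv (x y : Point k A R) :
    ev₂ x y Q.fInv = (x * y)⁻¹ Q.β * ev₂ x y Q.δ := by
  have h' : ∀ F : A ⊗[k] A, ev₂ x y (Q.comul (Q.evα F)) = ev₂ (x * y)⁻¹ (x * y) F := by
    intro F
    induction F with
    | zero => simp
    | add a b ha hb => simp only [map_add, ha, hb]
    | tmul a b =>
      simp [hQ.comul_eq, ev₂_comul, hQ.antipode_eq, apply_antipode, hQ.α_eq]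
  have h'' : ∀ (F : A ⊗[k] A) (c : A), ev₂ x y
      (mulMap₂ (LinearMap.mulRight k Q.δ ∘ₗ Q.comul ∘ₗ Q.evα) Q.antipodeComulOp (F ⊗ₜ c)) =
      ev₂ (x * y)⁻¹ (x * y) F * (x * y)⁻¹ c * ev₂ x y Q.δ := by
    intro F c
    simp only [mulMap₂_tmul, LinearMap.comp_apply, LinearMap.mulRight_apply, map_mul, h',
        hQ.ev₂_antipodeComulOp]
    ring
  have h : ∀ F : A ⊗[k] (A ⊗[k] A), ev₂ x y
      (mulMap₂ (LinearMap.mulRight k Q.δ ∘ₗ Q.comul ∘ₗ Q.evα) Q.antipodeComulOp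
        ((TensorProduct.assoc k A A A).symm F)) =
      ev₃ (x * y)⁻¹ (x * y) (x * y)⁻¹ F * ev₂ x y Q.δ := by
    intro F
    induction F with
    | zero => simp
    | add a b ha hb => simp only [map_add, ha, hb, add_mul]
    | tmul a F =>
      induction F with
      | zero => simp
      | add a b ha hb => simp only [TensorProduct.tmul_add, map_add, ha, hb, add_mul]
      | tmul b c =>
        rw [TensorProduct.assoc_symm_tmul, h'']
        simp only [ev₃_tmul, ev₂_tmul]
        ring
  rw [QuasiHopfData.fInv, h, hQ.β_apply, inv_inv]

theorem ev₂_U (x y : Point k A R) : ev₂ x y Q.U = ev₂ x y Q.fInv * v Q y⁻¹ x⁻¹ x := by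
  have h : ∀ F : A ⊗[k] A, ev₂ x y (TensorProduct.map Q.antipode Q.antipode
      (TensorProduct.comm k A A F)) = ev₂ y⁻¹ x⁻¹ F := by
    intro F
    induction F with
    | zero => simp
    | add a b ha hb => simp only [map_add, ha, hb]
    | tmul a b => simp [hQ.antipode_eq, apply_antipode, mul_comm]
  rw [QuasiHopfData.U, map_mul, h, hQ.ev₂_qR, inv_inv]

theorem ev₂_V (x y : Point k A R) :
    ev₂ x y Q.V = ev₂ y⁻¹ x⁻¹ Q.f * ev₂ y⁻¹ x⁻¹ Q.pR := by
  have h : ∀ F : A ⊗[k] A, ev₂ x y (TensorProduct.comm k A A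
      (TensorProduct.map Q.antipodeInv Q.antipodeInv F)) = ev₂ y⁻¹ x⁻¹ F := by
    intro F
    induction F with
    | zero => simp
    | add a b ha hb => simp only [map_add, ha, hb]
    | tmul a b => simp [hQ.antipodeInv_eq, apply_antipode, mul_comm]
  rw [QuasiHopfData.V, h, map_mul]

/-- Every value of `ω` in `V` or `U` meets the corresponding value of `ω⁻¹` in the product, and
`β(x⁻¹)` from `p_R` cancels `β(x)` from `δ`. Only the outer factor of `f⁻¹` and one `β(y)` survive.
-/
theorem ev₂_V_mul_U (x y : Point k A R) :
    ev₂ x y (Q.V * Q.U) = (x * y)⁻¹ Q.β * y Q.β := by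
  rw [map_mul, hQ.ev₂_V, hQ.ev₂_U, hQ.ev₂_f, hQ.ev₂_pR, hQ.ev₂_fInv, hQ.ev₂_δ]
  simp only [inv_inv]
  have h1 := hQ.v_mul_w x y y⁻¹
  have h2 := hQ.v_mul_w (x * y) y⁻¹ x⁻¹
  have h3 := hQ.v_mul_w y⁻¹ x⁻¹ x
  have h4 := hQ.β_inv_mul_β x
  calc _ = (v Q x y y⁻¹ * w Q x y y⁻¹) * (v Q (x * y) y⁻¹ x⁻¹ * w Q (x * y) y⁻¹ x⁻¹) *
        (v Q y⁻¹ x⁻¹ x * w Q y⁻¹ x⁻¹ x) * (x⁻¹ Q.β * x Q.β) * ((x * y)⁻¹ Q.β * y Q.β) := by ring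
    _ = _ := by rw [h1, h2, h3, h4]; ring

theorem V_mul_U : Q.V * Q.U =
    Coalgebra.comul (HopfAlgebra.antipode k Q.β) * (1 ⊗ₜ[k] Q.β) := by
  refine eq_of_ev₂ fun x y => ?_
  rw [hQ.ev₂_V_mul_U, map_mul, ev₂_comul, apply_antipode, ev₂_tmul, map_one, one_mul]

theorem q_mul_p : Q.qR * Q.pR = 1 ⊗ₜ[k] Q.β := by
  refine eq_of_ev₂ fun x y => ?_
  rw [map_mul, hQ.ev₂_qR, hQ.ev₂_pR, ← mul_assoc, hQ.v_mul_w, ev₂_tmul, map_one]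

theorem antipode_β_mul_β : HopfAlgebra.antipode k Q.β * Q.β = 1 :=
  hQ.β_inv_mul_β (AlgHom.id k A : Point k A A)

end IsTwist

end TwistValues

/-! ### Integrals of a finite-dimensional commutative Hopf algebra and of its dual -/

section CommutativeIntegrals

open Point

variable {k A : Type*} [Field k] [CommRing A] [HopfAlgebra k A]

section Contract

theorem contractRight_tmul_one_mul (m : A →ₗ[k] k) (c : A) (F : A ⊗[k] A) :
    contractRight m ((c ⊗ₜ 1) * F) = c * contractRight m F := by
  induction F with
  | zero => simp
  | add a b ha hb => simp only [map_add, mul_add, ha, hb]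
  | tmul a b => simp

theorem contractLeft_one_tmul_mul (m : A →ₗ[k] k) (c : A) (F : A ⊗[k] A) :
    contractLeft m ((1 ⊗ₜ c) * F) = c * contractLeft m F := by
  induction F with
  | zero => simp
  | add a b ha hb => simp only [map_add, mul_add, ha, hb]
  | tmul a b => simp

theorem contractRight_one_tmul_mul (m : A →ₗ[k] k) (c : A) (F : A ⊗[k] A) :
    contractRight m ((1 ⊗ₜ c) * F) = contractRight (m ∘ₗ LinearMap.mulLeft k c) F := by
  induction F with
  | zero => simp
  | add a b ha hb => simp only [map_add, mul_add, ha, hb]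
  | tmul a b => simp

theorem contractLeft_tmul_one_mul (m : A →ₗ[k] k) (c : A) (F : A ⊗[k] A) :
    contractLeft m ((c ⊗ₜ 1) * F) = contractLeft (m ∘ₗ LinearMap.mulLeft k c) F := by
  induction F with
  | zero => simp
  | add a b ha hb => simp only [map_add, mul_add, ha, hb]
  | tmul a b => simp

theorem apply_contractRight {M N : Type*} [AddCommGroup M] [Module k M] [AddCommGroup N]
    [Module k N] (z : M →ₗ[k] k) (m : N →ₗ[k] k) (F : M ⊗[k] N) :
    z (contractRight m F) = m (contractLeft z F) := by
  induction F with
  | zero => simp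
  | add a b ha hb => simp only [map_add, ha, hb]
  | tmul a b => simp [mul_comm]

theorem contractRight_counit_comul (a : A) :
    contractRight (Coalgebra.counit (R := k)) (Coalgebra.comul a) = a := by
  simp [contractRight]

theorem contractLeft_counit_comul (a : A) :
    contractLeft (Coalgebra.counit (R := k)) (Coalgebra.comul a) = a := by
  simp [contractLeft]

end Contract

/-- Left invariant functionals on `A`, that is, left integrals of the dual of `A`. -/
def IsLeftInvariant (m : A →ₗ[k] k) : Prop :=
  ∀ a : A, contractRight m (Coalgebra.comul a) = m a • (1 : A)

/-- The identity `b(y) = b(x⁻¹ · xy)` of functions of `(x, y)`, that is, `1 ⊗ b = (S(b₁) ⊗ 1)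
Δ(b₂)`. -/
theorem one_tmul_eq_mulMap₂ (b : A) :
    (1 : A) ⊗ₜ[k] b = mulMap₂
      ((TensorProduct.mk k A A).flip 1 ∘ₗ HopfAlgebra.antipode k) Coalgebra.comul
      (Coalgebra.comul b) := by
  refine eq_of_ev₂ fun x y => ?_
  rw [map_mulMap₂ (ev₂ x y) (x := x⁻¹) (y := x * y) (fun a => by simp [apply_antipode])
    (fun a => ev₂_comul x y a), ev₂_comul, inv_mul_cancel_left]
  simp

namespace IsLeftInvariant

/-- After `1 ⊗ b` is rewritten as `(S(b₁) ⊗ 1) Δ(b₂)`, invariance applies to the product `b₂ a`. In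
Sweedler notation: `a₁ m(b a₂) = S(b₁) m(a b₂)`. -/
theorem contract_comul_mul {m : A →ₗ[k] k} (hm : IsLeftInvariant m) (a b : A) :
    contractRight m ((1 ⊗ₜ b) * Coalgebra.comul a) = contractRight (m ∘ₗ LinearMap.mulLeft k a)
      (LinearMap.rTensor A (HopfAlgebra.antipode k) (Coalgebra.comul b)) := by
  have h : ∀ F : A ⊗[k] A, contractRight m (mulMap₂
      ((TensorProduct.mk k A A).flip 1 ∘ₗ HopfAlgebra.antipode k) Coalgebra.comul F *
        Coalgebra.comul a) = contractRight (m ∘ₗ LinearMap.mulLeft k a)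
      (LinearMap.rTensor A (HopfAlgebra.antipode k) F) := by
    intro F
    induction F with
    | zero => simp
    | add a b ha hb => simp only [map_add, add_mul, ha, hb]
    | tmul c d =>
      have h1 := hm (d * a)
      rw [Bialgebra.comul_mul] at h1
      simp only [mulMap₂_tmul, LinearMap.comp_apply, LinearMap.flip_apply, TensorProduct.mk_apply,
        mul_assoc, contractRight_tmul_one_mul, h1]
      simp [mul_comm]
  rw [one_tmul_eq_mulMap₂, h]

/-- Non-degeneracy of the form `m(ab)`, the Frobenius property. Its radical is stable under `a ↦
z(a₁) a₂` for every functional `z`, and the counit vanishes on it; but the counit of `z(a₁) a₂` is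
`z(a)`. -/
theorem eq_zero_of_forall_mul [Module.Finite k A] {m : A →ₗ[k] k} (hm : IsLeftInvariant m)
    (h0 : m ≠ 0) {a : A} (ha : ∀ b, m (a * b) = 0) : a = 0 := by
  have h1 : ∀ a : A, (∀ b, m (a * b) = 0) → ∀ b,
      contractRight m ((1 ⊗ₜ b) * Coalgebra.comul a) = 0 := by
    intro a ha b
    have : m ∘ₗ LinearMap.mulLeft k a = 0 := LinearMap.ext fun b => ha b
    rw [hm.contract_comul_mul, this]
    simp [contractRight]
  have h2 : ∀ a : A, (∀ b, m (a * b) = 0) → Coalgebra.counit (R := k) a = 0 := by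
    intro a ha
    obtain ⟨c, hc⟩ : ∃ c, m c ≠ 0 := by
      by_contra! h
      exact h0 (LinearMap.ext h)
    -- From `S(a₁) a₂ = ε(a)` one gets `ε(a) m(c) = m(S(a₁) a₂ c)`. Expanding `a₁` in a basis turns
    -- this into a sum of coordinates of the vectors `a₁ m(S(eᵢ) c a₂)`, which vanish by `h1`.
    let e := Module.finBasis k A
    have h3 : ∀ F : A ⊗[k] A, m (LinearMap.mul' k A
        (LinearMap.rTensor A (HopfAlgebra.antipode k) F) * c) =
        ∑ i, e.coord i (contractRight m ((1 ⊗ₜ (HopfAlgebra.antipode k (e i) * c)) * F)) := by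
      intro F
      induction F with
      | zero => simp
      | add a b ha hb => simp only [map_add, add_mul, mul_add, ha, hb, Finset.sum_add_distrib]
      | tmul x y =>
        have hx : HopfAlgebra.antipode k x * y * c =
            ∑ i, e.coord i x • (HopfAlgebra.antipode k (e i) * c * y) := by
          conv_lhs => rw [← e.sum_repr x]
          simp only [map_sum, map_smul, Finset.sum_mul, smul_mul_assoc]
          exact Finset.sum_congr rfl fun i _ => by rw [mul_right_comm]; rfl
        simp only [LinearMap.rTensor_tmul, LinearMap.mul'_apply, hx, map_sum, map_smul,
          Algebra.TensorProduct.tmul_mul_tmul, contractRight_tmul, one_mul, smul_eq_mul,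
          mul_comm (e.coord _ x)]
    have h4 := h3 (Coalgebra.comul a)
    rw [HopfAlgebra.mul_antipode_rTensor_comul_apply,
      Finset.sum_eq_zero fun i _ => by rw [h1 a ha, map_zero], ← Algebra.smul_def, map_smul,
      smul_eq_mul] at h4
    exact (mul_eq_zero.mp h4).resolve_right hc
  refine (Module.forall_dual_apply_eq_zero_iff k a).mp fun z => ?_
  have h5 : ∀ b, m (contractLeft z (Coalgebra.comul a) * b) = 0 := by
    intro b
    have := congrArg z (h1 a ha b)
    rwa [apply_contractRight, contractLeft_one_tmul_mul, map_zero, mul_comm] at this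
  have h6 := h2 _ h5
  rwa [← apply_contractRight, contractRight_counit_comul] at h6

theorem exists_dual [Module.Finite k A] {m : A →ₗ[k] k} (hm : IsLeftInvariant m) (h0 : m ≠ 0) :
    ∃ r : A, ∀ a, m (a * r) = Coalgebra.counit (R := k) a := by
  have hinj : Function.Injective ((LinearMap.mul k A).compr₂ m) := by
    refine (injective_iff_map_eq_zero _).mpr fun a ha => hm.eq_zero_of_forall_mul h0 fun b => ?_
    exact LinearMap.congr_fun ha b
  have hsurj := (LinearMap.injective_iff_surjective_of_finrank_eq_finrank
    (Subspace.dual_finrank_eq (K := k) (V := A)).symm).mp hinj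
  obtain ⟨r, hr⟩ := hsurj (Coalgebra.counit (R := k))
  exact ⟨r, fun a => by rw [mul_comm]; exact LinearMap.congr_fun hr a⟩

end IsLeftInvariant

/-! Existence of a non-zero invariant functional -/

section Existence

/-- The operator `c ↦ c₁ φ(c₂)`. -/
def translate (φ : A →ₗ[k] k) : A →ₗ[k] A := contractRight φ ∘ₗ Coalgebra.comul

/-- Coassociativity. Geometrically, `translate φ` averages over translations on one side and so
commutes with translations on the other. -/
theorem comul_translate (φ : A →ₗ[k] k) (a : A) :
    Coalgebra.comul (translate φ a) = LinearMap.lTensor A (translate φ) (Coalgebra.comul a) := by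
  have h1 : ∀ F : A ⊗[k] A, Coalgebra.comul (contractRight φ F) =
      LinearMap.lTensor A (contractRight φ)
        (TensorProduct.assoc k A A A (LinearMap.rTensor A Coalgebra.comul F)) := by
    have h2 : ∀ (G : A ⊗[k] A) (c : A), LinearMap.lTensor A (contractRight φ)
        (TensorProduct.assoc k A A A (G ⊗ₜ c)) = φ c • G := by
      intro G c
      induction G with
      | zero => simp
      | add a b ha hb => simp only [TensorProduct.add_tmul, map_add, smul_add, ha, hb]
      | tmul a b => simp
    intro F
    induction F with
    | zero => simp
    | add a b ha hb => simp only [map_add, ha, hb]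
    | tmul a b => simp [h2]
  rw [translate, LinearMap.comp_apply, h1, Coalgebra.coassoc_apply, LinearMap.lTensor_comp_apply]

/-- The endomorphism `a ⊗ b ↦ a b₁ ⊗ b₂` of `A ⊗ A`. -/
def shearHom (k A : Type*) [Field k] [CommRing A] [HopfAlgebra k A] : A ⊗[k] A →ₐ[A] A ⊗[k] A :=
  Algebra.TensorProduct.lift (Algebra.ofId A (A ⊗[k] A)) (Bialgebra.comulAlgHom k A)
    fun _ _ => .all _ _

/-- The endomorphism `a ⊗ b ↦ a S(b₁) ⊗ b₂` of `A ⊗ A`. -/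
def shearInv (k A : Type*) [Field k] [CommRing A] [HopfAlgebra k A] : A ⊗[k] A →ₐ[A] A ⊗[k] A :=
  Algebra.TensorProduct.lift (Algebra.ofId A (A ⊗[k] A))
    ((Algebra.TensorProduct.map (HopfAlgebra.antipodeAlgHom k A) (AlgHom.id k A)).comp
      (Bialgebra.comulAlgHom k A)) fun _ _ => .all _ _

theorem ev₂_shearHom {R : Type*} [CommRing R] [Algebra k R] (x y : Point k A R) (F : A ⊗[k] A) :
    ev₂ x y (shearHom k A F) = ev₂ x (x * y) F := by
  induction F with
  | zero => simp
  | add a b ha hb => simp only [map_add, ha, hb]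
  | tmul a b => simp [shearHom, Algebra.ofId_apply, ev₂_comul]

theorem ev₂_shearInv {R : Type*} [CommRing R] [Algebra k R] (x y : Point k A R) (F : A ⊗[k] A) :
    ev₂ x y (shearInv k A F) = ev₂ x (x⁻¹ * y) F := by
  have h : ∀ F : A ⊗[k] A, ev₂ x y (Algebra.TensorProduct.map (HopfAlgebra.antipodeAlgHom k A)
      (AlgHom.id k A) F) = ev₂ x⁻¹ y F := by
    intro F
    induction F with
    | zero => simp
    | add a b ha hb => simp only [map_add, ha, hb]
    | tmul a b => simp [apply_antipode]
  induction F with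
  | zero => simp
  | add a b ha hb => simp only [map_add, ha, hb]
  | tmul a b => simp [shearInv, Algebra.ofId_apply, h, ev₂_comul]

/-- The automorphism `a ⊗ b ↦ a b₁ ⊗ b₂` of `A ⊗ A`. -/
def shear (k A : Type*) [Field k] [CommRing A] [HopfAlgebra k A] : A ⊗[k] A ≃ₐ[A] A ⊗[k] A :=
  AlgEquiv.ofAlgHom (shearHom k A) (shearInv k A)
    (AlgHom.ext fun F => eq_of_ev₂ fun x y => by simp [ev₂_shearHom, ev₂_shearInv])
    (AlgHom.ext fun F => eq_of_ev₂ fun x y => by simp [ev₂_shearHom, ev₂_shearInv])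

theorem shear_tmul (a b : A) : shear k A (a ⊗ₜ b) = (a ⊗ₜ 1) * Coalgebra.comul b := by
  simp [shear, shearHom, Algebra.ofId_apply]

/-- The functional `b ↦ tr(c ↦ b₁c₁ φ(b₂c₂))`. -/
def traceForm (φ : A →ₗ[k] k) : A →ₗ[k] k :=
  LinearMap.trace k A ∘ₗ LinearMap.mulLeft k (translate φ) ∘ₗ LinearMap.mul k A

theorem traceForm_apply (φ : A →ₗ[k] k) (b : A) :
    traceForm φ b = LinearMap.trace k A (translate φ * LinearMap.mulLeft k b) := rfl

/-- A trace is unchanged under conjugation, here by the universal translation. Over the base ring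
`A`, the operator `X F`, multiplication by `F` followed by the extension of `translate φ`, has trace
`contractRight (traceForm φ) F`. The shear is `A`-linear, commutes with the extended `translate φ`
and sends `1 ⊗ b` to `Δ(b)`, so it conjugates `X (1 ⊗ b)` to `X (Δ b)`; comparing traces gives
invariance at `b`. -/
theorem isLeftInvariant_traceForm [Module.Finite k A] (φ : A →ₗ[k] k) : IsLeftInvariant (traceForm φ) := by
  let T : A ⊗[k] A →ₗ[A] A ⊗[k] A := (translate φ).baseChange A
  let X : A ⊗[k] A → A ⊗[k] A →ₗ[A] A ⊗[k] A := fun F => T ∘ₗ LinearMap.mulLeft A F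
  have hT : ∀ (a : A) (F : A ⊗[k] A), T ((a ⊗ₜ 1) * F) = (a ⊗ₜ 1) * T F := by
    intro a F
    have h : ∀ G : A ⊗[k] A, (a ⊗ₜ 1) * G = a • G := fun G => by
      rw [Algebra.smul_def]; rfl
    rw [h, h, map_smul]
  have h1 : ∀ F : A ⊗[k] A, LinearMap.trace A (A ⊗[k] A) (X F) =
      contractRight (traceForm φ) F := by
    intro F
    induction F with
    | zero =>
      have : X 0 = 0 := by ext; simp [X]
      rw [this, map_zero, map_zero]
    | add F G hF hG =>
      have : X (F + G) = X F + X G := by ext; simp [X, add_mul]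
      rw [this, map_add, map_add, hF, hG]
    | tmul a b =>
      have : X (a ⊗ₜ b) = a • (translate φ * LinearMap.mulLeft k b).baseChange A := by
        ext c
        simp [X, T, TensorProduct.smul_tmul']
      rw [this, map_smul, LinearMap.trace_baseChange, contractRight_tmul, traceForm_apply,
        smul_eq_mul, mul_comm]
      exact (Algebra.smul_def _ _).symm
  intro b
  have h2 : (shear k A).toLinearEquiv.conj (X (1 ⊗ₜ b)) = X (Coalgebra.comul b) := by
    refine LinearMap.ext fun G => ?_
    obtain ⟨G, rfl⟩ := (shear k A).surjective G
    have h3 : ∀ G : A ⊗[k] A, shear k A (T G) = T (shear k A G) := by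
      intro G
      induction G with
      | zero => simp
      | add a b ha hb => simp only [map_add, ha, hb]
      | tmul c d =>
        rw [shear_tmul, hT]
        change shear k A (c ⊗ₜ translate φ d) = _
        rw [shear_tmul, comul_translate]
        rfl
    rw [LinearEquiv.conj_apply_apply]
    change shear k A (X (1 ⊗ₜ b) ((shear k A).symm (shear k A G))) = T (_ * _)
    rw [AlgEquiv.symm_apply_apply]
    change shear k A (T (1 ⊗ₜ b * G)) = _
    rw [h3, map_mul, shear_tmul, ← Algebra.TensorProduct.one_def, one_mul]
  rw [← h1, ← h2, LinearMap.trace_conj', h1, contractRight_tmul]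

/-- The operator `c ↦ c₁ S(c₂) = ε(c) 1` has rank one and trace `ε(1) = 1`. It is a sum of operators
`eᵢ · translate φᵢ`, whose traces are values of trace forms, so these cannot all vanish. -/
theorem exists_traceForm_ne_zero (k A : Type*) [Field k] [CommRing A] [HopfAlgebra k A]
    [Module.Finite k A] : ∃ φ : A →ₗ[k] k, traceForm φ ≠ 0 := by
  by_contra! h
  let e := Module.finBasis k A
  -- Chosen so that `∑ φᵢ(y) eᵢ = S(y)`.
  let φ := fun i => e.coord i ∘ₗ HopfAlgebra.antipode k
  have h1 : ∑ i, LinearMap.mulLeft k (e i) * translate (φ i) =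
      (Coalgebra.counit (R := k) (A := A)).smulRight 1 := by
    ext c
    have h2 : ∀ F : A ⊗[k] A, ∑ i, e i * contractRight (φ i) F =
        LinearMap.mul' k A (LinearMap.lTensor A (HopfAlgebra.antipode k) F) := by
      intro F
      induction F with
      | zero => simp
      | add a b ha hb => simp only [map_add, mul_add, Finset.sum_add_distrib, ha, hb]
      | tmul x y =>
        have hy : HopfAlgebra.antipode k y = ∑ i, φ i y • e i :=
          (e.sum_repr (HopfAlgebra.antipode k y)).symm
        rw [LinearMap.lTensor_tmul, LinearMap.mul'_apply, hy, Finset.mul_sum]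
        exact Finset.sum_congr rfl fun i _ => by simp [mul_comm]
    have := h2 (Coalgebra.comul c)
    rw [HopfAlgebra.mul_antipode_lTensor_comul_apply] at this
    simpa [translate, Algebra.smul_def] using this
  have h3 := congrArg (LinearMap.trace k A) h1
  rw [map_sum, Finset.sum_eq_zero fun i _ => by
    rw [LinearMap.trace_mul_comm, ← traceForm_apply, h, LinearMap.zero_apply],
    LinearMap.trace_smulRight, Bialgebra.counit_one] at h3
  exact zero_ne_one h3

end Existence

/-- `m` is an invariant functional on `A` and `r` is an integral in `A` with `m(r) = 1`. -/
structure IsIntegralPair (m : A →ₗ[k] k) (r : A) : Prop where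
  invariant : IsLeftInvariant m
  mul_eq : ∀ a, a * r = Coalgebra.counit (R := k) a • r
  apply_eq_one : m r = 1

/-- The element `r` represents the counit for the form `m(ab)`: `m(a r) = ε(a)`. Multiplicativity of
`ε` and non-degeneracy then make it an integral. -/
theorem exists_isIntegralPair (k A : Type*) [Field k] [CommRing A] [HopfAlgebra k A]
    [Module.Finite k A] : ∃ (m : A →ₗ[k] k) (r : A), IsIntegralPair m r := by
  obtain ⟨φ, h0⟩ := exists_traceForm_ne_zero k A
  have hm := isLeftInvariant_traceForm φ
  obtain ⟨r, hr⟩ := hm.exists_dual h0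
  refine ⟨_, r, hm, fun a => ?_, by simpa using hr 1⟩
  rw [← sub_eq_zero]
  refine hm.eq_zero_of_forall_mul h0 fun b => ?_
  have h1 : (a * r - Coalgebra.counit (R := k) a • r) * b =
      (b * a) * r - Coalgebra.counit (R := k) a • (b * r) := by
    rw [sub_mul, smul_mul_assoc, mul_comm r b]
    ring
  rw [h1, map_sub, map_smul, hr, hr, Bialgebra.counit_mul, smul_eq_mul, mul_comm, sub_self]

namespace IsIntegralPair

variable {m : A →ₗ[k] k} {r : A} (h : IsIntegralPair m r)

include h

theorem ne_zero : m ≠ 0 := fun h0 => by simpa [h0] using h.apply_eq_one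

theorem integral_ne_zero : r ≠ 0 := fun h0 => by simpa [h0] using h.apply_eq_one

theorem apply_mul (a : A) : m (a * r) = Coalgebra.counit (R := k) a := by
  rw [h.mul_eq, map_smul, h.apply_eq_one, smul_eq_mul, mul_one]

theorem eq_smul_of_integral [Module.Finite k A] {s : A}
    (hs : ∀ a, a * s = Coalgebra.counit (R := k) a • s) : s = m s • r := by
  rw [← sub_eq_zero]
  refine h.invariant.eq_zero_of_forall_mul h.ne_zero fun b => ?_
  rw [sub_mul, smul_mul_assoc, mul_comm s, mul_comm r, hs, h.mul_eq]
  simp [h.apply_eq_one, mul_comm]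

/-- The difference `n - n(r) m` is invariant and vanishes on `A r = k r`. If it were non-zero, its
form would be non-degenerate and would force `r = 0`. -/
theorem eq_smul_of_invariant [Module.Finite k A] {n : A →ₗ[k] k} (hn : IsLeftInvariant n) :
    n = n r • m := by
  rw [← sub_eq_zero]
  by_contra h0
  have h1 : IsLeftInvariant (n - n r • m) := by
    intro a
    have h2 : ∀ F : A ⊗[k] A, contractRight (n - n r • m) F =
        contractRight n F - n r • contractRight m F := by
      intro F
      induction F with
      | zero => simp
      | add a b ha hb => simp only [map_add, ha, hb, smul_add]; abel
      | tmul a b => simp [sub_smul, mul_smul]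
    rw [h2, hn a, h.invariant a]
    simp [sub_smul, mul_smul]
  refine h.integral_ne_zero (h1.eq_zero_of_forall_mul h0 fun b => ?_)
  rw [mul_comm, h.mul_eq]
  simp [h.apply_eq_one]

/-- By `contract_comul_mul` the left side is `S(b₁) m(r b₂) = S(b₁) ε(b₂)`. So `Δ(r)` is, up to the
antipode, the dual basis tensor of the form `m(ab)`. -/
theorem contract_comul (b : A) :
    contractRight m ((1 ⊗ₜ b) * Coalgebra.comul r) = HopfAlgebra.antipode k b := by
  have h1 : m ∘ₗ LinearMap.mulLeft k r = Coalgebra.counit (R := k) (A := A) :=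
    LinearMap.ext fun a => by
      rw [LinearMap.comp_apply, LinearMap.mulLeft_apply, mul_comm, h.apply_mul]
  have h2 : ∀ F : A ⊗[k] A, contractRight (Coalgebra.counit (R := k) (A := A))
      (LinearMap.rTensor A (HopfAlgebra.antipode k) F) =
      HopfAlgebra.antipode k (contractRight (Coalgebra.counit (R := k) (A := A)) F) := by
    intro F
    induction F with
    | zero => simp
    | add a b ha hb => simp only [map_add, ha, hb]
    | tmul a b => simp
  rw [h.invariant.contract_comul_mul, h1, h2, contractRight_counit_comul]

/-- Write `1 ⊗ b = (S(b₁) ⊗ 1) Δ(b₂)`; then `Δ(b₂) Δ(r) = Δ(b₂ r) = ε(b₂) Δ(r)`. This rule carries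
factors from one leg of `Δ(r)` to the other. -/
theorem one_tmul_mul_comul (b : A) : (1 ⊗ₜ[k] b) * Coalgebra.comul r =
    (HopfAlgebra.antipode k b ⊗ₜ 1) * Coalgebra.comul r := by
  have h1 : ∀ F : A ⊗[k] A, mulMap₂
      ((TensorProduct.mk k A A).flip 1 ∘ₗ HopfAlgebra.antipode k) Coalgebra.comul F *
        Coalgebra.comul r = (HopfAlgebra.antipode k
          (contractRight (Coalgebra.counit (R := k) (A := A)) F) ⊗ₜ 1) * Coalgebra.comul r := by
    intro F
    induction F with
    | zero => simp
    | add a b ha hb => simp only [map_add, add_mul, TensorProduct.add_tmul, ha, hb]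
    | tmul c d =>
      have h2 : Coalgebra.comul (d * r) =
          Coalgebra.counit (R := k) d • (Coalgebra.comul r : A ⊗[k] A) := by rw [h.mul_eq, map_smul]
      simp only [mulMap₂_tmul, LinearMap.comp_apply, LinearMap.flip_apply,
        TensorProduct.mk_apply, mul_assoc, ← Bialgebra.comul_mul, h2, contractRight_tmul, map_smul,
        ← TensorProduct.smul_tmul', smul_mul_assoc, mul_smul_comm]
  rw [one_tmul_eq_mulMap₂, h1, contractRight_counit_comul]

theorem tmul_one_mul_comul (b : A) : (b ⊗ₜ[k] 1) * Coalgebra.comul r =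
    (1 ⊗ₜ HopfAlgebra.antipode k b) * Coalgebra.comul r := by
  rw [h.one_tmul_mul_comul, antipode_antipode]

/-- The reproducing formula with `b = r` gives `S(r) = r₁ m(r r₂)`, and `r r₂ = ε(r₂) r`. -/
theorem antipode_integral : HopfAlgebra.antipode k r = r := by
  have h1 : ∀ F : A ⊗[k] A, (1 ⊗ₜ r) * F =
      contractRight (Coalgebra.counit (R := k) (A := A)) F ⊗ₜ r := by
    intro F
    induction F with
    | zero => simp
    | add a b ha hb => simp only [map_add, mul_add, TensorProduct.add_tmul, ha, hb]
    | tmul c d =>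
      rw [Algebra.TensorProduct.tmul_mul_tmul, mul_comm r, h.mul_eq, one_mul, contractRight_tmul,
        TensorProduct.smul_tmul]
  rw [← h.contract_comul, h1, contractRight_counit_comul, contractRight_tmul, h.apply_eq_one,
    one_smul]

/-- One-dimensionality of the integrals, with coefficients in `M`. The reproducing formula `b =
S(r₁) m(b r₂)`, applied to the second leg of `F`, lets `F` absorb `r₂` as `ε(r₂)`, and what is left
in that leg is `S(r) = r`. In the proof `T (c ⊗ d)` is `b ↦ m(bd) S(c)`. -/
theorem eq_tmul_of_integral {M : Type*} [AddCommGroup M] [Module k M] {F : M ⊗[k] A}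
    (hF : ∀ a, LinearMap.lTensor M (LinearMap.mulLeft k a) F = Coalgebra.counit (R := k) a • F) :
    F = contractRight m F ⊗ₜ r := by
  let T : A ⊗[k] A → A →ₗ[k] A := fun G => HopfAlgebra.antipode k ∘ₗ contractRight m ∘ₗ
    LinearMap.mulRight k G ∘ₗ TensorProduct.mk k A A 1
  have h1 : ∀ G, LinearMap.lTensor M (T G) F = contractRight m F ⊗ₜ[k]
      HopfAlgebra.antipode k (contractRight (Coalgebra.counit (R := k) (A := A)) G) := by
    intro G
    induction G with
    | zero =>
      have : T 0 = 0 := by ext; simp [T]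
      simp [this]
    | add G G' hG hG' =>
      have : T (G + G') = T G + T G' := by ext; simp [T, mul_add]
      rw [this, LinearMap.lTensor_add, LinearMap.add_apply, hG, hG', map_add, map_add,
        TensorProduct.tmul_add]
    | tmul c d =>
      have h2 : T (c ⊗ₜ d) = (m.smulRight (HopfAlgebra.antipode k c)) ∘ₗ LinearMap.mulLeft k d := by
        ext b
        simp [T, mul_comm]
      have h3 : ∀ F : M ⊗[k] A, LinearMap.lTensor M (m.smulRight (HopfAlgebra.antipode k c)) F =
          contractRight m F ⊗ₜ HopfAlgebra.antipode k c := by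
        intro F
        induction F with
        | zero => simp
        | add a b ha hb => simp only [map_add, TensorProduct.add_tmul, ha, hb]
        | tmul a b => simp [TensorProduct.smul_tmul]
      rw [h2, LinearMap.lTensor_comp_apply, hF, map_smul, h3]
      simp
  have h2 : T (Coalgebra.comul r) = LinearMap.id := by
    ext b
    change HopfAlgebra.antipode k (contractRight m ((1 ⊗ₜ b) * Coalgebra.comul r)) = b
    rw [h.contract_comul, antipode_antipode]
  have h3 := h1 (Coalgebra.comul r)
  rwa [h2, LinearMap.lTensor_id, LinearMap.id_apply, contractRight_counit_comul,
    h.antipode_integral] at h3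

/-- For each functional `z` the map `a ↦ z(m(a₁) a₂)` is again left invariant, hence a multiple of
`m`; the multiple is its value at `r`. -/
theorem contractLeft_comul [Module.Finite k A] (a : A) : contractLeft m (Coalgebra.comul a) =
    m a • contractLeft m (Coalgebra.comul r) := by
  rw [← sub_eq_zero]
  refine (Module.forall_dual_apply_eq_zero_iff k _).mp fun z => ?_
  have h1 : IsLeftInvariant (z ∘ₗ contractLeft m ∘ₗ Coalgebra.comul) := by
    intro a
    have h2 : ∀ (G : A ⊗[k] A) (c : A), contractRight (z ∘ₗ contractLeft m)
        (TensorProduct.assoc k A A A (G ⊗ₜ c)) = z c • contractRight m G := by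
      intro G c
      induction G with
      | zero => simp
      | add a b ha hb => simp only [TensorProduct.add_tmul, map_add, ha, hb, smul_add]
      | tmul a b => simp [smul_smul, mul_comm]
    have h3 : ∀ F : A ⊗[k] A, contractRight (z ∘ₗ contractLeft m)
        (TensorProduct.assoc k A A A (LinearMap.rTensor A Coalgebra.comul F)) =
        z (contractLeft m F) • 1 := by
      intro F
      induction F with
      | zero => simp
      | add a b ha hb => simp only [map_add, ha, hb, add_smul]
      | tmul a b => simp [h2, h.invariant a, smul_smul, mul_comm]
    have h4 : ∀ F : A ⊗[k] A, contractRight (z ∘ₗ contractLeft m ∘ₗ Coalgebra.comul) F =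
        contractRight (z ∘ₗ contractLeft m) (LinearMap.lTensor A Coalgebra.comul F) := by
      intro F
      induction F with
      | zero => simp
      | add a b ha hb => simp only [map_add, ha, hb]
      | tmul a b => simp
    rw [h4, ← Coalgebra.coassoc_apply, h3]
    rfl
  have h5 := LinearMap.congr_fun (h.eq_smul_of_invariant h1) a
  simp only [LinearMap.comp_apply, LinearMap.smul_apply, smul_eq_mul] at h5
  rw [map_sub, map_smul, h5, smul_eq_mul, mul_comm, sub_self]

/-- The modular element `μ` with `m(a₁) a₂ = m(a) μ`. -/
theorem comul_modular [Module.Finite k A] : Coalgebra.comul (contractLeft m (Coalgebra.comul r)) =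
    contractLeft m (Coalgebra.comul r) ⊗ₜ[k] contractLeft m (Coalgebra.comul r) := by
  have h2 : ∀ (G : A ⊗[k] A) (c : A), contractLeft m
      (TensorProduct.assoc k A A A (G ⊗ₜ c)) = contractLeft m G ⊗ₜ c := by
    intro G c
    induction G with
    | zero => simp
    | add a b ha hb => simp only [TensorProduct.add_tmul, map_add, ha, hb]
    | tmul a b => simp [TensorProduct.smul_tmul']
  have h3 : ∀ F : A ⊗[k] A, contractLeft m
      (TensorProduct.assoc k A A A (LinearMap.rTensor A Coalgebra.comul F)) =
      contractLeft m (Coalgebra.comul r) ⊗ₜ contractLeft m F := by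
    intro F
    induction F with
    | zero => simp
    | add a b ha hb => simp only [map_add, ha, hb, TensorProduct.tmul_add]
    | tmul a b =>
      rw [LinearMap.rTensor_tmul, h2, h.contractLeft_comul a, TensorProduct.smul_tmul,
        contractLeft_tmul]
  have h4 : ∀ F : A ⊗[k] A, Coalgebra.comul (contractLeft m F) =
      contractLeft m (LinearMap.lTensor A Coalgebra.comul F) := by
    intro F
    induction F with
    | zero => simp
    | add a b ha hb => simp only [map_add, ha, hb]
    | tmul a b => simp
  rw [h4, ← Coalgebra.coassoc_apply, h3]

theorem counit_modular :
    Coalgebra.counit (R := k) (contractLeft m (Coalgebra.comul r)) = 1 := by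
  rw [← apply_contractRight, contractRight_counit_comul, h.apply_eq_one]

theorem antipode_modular_mul [Module.Finite k A] :
    HopfAlgebra.antipode k (contractLeft m (Coalgebra.comul r)) *
      contractLeft m (Coalgebra.comul r) = 1 := by
  have h1 := HopfAlgebra.mul_antipode_rTensor_comul_apply (R := k)
    (contractLeft m (Coalgebra.comul r))
  rwa [h.comul_modular, h.counit_modular, LinearMap.rTensor_tmul, LinearMap.mul'_apply,
    map_one] at h1

end IsIntegralPair

end CommutativeIntegrals

/-! ### Cointegrals and modular elements of a commutative twist -/

section TwistCointegrals

open Point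

variable {k A : Type*} [Field k] [CommRing A] [HopfAlgebra k A]

/-- The modular element `μ` of the dual, defined by `m(a₁) a₂ = m(a) μ`. -/
def modularElt (m : A →ₗ[k] k) (r : A) : A := contractLeft m (Coalgebra.comul r)

theorem comul_antipode (a : A) : Coalgebra.comul (HopfAlgebra.antipode k a) =
    TensorProduct.comm k A A (TensorProduct.map (HopfAlgebra.antipode k) (HopfAlgebra.antipode k)
      (Coalgebra.comul a)) := by
  refine eq_of_ev₂ fun x y => ?_
  have h : ∀ F : A ⊗[k] A, ev₂ x y (TensorProduct.comm k A A
      (TensorProduct.map (HopfAlgebra.antipode k) (HopfAlgebra.antipode k) F)) =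
      ev₂ y⁻¹ x⁻¹ F := by
    intro F
    induction F with
    | zero => simp
    | add a b ha hb => simp only [map_add, ha, hb]
    | tmul a b => simp [apply_antipode, mul_comm]
  rw [h, ev₂_comul, ev₂_comul, apply_antipode, mul_inv_rev]

/-- Since `S(r) = r`, `Δ(r)` equals `S(r₂) ⊗ S(r₁)`. -/
theorem IsIntegralPair.contractRight_comp_antipode {m : A →ₗ[k] k} {r : A}
    (h : IsIntegralPair m r) (n : A →ₗ[k] k) :
    contractRight (n ∘ₗ HopfAlgebra.antipode k) (Coalgebra.comul r) =
      HopfAlgebra.antipode k (contractLeft n (Coalgebra.comul r)) := by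
  have h1 : ∀ F : A ⊗[k] A, contractRight (n ∘ₗ HopfAlgebra.antipode k) (TensorProduct.comm k A A
      (TensorProduct.map (HopfAlgebra.antipode k) (HopfAlgebra.antipode k) F)) =
      HopfAlgebra.antipode k (contractLeft n F) := by
    intro F
    induction F with
    | zero => simp
    | add a b ha hb => simp only [map_add, ha, hb]
    | tmul a b => simp [antipode_antipode]
  rw [← h1, ← comul_antipode, h.antipode_integral]

namespace IsTwist

variable {Q : QuasiHopfData k A} (hQ : IsTwist Q) {m : A →ₗ[k] k} {r : A}
  (h : IsIntegralPair m r)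

include hQ

theorem β_mul_antipode_β : Q.β * HopfAlgebra.antipode k Q.β = 1 := by
  rw [mul_comm, hQ.antipode_β_mul_β]

theorem counit_β : Coalgebra.counit (R := k) Q.β = 1 := by
  have h : (1 : Point k A k) Q.β = 1 := by rw [hQ.β_apply, hQ.w_one_left]
  exact h

theorem counit_antipode_β : Coalgebra.counit (R := k) (HopfAlgebra.antipode k Q.β) = 1 := by
  rw [HopfAlgebra.counit_antipode, hQ.counit_β]

theorem isModularFunctional_counit (h : IsIntegralPair m r) :
    IsModularFunctional Q.counit Q.counit :=
  ⟨r, h.integral_ne_zero, by rw [hQ.counit_eq]; exact h.mul_eq,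
    fun a => by rw [mul_comm, hQ.counit_eq, h.mul_eq]⟩

omit hQ in
theorem eq_counit_of_isModularFunctional {ν : A →ₗ[k] k} (hν : IsModularFunctional Q.counit ν) :
    ν = Q.counit := by
  obtain ⟨t, h0, h1, h2⟩ := hν
  refine LinearMap.ext fun a => ?_
  have h3 := h2 a
  rw [mul_comm, h1 a] at h3
  exact (smul_left_injective k h0 h3).symm

/-- The condition on left cointegrals, simplified by means of unimodularity. -/
def IsReducedCointegral (Q : QuasiHopfData k A) (l : A →ₗ[k] k) : Prop :=
  ∀ a, contractRight l (Q.V * Q.U * Coalgebra.comul a) = l a • (1 : A)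

/-- Commutativity forces the modular functional to be `ε`, normalization then collapses the right
side of the cointegral equation to `λ(h) 1`, and `V`, `Δ(h)`, `U` commute. -/
theorem isLeftCointegral_iff (h : IsIntegralPair m r) {l : A →ₗ[k] k} :
    Q.IsLeftCointegral l ↔ IsReducedCointegral Q l := by
  have h1 : ∀ a, contractLeft (l ∘ₗ LinearMap.mulLeft k a ∘ₗ Q.antipode)
      (contractLeft Q.counit Q.Φinv) = l a • (1 : A) := by
    intro a
    rw [hQ.counit_eq, hQ.normalized_left, Algebra.TensorProduct.one_def, contractLeft_tmul]
    simp [hQ.antipode_eq]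
  have h2 : ∀ a, Q.V * Q.comul a * Q.U = Q.V * Q.U * Coalgebra.comul a := by
    intro a
    rw [hQ.comul_eq]
    ring
  constructor
  · rintro ⟨ν, hν, h3⟩ a
    rw [← h2, h3, eq_counit_of_isModularFunctional hν, h1]
  · intro h3
    exact ⟨Q.counit, hQ.isModularFunctional_counit h, fun a => by rw [h2, h3, h1]⟩

/-- In `VU = Δ(S(β)) (1 ⊗ β)` the first factor is absorbed in the argument `a` and the second in the
functional. So the reduced equation for `l` is left invariance of `l(β · )`. -/
theorem contractRight_V_mul_U (l : A →ₗ[k] k) (a : A) :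
    contractRight l (Q.V * Q.U * Coalgebra.comul a) =
      contractRight (l ∘ₗ LinearMap.mulLeft k Q.β)
        (Coalgebra.comul (a * HopfAlgebra.antipode k Q.β)) := by
  rw [hQ.V_mul_U, ← contractRight_one_tmul_mul, Bialgebra.comul_mul]
  ring_nf

theorem isReducedCointegral_of_pair (h : IsIntegralPair m r) :
    IsReducedCointegral Q (m ∘ₗ LinearMap.mulLeft k (HopfAlgebra.antipode k Q.β)) := by
  intro a
  have h1 : (m ∘ₗ LinearMap.mulLeft k (HopfAlgebra.antipode k Q.β)) ∘ₗ
      LinearMap.mulLeft k Q.β = m := by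
    ext b
    simp [← mul_assoc, hQ.antipode_β_mul_β]
  rw [hQ.contractRight_V_mul_U, h1, h.invariant]
  simp [mul_comm]

theorem reducedCointegral_apply (h : IsIntegralPair m r) :
    (m ∘ₗ LinearMap.mulLeft k (HopfAlgebra.antipode k Q.β)) r = 1 := by
  rw [LinearMap.comp_apply, LinearMap.mulLeft_apply, h.mul_eq, hQ.counit_antipode_β, one_smul,
    h.apply_eq_one]

theorem eq_smul_of_isReducedCointegral [Module.Finite k A] (h : IsIntegralPair m r)
    {l : A →ₗ[k] k} (hl : IsReducedCointegral Q l) :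
    l = l r • (m ∘ₗ LinearMap.mulLeft k (HopfAlgebra.antipode k Q.β)) := by
  have h1 : IsLeftInvariant (l ∘ₗ LinearMap.mulLeft k Q.β) := by
    intro a
    have h2 := hl (a * Q.β)
    rw [hQ.contractRight_V_mul_U, mul_assoc, mul_comm Q.β, hQ.antipode_β_mul_β, mul_one] at h2
    rw [h2, LinearMap.comp_apply, LinearMap.mulLeft_apply, mul_comm]
  have h3 := h.eq_smul_of_invariant h1
  ext a
  have h6 := LinearMap.congr_fun h3 (HopfAlgebra.antipode k Q.β * a)
  simp only [LinearMap.comp_apply, LinearMap.mulLeft_apply, LinearMap.smul_apply] at h6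
  rw [← mul_assoc, hQ.β_mul_antipode_β, one_mul, h.mul_eq, hQ.counit_β, one_smul] at h6
  rw [h6]
  rfl

/-- The factor `Δ(S(β))` of `VU` is swallowed by `Δ(r)`, as `ε(S(β)) = 1`. One `β` is the remaining
factor `1 ⊗ β`; the other arises because `l` is a multiple of `m(S(β) · )`, and `S(β)` in the first
leg of `Δ(r)` becomes `S(S(β)) = β` in the second. -/
theorem contractLeft_V_mul_U [Module.Finite k A] (h : IsIntegralPair m r)
    {l : A →ₗ[k] k} (hl : IsReducedCointegral Q l) :
    contractLeft l (Q.V * Q.U * Coalgebra.comul r) = l r • (Q.β ^ 2 * modularElt m r) := by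
  have h3 : Q.V * Q.U * Coalgebra.comul r = (1 ⊗ₜ Q.β) * Coalgebra.comul r := by
    rw [hQ.V_mul_U, mul_right_comm, ← Bialgebra.comul_mul, h.mul_eq,
      hQ.counit_antipode_β, one_smul, mul_comm]
  have h4 : ∀ F : A ⊗[k] A, contractLeft l F = l r •
      contractLeft (m ∘ₗ LinearMap.mulLeft k (HopfAlgebra.antipode k Q.β)) F := by
    intro F
    conv_lhs => rw [hQ.eq_smul_of_isReducedCointegral h hl]
    generalize m ∘ₗ LinearMap.mulLeft k (HopfAlgebra.antipode k Q.β) = n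
    induction F with
    | zero => simp
    | add a b ha hb => simp only [map_add, ha, hb, smul_add]
    | tmul a b => simp [mul_smul]
  rw [h3, contractLeft_one_tmul_mul, h4, ← contractLeft_tmul_one_mul, h.tmul_one_mul_comul,
    antipode_antipode, contractLeft_one_tmul_mul, mul_smul_comm, modularElt]
  ring_nf

/-- The factor `1 ⊗ β` from `q p` goes through the antipode and joins the `S(β)` in `l`, giving
`m(S(β²) S( · ))`. As `Δ(r) = S(r₂) ⊗ S(r₁)`, the contraction is the antipode of `m(S(β²) r₁) r₂ =
β² m(r₁) r₂`. -/
theorem contractRight_q_mul_p [Module.Finite k A] (h : IsIntegralPair m r)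
    {l : A →ₗ[k] k} (hl : IsReducedCointegral Q l) :
    contractRight (l ∘ₗ HopfAlgebra.antipode k) (Q.qR * Q.pR * Coalgebra.comul r) =
      l r • HopfAlgebra.antipode k (Q.β ^ 2 * modularElt m r) := by
  have h1 : (l ∘ₗ HopfAlgebra.antipode k) ∘ₗ LinearMap.mulLeft k Q.β =
      l r • ((m ∘ₗ LinearMap.mulLeft k (HopfAlgebra.antipode k (Q.β ^ 2))) ∘ₗ
        HopfAlgebra.antipode k) := by
    ext a
    have h2 := LinearMap.congr_fun (hQ.eq_smul_of_isReducedCointegral h hl)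
      (HopfAlgebra.antipode k (Q.β * a))
    simp only [LinearMap.comp_apply, LinearMap.mulLeft_apply] at h2 ⊢
    rw [h2]
    simp only [LinearMap.smul_apply, LinearMap.comp_apply, LinearMap.mulLeft_apply, pow_two,
      HopfAlgebra.antipode_mul_distrib, mul_assoc]
  have h4 : ∀ (n : A →ₗ[k] k) (F : A ⊗[k] A), contractRight (l r • n) F =
      l r • contractRight n F := by
    intro n F
    induction F with
    | zero => simp
    | add a b ha hb => simp only [map_add, ha, hb, smul_add]
    | tmul a b => simp [mul_smul]
  rw [hQ.q_mul_p, contractRight_one_tmul_mul, h1, h4, h.contractRight_comp_antipode,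
    ← contractLeft_tmul_one_mul, h.tmul_one_mul_comul, antipode_antipode,
    contractLeft_one_tmul_mul, modularElt]

theorem isModularElement_iff [Module.Finite k A] (h : IsIntegralPair m r) {g : A} :
    Q.IsModularElement g ↔ g = Q.β ^ 2 * modularElt m r := by
  have h1 : ∀ (l : A →ₗ[k] k) (a : A), contractLeft l (Q.V * Q.comul a * Q.U) =
      contractLeft l (Q.V * Q.U * Coalgebra.comul a) := by
    intro l a
    rw [hQ.comul_eq]
    ring_nf
  constructor
  · rintro ⟨l, s, hl, hs, h2, rfl⟩
    rw [hQ.isLeftCointegral_iff h] at hl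
    -- All integrals are multiples of `r`; the normalization `l s = 1` removes the scalars of both
    -- `l` and `s`.
    have h3 := h.eq_smul_of_integral (s := s) fun a => by rw [mul_comm, hs, hQ.counit_eq]
    rw [h1, h3, map_smul, mul_smul_comm, map_smul, hQ.contractLeft_V_mul_U h hl, smul_smul,
      ← smul_eq_mul, ← smul_eq_mul, ← map_smul, ← h3, h2, one_smul]
  · rintro rfl
    have hl := hQ.isReducedCointegral_of_pair h
    have h2 := hQ.reducedCointegral_apply h
    exact ⟨_, r, (hQ.isLeftCointegral_iff h).mpr hl,
      fun a => by rw [mul_comm, hQ.counit_eq, h.mul_eq], h2, by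
        rw [h1, hQ.contractLeft_V_mul_U h hl, h2, one_smul]⟩

theorem isLeftIntegralContraction_iff [Module.Finite k A] (h : IsIntegralPair m r) {g : A} :
    Q.IsLeftIntegralContraction g ↔
      g = HopfAlgebra.antipode k (Q.β ^ 2 * modularElt m r) := by
  have h1 : ∀ (l : A →ₗ[k] k) (a : A), contractRight l (Q.qR * Q.comul a * Q.pR) =
      contractRight l (Q.qR * Q.pR * Coalgebra.comul a) := by
    intro l a
    rw [hQ.comul_eq]
    ring_nf
  constructor
  · rintro ⟨l, s, hl, hs, h2, rfl⟩
    rw [hQ.isLeftCointegral_iff h] at hl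
    have h3 := h.eq_smul_of_integral (s := s) fun a => by rw [hs, hQ.counit_eq]
    rw [hQ.antipodeInv_eq, h3, map_smul, h.antipode_integral, map_smul] at h2
    rw [h1, h3, map_smul, mul_smul_comm, map_smul, hQ.antipodeInv_eq,
      hQ.contractRight_q_mul_p h hl, smul_smul, ← smul_eq_mul, h2, one_smul]
  · rintro rfl
    have hl := hQ.isReducedCointegral_of_pair h
    have h2 := hQ.reducedCointegral_apply h
    exact ⟨_, r, (hQ.isLeftCointegral_iff h).mpr hl,
      fun a => by rw [hQ.counit_eq, h.mul_eq], by
        rw [hQ.antipodeInv_eq, h.antipode_integral, h2], by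
        rw [h1, hQ.antipodeInv_eq, hQ.contractRight_q_mul_p h hl, h2, one_smul]⟩

end IsTwist

end TwistCointegrals

/-! ### Conjugation -/

section Conjugation

open Point

variable {k A : Type*} [Field k] [CommRing A] [HopfAlgebra k A]
variable {R : Type*} [CommRing R] [Algebra k R]

/-- The endomorphism `F(x, g) ↦ F(x, xgx⁻¹)` of `A ⊗ A`. -/
def conj₂ (k A : Type*) [Field k] [CommRing A] [HopfAlgebra k A] : A ⊗[k] A →ₐ[k] A ⊗[k] A :=
  ev₂ fst₂ (fst₂ * snd₂ * fst₂⁻¹)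

/-- The endomorphism `F(x, g) ↦ F(x, x⁻¹gx)` of `A ⊗ A`. -/
def conjInv₂ (k A : Type*) [Field k] [CommRing A] [HopfAlgebra k A] : A ⊗[k] A →ₐ[k] A ⊗[k] A :=
  ev₂ fst₂ (fst₂⁻¹ * snd₂ * fst₂)

theorem ev₂_conj₂ (x y : Point k A R) (F : A ⊗[k] A) :
    ev₂ x y (conj₂ k A F) = ev₂ x (x * y * x⁻¹) F := by
  rw [conj₂, map_ev₂, comp_mul, comp_mul, comp_inv, comp_fst₂, comp_snd₂]

theorem ev₂_conjInv₂ (x y : Point k A R) (F : A ⊗[k] A) :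
    ev₂ x y (conjInv₂ k A F) = ev₂ x (x⁻¹ * y * x) F := by
  rw [conjInv₂, map_ev₂, comp_mul, comp_mul, comp_inv, comp_fst₂, comp_snd₂]

theorem conj₂_conjInv₂ (F : A ⊗[k] A) : conj₂ k A (conjInv₂ k A F) = F :=
  eq_of_ev₂ fun x y => by rw [ev₂_conj₂, ev₂_conjInv₂]; congr 1; group

theorem conjInv₂_conj₂ (F : A ⊗[k] A) : conjInv₂ k A (conj₂ k A F) = F :=
  eq_of_ev₂ fun x y => by rw [ev₂_conjInv₂, ev₂_conj₂]; congr 1; group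

/-- The function `(x, g) ↦ a(xgx⁻¹)`. -/
def ad (k : Type*) {A : Type*} [Field k] [CommRing A] [HopfAlgebra k A] : A →ₐ[k] A ⊗[k] A :=
  (conj₂ k A).comp Algebra.TensorProduct.includeRight

/-- The function `(x, g) ↦ a(x⁻¹gx)`. -/
def coad (k : Type*) {A : Type*} [Field k] [CommRing A] [HopfAlgebra k A] : A →ₐ[k] A ⊗[k] A :=
  (conjInv₂ k A).comp Algebra.TensorProduct.includeRight

theorem ev₂_ad (x y : Point k A R) (a : A) : ev₂ x y (ad k a) = (x * y * x⁻¹) a := by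
  change ev₂ x y (conj₂ k A (1 ⊗ₜ a)) = _
  rw [ev₂_conj₂, ev₂_tmul, map_one, one_mul]

theorem ev₂_coad (x y : Point k A R) (a : A) : ev₂ x y (coad k a) = (x⁻¹ * y * x) a := by
  change ev₂ x y (conjInv₂ k A (1 ⊗ₜ a)) = _
  rw [ev₂_conjInv₂, ev₂_tmul, map_one, one_mul]

theorem conj₂_tmul (a b : A) : conj₂ k A (a ⊗ₜ b) = (a ⊗ₜ 1) * ad k b :=
  eq_of_ev₂ fun x y => by rw [ev₂_conj₂, map_mul, ev₂_ad, ev₂_tmul, ev₂_tmul, map_one, mul_one]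

theorem conjInv₂_tmul (a b : A) : conjInv₂ k A (a ⊗ₜ b) = (a ⊗ₜ 1) * coad k b :=
  eq_of_ev₂ fun x y => by
    rw [ev₂_conjInv₂, map_mul, ev₂_coad, ev₂_tmul, ev₂_tmul, map_one, mul_one]

theorem contractLeft_counit_ad (a : A) : contractLeft Coalgebra.counit (ad k a) = a := by
  refine eq_of_apply (k := k) fun x => ?_
  rw [← ev₂_one_left, ev₂_ad]
  simp

theorem contractRight_counit_ad (a : A) :
    contractRight Coalgebra.counit (ad k a) = Coalgebra.counit (R := k) a • (1 : A) := by
  refine eq_of_apply (k := k) fun x => ?_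
  rw [← ev₂_one_right, ev₂_ad]
  simp [one_apply, Algebra.smul_def, AlgHomClass.commutes]

theorem contractRight_counit_coad (a : A) :
    contractRight Coalgebra.counit (coad k a) = Coalgebra.counit (R := k) a • (1 : A) := by
  refine eq_of_apply (k := k) fun x => ?_
  rw [← ev₂_one_right, ev₂_coad]
  simp [one_apply, Algebra.smul_def, AlgHomClass.commutes]

/-- The function `a(xy · x⁻¹)`, written as `Δ(a₁) (S(a₂) ⊗ 1)`. -/
theorem ad_eq_mulMap₂ (a : A) : ad k a = mulMap₂ Coalgebra.comul
    ((TensorProduct.mk k A A).flip 1 ∘ₗ HopfAlgebra.antipode k) (Coalgebra.comul a) := by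
  refine eq_of_ev₂ fun x y => ?_
  rw [map_mulMap₂ (ev₂ x y) (x := x * y) (y := x⁻¹) (fun a => ev₂_comul x y a)
    (fun a => by simp [apply_antipode]), ev₂_comul, ev₂_ad]

namespace IsIntegralPair

variable {m : A →ₗ[k] k} {r : A} (h : IsIntegralPair m r)

include h

theorem mul_one_tmul (F : A ⊗[k] A) :
    F * (1 ⊗ₜ r) = contractRight Coalgebra.counit F ⊗ₜ r := by
  induction F with
  | zero => simp
  | add a b ha hb => simp only [map_add, add_mul, TensorProduct.add_tmul, ha, hb]
  | tmul a b =>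
    rw [Algebra.TensorProduct.tmul_mul_tmul, h.mul_eq, mul_one, contractRight_tmul,
      TensorProduct.smul_tmul]

theorem contractRight_ad (a : A) :
    contractRight m (ad k a) = HopfAlgebra.antipode k (contractLeft m (Coalgebra.comul a)) := by
  have h1 : ∀ F : A ⊗[k] A, contractRight m (mulMap₂ Coalgebra.comul
      ((TensorProduct.mk k A A).flip 1 ∘ₗ HopfAlgebra.antipode k) F) =
      HopfAlgebra.antipode k (contractLeft m F) := by
    intro F
    induction F with
    | zero => simp
    | add a b ha hb => simp only [map_add, ha, hb]
    | tmul a b =>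
      simp only [mulMap₂_tmul, LinearMap.comp_apply, LinearMap.flip_apply,
        TensorProduct.mk_apply, mul_comm (Coalgebra.comul a), contractRight_tmul_one_mul,
        h.invariant a, contractLeft_tmul, map_smul, mul_smul_comm, mul_one]
  rw [ad_eq_mulMap₂, h1]

/-- Conjugation by `x` is an automorphism, so it carries integrals to integrals over the functions
of `x`; hence `r(xgx⁻¹)` is a function of `x` times `r(g)`. Contraction with `m` identifies that
function. In the double this is the source of the modular element when `φ ⋈ r` multiplies from the
left. -/
theorem ad_integral : ad k r = HopfAlgebra.antipode k (modularElt m r) ⊗ₜ r := by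
  have h1 : ∀ a, LinearMap.lTensor A (LinearMap.mulLeft k a) (ad k r) =
      Coalgebra.counit (R := k) a • ad k r := by
    intro a
    have h2 : ∀ F : A ⊗[k] A, LinearMap.lTensor A (LinearMap.mulLeft k a) F =
        conj₂ k A (coad k a) * F := by
      have h3 : conj₂ k A (coad k a) = 1 ⊗ₜ a := conj₂_conjInv₂ (1 ⊗ₜ a)
      intro F
      induction F with
      | zero => simp
      | add a b ha hb => simp only [map_add, mul_add, ha, hb]
      | tmul b c => simp [h3]
    have h4 : ad k r = conj₂ k A (1 ⊗ₜ r) := rfl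
    rw [h2, h4, ← map_mul, h.mul_one_tmul, contractRight_counit_coad, ← map_smul,
      TensorProduct.smul_tmul']
  rw [h.eq_tmul_of_integral h1, h.contractRight_ad, modularElt]

end IsIntegralPair

end Conjugation

/-! ### Actions on tensor products -/

section Actions

variable {k A : Type*} [Field k] [CommRing A] [HopfAlgebra k A]

/-- The action of `B ⊗ C` on `M ⊗ N` given by actions of `B` on `M` and of `C` on `N`. -/
def tensorAct {B C M N : Type*} [Ring B] [Algebra k B] [Ring C] [Algebra k C]
    [AddCommMonoid M] [Module k M] [AddCommMonoid N] [Module k N]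
    (ρ : B →ₐ[k] Module.End k M) (σ : C →ₐ[k] Module.End k N) :
    B ⊗[k] C →ₐ[k] Module.End k (M ⊗[k] N) :=
  (Module.endTensorEndAlgHom (R := k) (S := k) (A := k)).comp (Algebra.TensorProduct.map ρ σ)

@[simp] theorem tensorAct_tmul {B C M N : Type*} [Ring B] [Algebra k B] [Ring C] [Algebra k C]
    [AddCommMonoid M] [Module k M] [AddCommMonoid N] [Module k N]
    (ρ : B →ₐ[k] Module.End k M) (σ : C →ₐ[k] Module.End k N) (b : B) (c : C) (m : M) (n : N) :
    tensorAct ρ σ (b ⊗ₜ c) (m ⊗ₜ n) = ρ b m ⊗ₜ σ c n := rfl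

/-- The action `a ⇀ φ = φ(a · )` of `A` on its dual. -/
def dualAct (k A : Type*) [Field k] [CommRing A] [HopfAlgebra k A] :
    A →ₐ[k] Module.End k (Module.Dual k A) :=
  AlgHom.ofLinearMap (biact ∘ₗ (TensorProduct.mk k A A).flip 1)
    (by ext φ x; simp) (fun a b => by ext φ x; simp [mul_assoc, mul_left_comm])

@[simp] theorem dualAct_apply (a x : A) (φ : Module.Dual k A) :
    dualAct k A a φ x = φ (a * x) := by
  change φ (1 * (x * a)) = _
  rw [one_mul, mul_comm]

/-- The action of `A ⊗ A` on `A* ⊗ A`. -/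
def act₂ (k A : Type*) [Field k] [CommRing A] [HopfAlgebra k A] :
    A ⊗[k] A →ₐ[k] Module.End k (Module.Dual k A ⊗[k] A) :=
  tensorAct (dualAct k A) (Algebra.lmul k A)

@[simp] theorem act₂_tmul (a b h : A) (φ : Module.Dual k A) :
    act₂ k A (a ⊗ₜ b) (φ ⊗ₜ h) = dualAct k A a φ ⊗ₜ (b * h) := rfl

/-- The map `(a ⊗ b) ⊗ c ↦ a b ⊗ c`. -/
def collapse (k A : Type*) [Field k] [CommRing A] [HopfAlgebra k A] :
    (A ⊗[k] A) ⊗[k] A →ₐ[k] A ⊗[k] A :=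
  Algebra.TensorProduct.map (Algebra.TensorProduct.lmul' k) (AlgHom.id k A)

@[simp] theorem collapse_tmul (F : A ⊗[k] A) (c : A) :
    collapse k A (F ⊗ₜ c) = LinearMap.mul' k A F ⊗ₜ c := rfl

/-- In a commutative algebra `a ⇀ φ ↼ b` depends only on `ab`. This allows `Ω` and the other twists
of the double to be treated as functions of one point per tensor factor. -/
theorem biact_eq (F : A ⊗[k] A) : biact F = dualAct k A (LinearMap.mul' k A F) := by
  induction F with
  | zero => simp
  | add a b ha hb => simp only [map_add, ha, hb]
  | tmul a b =>
    ext φ x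
    simp only [biact_tmul, dualAct_apply, LinearMap.mul'_apply]
    ring_nf

theorem biactMul_eq (F : (A ⊗[k] A) ⊗[k] A) : biactMul F = act₂ k A (collapse k A F) := by
  induction F with
  | zero => simp
  | add a b ha hb => simp only [map_add, ha, hb]
  | tmul a b =>
    refine TensorProduct.ext' fun φ h => ?_
    change biact a φ ⊗ₜ[k] (b * h) = _
    rw [biact_eq]
    rfl

theorem dualAct_counit (a : A) : dualAct k A a Coalgebra.counit =
    Coalgebra.counit (R := k) a • (Coalgebra.counit : Module.Dual k A) := by
  ext x
  simp

/-- Because `a ⇀ ε = ε(a) ε`, acting on `ε` evaluates the corresponding point at 1. -/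
theorem tensorAct_counit_tmul {C N : Type*} [Ring C] [Algebra k C] [AddCommMonoid N] [Module k N]
    (σ : C →ₐ[k] Module.End k N) (F : A ⊗[k] C) (n : N) :
    tensorAct (dualAct k A) σ F ((Coalgebra.counit : Module.Dual k A) ⊗ₜ n) =
      (Coalgebra.counit : Module.Dual k A) ⊗ₜ σ (contractLeft Coalgebra.counit F) n := by
  induction F with
  | zero => simp
  | add a b ha hb => simp only [map_add, LinearMap.add_apply, TensorProduct.tmul_add, ha, hb]
  | tmul a b => simp [dualAct_counit, TensorProduct.smul_tmul]

theorem act₂_counit_tmul (F : A ⊗[k] A) (h : A) :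
    act₂ k A F ((Coalgebra.counit : Module.Dual k A) ⊗ₜ h) =
      (Coalgebra.counit : Module.Dual k A) ⊗ₜ (contractLeft Coalgebra.counit F * h) :=
  tensorAct_counit_tmul _ _ _

/-- Because `b r = ε(b) r`, acting on an integral evaluates the point `g` at 1. -/
theorem act₂_tmul_integral {r : A} (hr : ∀ a, a * r = Coalgebra.counit (R := k) a • r)
    (F : A ⊗[k] A) (φ : Module.Dual k A) :
    act₂ k A F (φ ⊗ₜ r) = dualAct k A (contractRight Coalgebra.counit F) φ ⊗ₜ r := by
  induction F with
  | zero => simp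
  | add a b ha hb => simp only [map_add, LinearMap.add_apply, TensorProduct.add_tmul, ha, hb]
  | tmul a b => simp [hr, TensorProduct.smul_tmul]

theorem act₂_one_tmul (a : A) (y : Module.Dual k A ⊗[k] A) :
    act₂ k A (1 ⊗ₜ a) y = LinearMap.lTensor _ (LinearMap.mulLeft k a) y := by
  induction y with
  | zero => simp
  | add a b ha hb => simp only [map_add, ha, hb]
  | tmul φ h => simp

end Actions

/-! ### The multiplication of the quantum double of a commutative twist -/

section DoubleMul

open Point

variable {k A : Type*} [Field k] [CommRing A] [HopfAlgebra k A]
variable {R : Type*} [CommRing R] [Algebra k R]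

/-- The map `(a ⊗ b) ⊗ ((c ⊗ d) ⊗ e) ↦ a b ⊗ (c d ⊗ e)`. -/
def collapseΩ (k A : Type*) [Field k] [CommRing A] [HopfAlgebra k A] :
    (A ⊗[k] A) ⊗[k] ((A ⊗[k] A) ⊗[k] A) →ₐ[k] A ⊗[k] (A ⊗[k] A) :=
  Algebra.TensorProduct.map (Algebra.TensorProduct.lmul' k) (collapse k A)

/-- The action of `A ⊗ (A ⊗ A)` on `A* ⊗ (A* ⊗ A)`. -/
def act₃ (k A : Type*) [Field k] [CommRing A] [HopfAlgebra k A] :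
    A ⊗[k] (A ⊗[k] A) →ₐ[k] Module.End k (Module.Dual k A ⊗[k] (Module.Dual k A ⊗[k] A)) :=
  tensorAct (dualAct k A) (act₂ k A)

theorem act₃_eq (F : (A ⊗[k] A) ⊗[k] ((A ⊗[k] A) ⊗[k] A)) :
    (TensorProduct.homTensorHomMap (.id k) _ _ _ _ ∘ₗ TensorProduct.map biact biactMul) F =
      act₃ k A (collapseΩ k A F) := by
  induction F with
  | zero => simp
  | add a b ha hb => rw [map_add, map_add, map_add, ha, hb]
  | tmul a b =>
    refine TensorProduct.ext' fun φ x => ?_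
    change biact a φ ⊗ₜ[k] biactMul b x = _
    rw [biact_eq, biactMul_eq]
    rfl

theorem act₃_one_middle {F : A ⊗[k] (A ⊗[k] A)}
    (φ : Module.Dual k A) (h : A) :
    act₃ k A F (φ ⊗ₜ ((Coalgebra.counit : Module.Dual k A) ⊗ₜ h)) =
      TensorProduct.leftComm k _ _ _ ((Coalgebra.counit : Module.Dual k A) ⊗ₜ
        act₂ k A (LinearMap.lTensor A (contractLeft Coalgebra.counit) F) (φ ⊗ₜ h)) := by
  induction F with
  | zero => simp
  | add a b ha hb =>
    simp only [map_add, LinearMap.add_apply, TensorProduct.tmul_add, ha, hb]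
  | tmul a b =>
    change dualAct k A a φ ⊗ₜ act₂ k A b (_ ⊗ₜ h) = _
    rw [act₂_counit_tmul, LinearMap.lTensor_tmul, act₂_tmul, TensorProduct.leftComm_tmul]

theorem act₃_integral {r : A} (hr : ∀ a, a * r = Coalgebra.counit (R := k) a • r)
    (F : A ⊗[k] (A ⊗[k] A)) (φ ψ : Module.Dual k A) :
    act₃ k A F (φ ⊗ₜ (ψ ⊗ₜ r)) = TensorProduct.assoc k _ _ _
      (tensorAct (dualAct k A) (dualAct k A)
        (LinearMap.lTensor A (contractRight Coalgebra.counit) F) (φ ⊗ₜ ψ) ⊗ₜ r) := by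
  induction F with
  | zero => simp
  | add a b ha hb =>
    simp only [map_add, LinearMap.add_apply, TensorProduct.add_tmul, ha, hb]
  | tmul a b =>
    change dualAct k A a φ ⊗ₜ act₂ k A b (ψ ⊗ₜ r) = _
    rw [act₂_tmul_integral hr]
    rfl

theorem contractLeft_eq_one {F : A ⊗[k] (A ⊗[k] A)}
    (h : ∀ y z : Point k A (A ⊗[k] A), ev₃ 1 y z F = 1) :
    contractLeft Coalgebra.counit F = 1 :=
  eq_of_ev₂ fun y z => by rw [← ev₃_one_left, h, map_one]

theorem lTensor_contractLeft_eq_one {F : A ⊗[k] (A ⊗[k] A)}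
    (h : ∀ x z : Point k A (A ⊗[k] A), ev₃ x 1 z F = 1) :
    LinearMap.lTensor A (contractLeft Coalgebra.counit) F = 1 :=
  eq_of_ev₂ fun y z => by rw [← ev₃_one_middle, h, map_one]

theorem lTensor_contractRight_eq_one {F : A ⊗[k] (A ⊗[k] A)}
    (h : ∀ x y : Point k A (A ⊗[k] A), ev₃ x y 1 F = 1) :
    LinearMap.lTensor A (contractRight Coalgebra.counit) F = 1 :=
  eq_of_ev₂ fun y z => by rw [← ev₃_one_right, h, map_one]

/-- No case for 0 is required, as it is `bowtie 0 0`. -/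
theorem QuantumDouble.induction_on {Q : QuasiHopfData k A} {p : QuantumDouble Q → Prop}
    (y : QuantumDouble Q) (add : ∀ x y, p x → p y → p (x + y))
    (bowtie : ∀ φ h, p (QuantumDouble.bowtie Q φ h)) : p y :=
  TensorProduct.induction_on (motive := p) y
    (show p (0 : QuantumDouble Q) by simpa using bowtie 0 0) bowtie add

/-- The action of `A ⊗ A` on the quantum double, `(a ⊗ b)(φ ⋈ h) = (a ⇀ φ) ⋈ b h`. -/
def actD (Q : QuasiHopfData k A) : A ⊗[k] A →ₐ[k] Module.End k (QuantumDouble Q) := act₂ k A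

@[simp] theorem actD_bowtie (Q : QuasiHopfData k A) (a b h : A) (φ : Module.Dual k A) :
    actD Q (a ⊗ₜ b) (QuantumDouble.bowtie Q φ h) =
      QuantumDouble.bowtie Q (dualAct k A a φ) (b * h) := rfl

namespace IsTwist

variable {Q : QuasiHopfData k A} (hQ : IsTwist Q)

include hQ

theorem ev₃_comulLeft (x y z : Point k A R) (a : A) :
    ev₃ x y z (Q.comulLeft a) = (x * y * z) a := by
  rw [← ev₂_comul, ← ev₃_assoc_comul, QuasiHopfData.comulLeft, hQ.comul_eq]
  rfl

/-- The point `x` belongs to `Ω¹`, `Ω⁵` (acting on `φ`), `y` to `Ω²`, `Ω⁴` (acting on `ψ`) and `g`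
to `Ω³`; the legs under `S⁻¹` are evaluated at inverse points. -/
theorem ev₃_Ω (x y g : Point k A R) : ev₃ x y g (collapseΩ k A Q.Ω) =
    ev₂ y⁻¹ x⁻¹ Q.f * v Q (x * y * g) y⁻¹ x⁻¹ * w Q x y g * w Q x (y * g) y⁻¹ := by
  let e : (A ⊗[k] A) ⊗[k] Triple k A →ₐ[k] R := ((ev₃ x y g).comp (collapseΩ k A)).comp
    (Algebra.TensorProduct.map
      (Algebra.TensorProduct.map (AlgHom.id k A) (HopfAlgebra.antipodeAlgHom k A))
      (Algebra.TensorProduct.map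
        (Algebra.TensorProduct.map (AlgHom.id k A) (HopfAlgebra.antipodeAlgHom k A))
        (AlgHom.id k A)))
  have he : ∀ a b c d l : A, e ((a ⊗ₜ b) ⊗ₜ ((c ⊗ₜ d) ⊗ₜ l)) =
      (x a * x⁻¹ b) * ((y c * y⁻¹ d) * g l) := by
    intro a b c d l
    change ev₃ x y g ((a * HopfAlgebra.antipode k b) ⊗ₜ
      ((c * HopfAlgebra.antipode k d) ⊗ₜ l)) = _
    simp [apply_antipode]
  unfold QuasiHopfData.Ω
  extract_lets i₁ i₅ i₂ i₄ i₃
  have h1 : ∀ a, e (i₁ a) = x a := fun a =>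
    (he a 1 1 1 1).trans (by simp)
  have h2 : ∀ a, e (i₂ a) = y a := fun a =>
    (he 1 1 a 1 1).trans (by simp)
  have h3 : ∀ a, e (i₃ a) = g a := fun a =>
    (he 1 1 1 1 a).trans (by simp)
  have h4 : ∀ a, e (i₄ a) = y⁻¹ a := fun a =>
    (he 1 1 1 a 1).trans (by simp)
  have h5 : ∀ a, e (i₅ a) = x⁻¹ a := fun a =>
    (he 1 a 1 1 1).trans (by simp)
  have h6 : ∀ a, e ((mulMap₃ i₁ i₂ i₃ ∘ₗ Q.comulLeft) a) = (x * y * g) a := fun a => by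
    rw [LinearMap.comp_apply, map_mulMap₃ e h1 h2 h3, hQ.ev₃_comulLeft]
  have h7 : ∀ a, e ((mulMap₂ i₂ i₃ ∘ₗ Q.comul) a) = (y * g) a := fun a => by
    rw [LinearMap.comp_apply, map_mulMap₂ e h2 h3, hQ.comul_eq, ev₂_comul]
  rw [hQ.antipodeInv_eq]
  change e _ = _
  rw [map_mul, map_mul, map_mul, map_mulMap₂ e h4 h5, map_mulMap₃ e h6 h4 h5,
    map_mulMap₃ e h1 h2 h3, map_mulMap₃ e h1 h7 h4]

theorem ev₂_f_one_right (x : Point k A R) : ev₂ x 1 Q.f = 1 := by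
  rw [hQ.ev₂_f]
  simp [hQ.v_one_left, hQ.w_one_right]

theorem ev₂_f_one_left (x : Point k A R) : ev₂ 1 x Q.f = 1 := by
  rw [hQ.ev₂_f]
  simp [hQ.v_one_middle, hQ.w_one_middle]

/-- The specializations `x = 1`, `y = 1` and `g = 1` govern products with `φ = ε`, with `ψ = ε` and
with an integral in the last place. The twist disappears in each of them, so no other values of `Ω`
are needed. -/
theorem Ω_one_left : contractLeft Coalgebra.counit (collapseΩ k A Q.Ω) = 1 :=
  contractLeft_eq_one fun y z => by
    rw [hQ.ev₃_Ω]
    simp [hQ.ev₂_f_one_right, hQ.v_one_right, hQ.w_one_left]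

theorem Ω_one_middle :
    LinearMap.lTensor A (contractLeft Coalgebra.counit) (collapseΩ k A Q.Ω) = 1 :=
  lTensor_contractLeft_eq_one fun y z => by
    rw [hQ.ev₃_Ω]
    simp [hQ.ev₂_f_one_left, hQ.v_one_middle, hQ.w_one_middle, hQ.w_one_right]

/-- Here the values of `Φ` and `Φ⁻¹` do not vanish one by one; they cancel against the two factors
of `f(y⁻¹, x⁻¹)`. -/
theorem Ω_one_right :
    LinearMap.lTensor A (contractRight Coalgebra.counit) (collapseΩ k A Q.Ω) = 1 :=
  lTensor_contractRight_eq_one fun x y => by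
    rw [hQ.ev₃_Ω, hQ.ev₂_f, mul_one, mul_one, hQ.w_one_right, inv_inv, inv_inv, mul_one,
      mul_right_comm, mul_right_comm (v Q x y y⁻¹), hQ.v_mul_w, one_mul, mul_comm, hQ.v_mul_w]

/-! The product -/

theorem collapse_splitComul (a : A) : collapse k A (Q.splitComul a) = ad k a := by
  refine eq_of_ev₂ fun x y => ?_
  have h1 : ∀ (G : A ⊗[k] A) (c : A), ev₂ x y (collapse k A
      (LinearMap.rTensor A (LinearMap.lTensor A (HopfAlgebra.antipode k))
        (TensorProduct.rightComm k A A A (G ⊗ₜ c)))) = ev₂ x y G * x⁻¹ c := by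
    intro G c
    induction G with
    | zero => simp
    | add a b ha hb => simp only [TensorProduct.add_tmul, map_add, ha, hb, add_mul]
    | tmul a b => simp [apply_antipode, mul_right_comm]
  have h2 : ∀ F : A ⊗[k] A, ev₂ x y (collapse k A
      (LinearMap.rTensor A (LinearMap.lTensor A (HopfAlgebra.antipode k))
        (TensorProduct.rightComm k A A A (LinearMap.rTensor A Coalgebra.comul F)))) =
      ev₂ (x * y) x⁻¹ F := by
    intro F
    induction F with
    | zero => simp
    | add a b ha hb => simp only [map_add, ha, hb]
    | tmul a b => simp [h1, ev₂_comul]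
  rw [ev₂_ad, ← ev₂_comul, ← h2, QuasiHopfData.splitComul, hQ.antipodeInv_eq, hQ.comul_eq]
  rfl

omit hQ in
theorem dualMul_tmul_apply (φ ψ : Module.Dual k A) (a : A) :
    Q.dualMul (φ ⊗ₜ ψ) a = φ (contractRight ψ (Q.comul a)) := by
  have h : ∀ F : A ⊗[k] A, TensorProduct.dualDistrib k A A (φ ⊗ₜ ψ) F = φ (contractRight ψ F) := by
    intro F
    induction F with
    | zero => simp
    | add a b ha hb => simp only [map_add, ha, hb]
    | tmul a b => simp [mul_comm]
  exact h _

theorem dualMul_counit_left (ψ : Module.Dual k A) :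
    Q.dualMul ((Coalgebra.counit : Module.Dual k A) ⊗ₜ ψ) = ψ := by
  ext a
  rw [dualMul_tmul_apply, hQ.comul_eq, apply_contractRight, contractLeft_counit_comul]

theorem dualMul_counit_right (φ : Module.Dual k A) :
    Q.dualMul (φ ⊗ₜ (Coalgebra.counit : Module.Dual k A)) = φ := by
  ext a
  rw [dualMul_tmul_apply, hQ.comul_eq, contractRight_counit_comul]

omit hQ in
theorem ΩAct_apply (x : Module.Dual k A ⊗[k] (Module.Dual k A ⊗[k] A)) :
    Q.ΩAct x = LinearMap.rTensor A Q.dualMul ((TensorProduct.assoc k _ _ _).symm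
      (act₃ k A (collapseΩ k A Q.Ω) x)) := by
  rw [← act₃_eq]
  rfl

theorem bowtie_mul (φ : Module.Dual k A) (h : A) (y : QuantumDouble Q) :
    QuantumDouble.bowtie Q φ h * y = Q.ΩAct (φ ⊗ₜ actD Q (ad k h) y) := by
  rw [← hQ.collapse_splitComul]
  change Q.ΩAct (φ ⊗ₜ biactMul (Q.splitComul h) y) = _
  rw [biactMul_eq]
  rfl

theorem ΩAct_counit (z : Module.Dual k A ⊗[k] A) :
    Q.ΩAct ((Coalgebra.counit : Module.Dual k A) ⊗ₜ z) = z := by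
  rw [ΩAct_apply, act₃, tensorAct_counit_tmul, hQ.Ω_one_left, map_one, Module.End.one_apply]
  induction z with
  | zero => simp
  | add a b ha hb => simp only [TensorProduct.tmul_add, map_add, ha, hb]
  | tmul ψ b =>
    rw [TensorProduct.assoc_symm_tmul, LinearMap.rTensor_tmul, hQ.dualMul_counit_left]

/-- Left multiplication by `ε ⋈ a` is the function `a(xgx⁻¹)`; by `mul_incl` right multiplication is
`a(g)`. -/
theorem incl_mul (a : A) (y : QuantumDouble Q) :
    QuantumDouble.incl Q a * y = actD Q (ad k a) y := by
  refine (hQ.bowtie_mul _ a y).trans ?_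
  rw [hQ.counit_eq]
  exact hQ.ΩAct_counit _

theorem bowtie_mul_incl (φ : Module.Dual k A) (h a : A) :
    QuantumDouble.bowtie Q φ h * QuantumDouble.incl Q a = QuantumDouble.bowtie Q φ (h * a) := by
  refine (hQ.bowtie_mul _ h _).trans ?_
  change Q.ΩAct (φ ⊗ₜ act₂ k A (ad k h) (Q.counit ⊗ₜ a)) = _
  rw [hQ.counit_eq, act₂_counit_tmul, contractLeft_counit_ad, ΩAct_apply, act₃_one_middle,
    hQ.Ω_one_middle, map_one, Module.End.one_apply, TensorProduct.leftComm_tmul,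
    TensorProduct.assoc_symm_tmul, LinearMap.rTensor_tmul, hQ.dualMul_counit_right]
  rfl

theorem mul_incl (y : QuantumDouble Q) (a : A) :
    y * QuantumDouble.incl Q a = actD Q (1 ⊗ₜ a) y := by
  induction y using QuantumDouble.induction_on with
  | add x y hx hy => rw [add_mul, map_add, hx, hy]
  | bowtie φ h => rw [hQ.bowtie_mul_incl, actD_bowtie, map_one, mul_comm a, Module.End.one_apply]

theorem ΩAct_integral {r : A} (hr : ∀ a, a * r = Coalgebra.counit (R := k) a • r)
    (φ ψ : Module.Dual k A) : Q.ΩAct (φ ⊗ₜ (ψ ⊗ₜ r)) = Q.dualMul (φ ⊗ₜ ψ) ⊗ₜ r := by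
  rw [ΩAct_apply, act₃_integral hr, hQ.Ω_one_right, map_one, Module.End.one_apply,
    LinearEquiv.symm_apply_apply, LinearMap.rTensor_tmul]

theorem bowtie_mul_integral {r : A} (hr : ∀ a, a * r = Coalgebra.counit (R := k) a • r)
    (φ ψ : Module.Dual k A) (h : A) :
    QuantumDouble.bowtie Q φ h * QuantumDouble.bowtie Q ψ r =
      Coalgebra.counit (R := k) h • QuantumDouble.bowtie Q (Q.dualMul (φ ⊗ₜ ψ)) r := by
  refine (hQ.bowtie_mul φ h _).trans ?_
  change Q.ΩAct (φ ⊗ₜ act₂ k A (ad k h) (ψ ⊗ₜ r)) = _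
  rw [act₂_tmul_integral hr, contractRight_counit_ad, map_smul, map_one, hQ.ΩAct_integral hr,
    LinearMap.smul_apply, Module.End.one_apply, TensorProduct.tmul_smul, map_smul,
    ← TensorProduct.smul_tmul']
  rfl

/-- The action of `ad r` is `S(μ) ⊗ r` by `ad_integral`: the second leg turns `h` into `ε(h) r`, and
the first twists `ψ`. -/
theorem bowtie_integral_mul {m : A →ₗ[k] k} {r : A} (hI : IsIntegralPair m r)
    (φ ψ : Module.Dual k A) (h : A) :
    QuantumDouble.bowtie Q φ r * QuantumDouble.bowtie Q ψ h =
      Coalgebra.counit (R := k) h • QuantumDouble.bowtie Q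
        (Q.dualMul (φ ⊗ₜ dualAct k A (HopfAlgebra.antipode k (modularElt m r)) ψ)) r := by
  refine (hQ.bowtie_mul φ r _).trans ?_
  change Q.ΩAct (φ ⊗ₜ act₂ k A (ad k r) (ψ ⊗ₜ h)) = _
  rw [hI.ad_integral, act₂_tmul, mul_comm r, hI.mul_eq, TensorProduct.tmul_smul,
    TensorProduct.tmul_smul, map_smul, hQ.ΩAct_integral hI.mul_eq]
  rfl

end IsTwist

end DoubleMul

/-! ### Integrals in the quantum double of a commutative twist -/

section DoubleIntegrals

open Point QuantumDouble

variable {k A : Type*} [Field k] [CommRing A] [HopfAlgebra k A]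

namespace IsTwist

variable {Q : QuasiHopfData k A} (hQ : IsTwist Q) {m : A →ₗ[k] k} {r : A}

include hQ

theorem double_counit_bowtie (φ : Module.Dual k A) (h : A) :
    QuantumDouble.counit Q (bowtie Q φ h) = φ 1 * Coalgebra.counit (R := k) h := by
  change φ (Q.antipodeInv Q.α) * Q.counit h = _
  rw [hQ.antipodeInv_eq, hQ.α_eq, hQ.counit_eq, HopfAlgebra.antipode_one]

theorem double_counit_incl (a : A) :
    QuantumDouble.counit Q (incl Q a) = Coalgebra.counit (R := k) a := by
  refine (hQ.double_counit_bowtie _ a).trans ?_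
  rw [hQ.counit_eq, Bialgebra.counit_one, one_mul]

theorem dualMul_invariant {n : A →ₗ[k] k} (hn : IsLeftInvariant n)
    (φ : Module.Dual k A) : Q.dualMul (φ ⊗ₜ n) = φ 1 • n := by
  ext a
  rw [dualMul_tmul_apply, hQ.comul_eq, hn a, map_smul]
  simp [mul_comm]

/-- Since `m(a₁) a₂ = m(a) μ`, the left side at `a` is `m(a) ψ(S(μ) μ)`, and `μ` is group-like. This
cancellation makes the double unimodular whether or not `H` is. -/
theorem dualMul_modular [Module.Finite k A] (hI : IsIntegralPair m r) (ψ : Module.Dual k A) :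
    Q.dualMul (m ⊗ₜ dualAct k A (HopfAlgebra.antipode k (modularElt m r)) ψ) = ψ 1 • m := by
  ext a
  rw [dualMul_tmul_apply, hQ.comul_eq, apply_contractRight, hI.contractLeft_comul, map_smul]
  have h1 : HopfAlgebra.antipode k (modularElt m r) * modularElt m r = 1 :=
    hI.antipode_modular_mul
  change m a • dualAct k A (HopfAlgebra.antipode k (modularElt m r)) ψ (modularElt m r) = _
  rw [dualAct_apply, h1]
  simp [mul_comm]

theorem isLeftIntegral_double (hI : IsIntegralPair m r) :
    IsLeftIntegral (QuantumDouble.counit Q) (bowtie Q m r) := by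
  intro d
  induction d using QuantumDouble.induction_on with
  | add x y hx hy => rw [add_mul, map_add, add_smul, hx, hy]
  | bowtie φ h =>
    rw [hQ.bowtie_mul_integral hI.mul_eq, hQ.dualMul_invariant hI.invariant,
      hQ.double_counit_bowtie, map_smul, LinearMap.smul_apply, smul_smul, mul_comm]

theorem isRightIntegral_double [Module.Finite k A] (hI : IsIntegralPair m r) :
    IsRightIntegral (QuantumDouble.counit Q) (bowtie Q m r) := by
  intro d
  induction d using QuantumDouble.induction_on with
  | add x y hx hy => rw [mul_add, map_add, add_smul, hx, hy]
  | bowtie φ h =>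
    rw [hQ.bowtie_integral_mul hI, hQ.dualMul_modular hI,
      hQ.double_counit_bowtie, map_smul, LinearMap.smul_apply, smul_smul, mul_comm]

omit hQ in
theorem actD_one_tmul (a : A) (T : QuantumDouble Q) : actD Q (1 ⊗ₜ a) T =
    LinearMap.lTensor (Module.Dual k A) (LinearMap.mulLeft k a) T :=
  act₂_one_tmul a T

omit hQ in
theorem eq_bowtie_of_actD (hI : IsIntegralPair m r) {T : QuantumDouble Q}
    (hT : ∀ a, actD Q (1 ⊗ₜ a) T = Coalgebra.counit (R := k) a • T) :
    ∃ n : Module.Dual k A, T = bowtie Q n r :=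
  ⟨contractRight m (M := Module.Dual k A) T,
    hI.eq_tmul_of_integral fun a => (actD_one_tmul a T).symm.trans (hT a)⟩

omit hQ in
theorem bowtie_integral_injective (hI : IsIntegralPair m r) {n n' : Module.Dual k A}
    (h : bowtie Q n r = bowtie Q n' r) : n = n' := by
  have h1 := congrArg (contractRight m (M := Module.Dual k A)) h
  change contractRight m (n ⊗ₜ r) = contractRight m (n' ⊗ₜ r) at h1
  rwa [contractRight_tmul, contractRight_tmul, hI.apply_eq_one, one_smul, one_smul] at h1

/-- Multiplication by `ε ⋈ a` forces the `A`-component of `T` to be `r`, so `T = n ⋈ r`;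
multiplication by `φ ⋈ 1` then makes `n` left invariant. -/
theorem eq_smul_of_isLeftIntegral_double [Module.Finite k A] (hI : IsIntegralPair m r)
    {T : QuantumDouble Q} (hT : IsLeftIntegral (QuantumDouble.counit Q) T) :
    ∃ c : k, T = c • bowtie Q m r := by
  -- Being an integral only says that `a(xgx⁻¹)` acts as `ε(a)`. By linearity over functions of `x`
  -- every `F(x, xgx⁻¹)` acts as `F(x, 1)`, and `F = coad a` yields the untwisted function `a(g)`.
  have h1 : ∀ F : A ⊗[k] A, actD Q (conj₂ k A F) T =
      actD Q (contractRight Coalgebra.counit F ⊗ₜ 1) T := by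
    intro F
    induction F with
    | zero => simp
    | add a b ha hb => simp only [map_add, LinearMap.add_apply, TensorProduct.add_tmul, ha, hb]
    | tmul a b =>
      rw [conj₂_tmul, map_mul, Module.End.mul_apply, ← hQ.incl_mul, hT, hQ.double_counit_incl,
        contractRight_tmul, map_smul, ← TensorProduct.smul_tmul', map_smul, LinearMap.smul_apply]
  have h2 : ∀ a, actD Q (1 ⊗ₜ a) T = Coalgebra.counit (R := k) a • T := by
    intro a
    have h3 := h1 (coad k a)
    have h4 : conj₂ k A (coad k a) = 1 ⊗ₜ a := conj₂_conjInv₂ (1 ⊗ₜ a)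
    rwa [h4, contractRight_counit_coad, ← TensorProduct.smul_tmul', map_smul,
      ← Algebra.TensorProduct.one_def, map_one, LinearMap.smul_apply, Module.End.one_apply] at h3
  obtain ⟨n, rfl⟩ := eq_bowtie_of_actD hI h2
  have h5 : IsLeftInvariant n := by
    intro a
    refine (sub_eq_zero.mp ((Module.forall_dual_apply_eq_zero_iff k _).mp fun φ => ?_))
    have h6 := hT (bowtie Q φ 1)
    rw [hQ.bowtie_mul_integral hI.mul_eq, hQ.double_counit_bowtie, Bialgebra.counit_one, one_smul,
      mul_one, ← LinearMap.smul_apply, ← map_smul] at h6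
    have h7 := LinearMap.congr_fun (bowtie_integral_injective hI h6) a
    rw [dualMul_tmul_apply, hQ.comul_eq] at h7
    rw [map_sub, h7, map_smul, LinearMap.smul_apply, smul_eq_mul, smul_eq_mul, mul_comm, sub_self]
  exact ⟨n r, by rw [← LinearMap.smul_apply, ← map_smul, ← hI.eq_smul_of_invariant h5]⟩

theorem eq_smul_of_isRightIntegral_double [Module.Finite k A] (hI : IsIntegralPair m r)
    {T : QuantumDouble Q} (hT : IsRightIntegral (QuantumDouble.counit Q) T) :
    ∃ c : k, T = c • bowtie Q m r := by
  have h2 : ∀ a, actD Q (1 ⊗ₜ a) T = Coalgebra.counit (R := k) a • T := by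
    intro a
    rw [← hQ.mul_incl, hT, hQ.double_counit_incl]
  obtain ⟨n, rfl⟩ := eq_bowtie_of_actD hI h2
  set μ := modularElt m r with hμ
  have hSμ : HopfAlgebra.antipode k μ * μ = 1 := hI.antipode_modular_mul
  -- The condition on `n'` means `n'(a₁) a₂ = n'(a) μ`. Then `a ↦ n'(S(S(μ) a))` is left invariant,
  -- hence a multiple of `m`. This applies to `n` and to `m` itself, and comparing the two results
  -- gives `n = n(r) m`.
  have h3 : ∀ (n' : Module.Dual k A), (∀ ψ : Module.Dual k A, Q.dualMul
      (n' ⊗ₜ dualAct k A (HopfAlgebra.antipode k μ) ψ) = ψ 1 • n') →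
      ∀ a, n' (HopfAlgebra.antipode k (HopfAlgebra.antipode k μ * a)) = n' r * m a := by
    intro n' hn'
    have h4 : ∀ a, contractLeft n' (Coalgebra.comul a) = n' a • μ := by
      intro a
      refine sub_eq_zero.mp ((Module.forall_dual_apply_eq_zero_iff k _).mp fun z => ?_)
      have h5 := LinearMap.congr_fun (hn' (dualAct k A μ z)) a
      rw [← Module.End.mul_apply, ← map_mul, hSμ, map_one, Module.End.one_apply,
        dualMul_tmul_apply, hQ.comul_eq, apply_contractRight, dualAct_apply, mul_one] at h5
      rw [map_sub, h5, map_smul, LinearMap.smul_apply, smul_eq_mul, smul_eq_mul, mul_comm,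
        sub_self]
    have h6 : IsLeftInvariant (n' ∘ₗ HopfAlgebra.antipode k ∘ₗ
        LinearMap.mulLeft k (HopfAlgebra.antipode k μ)) := by
      intro a
      have h7 : ∀ F : A ⊗[k] A, contractRight (n' ∘ₗ HopfAlgebra.antipode k ∘ₗ
          LinearMap.mulLeft k (HopfAlgebra.antipode k μ)) F =
          HopfAlgebra.antipode k (contractLeft n' ((μ ⊗ₜ 1) * (TensorProduct.comm k A A
            (TensorProduct.map (HopfAlgebra.antipode k) (HopfAlgebra.antipode k) F)))) := by
        intro F
        induction F with
        | zero => simp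
        | add a b ha hb => simp only [map_add, mul_add, ha, hb]
        | tmul a b => simp [HopfAlgebra.antipode_mul_distrib, antipode_antipode]
      have h8 : ∀ F : A ⊗[k] A, contractLeft n' ((μ ⊗ₜ 1) * F) =
          HopfAlgebra.antipode k μ * contractLeft n' ((μ ⊗ₜ μ) * F) := by
        intro F
        rw [← contractLeft_one_tmul_mul, ← mul_assoc, Algebra.TensorProduct.tmul_mul_tmul, hSμ,
          one_mul]
      have h9 : Coalgebra.comul μ = μ ⊗ₜ[k] μ := hI.comul_modular
      rw [h7, h8, ← comul_antipode, ← h9, ← Bialgebra.comul_mul, h4, mul_smul_comm, hSμ, map_smul,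
        HopfAlgebra.antipode_one]
      simp [HopfAlgebra.antipode_mul_distrib, antipode_antipode]
    intro a
    have h10 := LinearMap.congr_fun (hI.eq_smul_of_invariant h6) a
    simp only [LinearMap.comp_apply, LinearMap.mulLeft_apply, LinearMap.smul_apply, smul_eq_mul]
      at h10
    have h11 : Coalgebra.counit (R := k) μ = 1 := hI.counit_modular
    rw [h10, hI.mul_eq, HopfAlgebra.counit_antipode, h11, one_smul, hI.antipode_integral]
  have h12 : ∀ ψ : Module.Dual k A, Q.dualMul
      (n ⊗ₜ dualAct k A (HopfAlgebra.antipode k μ) ψ) = ψ 1 • n := by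
    intro ψ
    have h13 := hT (bowtie Q ψ 1)
    rw [hQ.bowtie_integral_mul hI, hQ.double_counit_bowtie, Bialgebra.counit_one, one_smul,
      mul_one, ← LinearMap.smul_apply, ← map_smul] at h13
    exact bowtie_integral_injective hI h13
  have h14 := h3 n h12
  have h15 := h3 m (hQ.dualMul_modular hI)
  refine ⟨n r, ?_⟩
  rw [← LinearMap.smul_apply, ← map_smul]
  congr 2
  ext a
  have h16 : HopfAlgebra.antipode k (HopfAlgebra.antipode k μ *
      (μ * HopfAlgebra.antipode k a)) = a := by
    rw [← mul_assoc, hSμ, one_mul, antipode_antipode]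
  have h17 := h14 (μ * HopfAlgebra.antipode k a)
  have h18 := h15 (μ * HopfAlgebra.antipode k a)
  rw [h16] at h17 h18
  rw [h17, LinearMap.smul_apply, h18, hI.apply_eq_one, one_mul, smul_eq_mul]

omit hQ in
theorem bowtie_integral_ne_zero (hI : IsIntegralPair m r) : bowtie Q m r ≠ 0 := by
  intro h
  refine hI.ne_zero (bowtie_integral_injective (Q := Q) hI ?_)
  rw [h, map_zero, LinearMap.zero_apply]

theorem isModularFunctional_double_iff [Module.Finite k A] (hI : IsIntegralPair m r)
    {ν : QuantumDouble Q →ₗ[k] k} :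
    IsModularFunctional (QuantumDouble.counit Q) ν ↔ ν = QuantumDouble.counit Q := by
  constructor
  · rintro ⟨T, h0, hT, h1⟩
    obtain ⟨c, rfl⟩ := hQ.eq_smul_of_isLeftIntegral_double hI hT
    refine LinearMap.ext fun d => ?_
    have h2 := h1 d
    rw [smul_mul_assoc, hQ.isRightIntegral_double hI d, smul_comm] at h2
    exact (smul_left_injective k h0 h2).symm
  · rintro rfl
    exact ⟨_, bowtie_integral_ne_zero hI, hQ.isLeftIntegral_double hI,
      hQ.isRightIntegral_double hI⟩

end IsTwist

end DoubleIntegrals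

/-! ### The comultiplication of the quantum double of a commutative twist -/

section DoubleComul

open Point QuantumDouble

variable {k A : Type*} [Field k] [CommRing A] [HopfAlgebra k A]
variable {R : Type*} [CommRing R] [Algebra k R]

/-- Evaluation of an element of `(A ⊗ A) ⊗ (A ⊗ A)` at two pairs of points. -/
def Point.ev₂₂ (x g x' g' : Point k A R) : (A ⊗[k] A) ⊗[k] (A ⊗[k] A) →ₐ[k] R :=
  Algebra.TensorProduct.lift (ev₂ x g) (ev₂ x' g') fun _ _ => .all _ _

@[simp] theorem Point.ev₂₂_tmul (x g x' g' : Point k A R) (F G : A ⊗[k] A) :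
    ev₂₂ x g x' g' (F ⊗ₜ G) = ev₂ x g F * ev₂ x' g' G := by
  simp [ev₂₂]

/-- The map `s ⊗ (u ⊗ v) ↦ ad(s) u ⊗ v`, where the first two factors of `u` and of `v` are
multiplied. -/
def collapseComul (k A : Type*) [Field k] [CommRing A] [HopfAlgebra k A] :
    A ⊗[k] (Triple k A ⊗[k] Triple k A) →ₐ[k] (A ⊗[k] A) ⊗[k] (A ⊗[k] A) :=
  Algebra.TensorProduct.lift
    ((Algebra.TensorProduct.includeLeft : A ⊗[k] A →ₐ[k] (A ⊗[k] A) ⊗[k] (A ⊗[k] A)).comp (ad k))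
    (Algebra.TensorProduct.map (collapse k A) (collapse k A)) fun _ _ => .all _ _

theorem collapseComul_tmul (s : A) (u v : Triple k A) :
    collapseComul k A (s ⊗ₜ (u ⊗ₜ v)) = (ad k s * collapse k A u) ⊗ₜ collapse k A v := by
  simp [collapseComul]

/-! ### Contraction of coproducts in the double with product functionals. -/

section Contract

/-- The tensor `φ₂ x ⊗ φ₁ y` for `E = φ₁ ⊗ φ₂` and `G = x ⊗ y`. -/
def shuffle (Q : QuasiHopfData k A) (E : Module.Dual k A ⊗[k] Module.Dual k A) (G : A ⊗[k] A) :
    QuantumDouble Q ⊗[k] QuantumDouble Q :=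
  TensorProduct.tensorTensorTensorComm k (Module.Dual k A) (Module.Dual k A) A A
    (TensorProduct.comm k _ _ E ⊗ₜ G)

variable (Q : QuasiHopfData k A)

theorem shuffle_tmul (φ₁ φ₂ : Module.Dual k A) (x y : A) :
    shuffle Q (φ₁ ⊗ₜ φ₂) (x ⊗ₜ y) = bowtie Q φ₂ x ⊗ₜ bowtie Q φ₁ y := rfl

theorem shuffle_add_left (E E' : Module.Dual k A ⊗[k] Module.Dual k A) (G : A ⊗[k] A) :
    shuffle Q (E + E') G = shuffle Q E G + shuffle Q E' G := by
  unfold shuffle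
  rw [map_add, TensorProduct.add_tmul, map_add]
  rfl

theorem shuffle_add_right (E : Module.Dual k A ⊗[k] Module.Dual k A) (G G' : A ⊗[k] A) :
    shuffle Q E (G + G') = shuffle Q E G + shuffle Q E G' := by
  unfold shuffle
  rw [TensorProduct.tmul_add, map_add]
  rfl

theorem shuffle_zero_left (G : A ⊗[k] A) : shuffle Q 0 G = 0 := by
  unfold shuffle
  rw [map_zero, TensorProduct.zero_tmul, map_zero]
  rfl

theorem shuffle_zero_right (E : Module.Dual k A ⊗[k] Module.Dual k A) : shuffle Q E 0 = 0 := by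
  unfold shuffle
  rw [TensorProduct.tmul_zero, map_zero]
  rfl

/-- The action of `(A ⊗ A) ⊗ (A ⊗ A)` on the tensor square of the quantum double. -/
def actDD : (A ⊗[k] A) ⊗[k] (A ⊗[k] A) →ₐ[k]
    Module.End k (QuantumDouble Q ⊗[k] QuantumDouble Q) :=
  tensorAct (actD Q) (actD Q)

theorem actDD_tmul (F G : A ⊗[k] A) (x y : QuantumDouble Q) :
    actDD Q (F ⊗ₜ G) (x ⊗ₜ y) = actD Q F x ⊗ₜ actD Q G y := rfl

variable {Q}

theorem tensor_induction {p : (A ⊗[k] A) ⊗[k] (A ⊗[k] A) → A ⊗[k] A → Prop}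
    (zero₁ : ∀ G, p 0 G) (zero₂ : ∀ F, p F 0)
    (add₁ : ∀ F F' G, p F G → p F' G → p (F + F') G)
    (add₂ : ∀ F G G', p F G → p F G' → p F (G + G'))
    (tmul : ∀ a b c d x y, p ((a ⊗ₜ b) ⊗ₜ (c ⊗ₜ d)) (x ⊗ₜ y)) (F G) : p F G := by
  induction F with
  | zero => exact zero₁ _
  | add F F' h h' => exact add₁ _ _ _ h h'
  | tmul F F' =>
    induction F with
    | zero => rw [TensorProduct.zero_tmul]; exact zero₁ _
    | add F F' h h' => rw [TensorProduct.add_tmul]; exact add₁ _ _ _ h h'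
    | tmul a b =>
      induction F' with
      | zero => rw [TensorProduct.tmul_zero]; exact zero₁ _
      | add F F' h h' => rw [TensorProduct.tmul_add]; exact add₁ _ _ _ h h'
      | tmul c d =>
        induction G with
        | zero => exact zero₂ _
        | add G G' h h' => exact add₂ _ _ _ h h'
        | tmul x y => exact tmul _ _ _ _ _ _

/-- The functional `φ ⋈ h ↦ φ(r) l(h)` on the quantum double. -/
def prodFunctional (Q : QuasiHopfData k A) (r : A) (l : A →ₗ[k] k) : QuantumDouble Q →ₗ[k] k :=
  LinearMap.mul' k k ∘ₗ TensorProduct.map (Module.Dual.eval k A r) l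

@[simp] theorem prodFunctional_bowtie (r : A) (l : A →ₗ[k] k) (φ : Module.Dual k A) (h : A) :
    prodFunctional Q r l (bowtie Q φ h) = φ r * l h := rfl

theorem ev₂₂_one_tmul (a b c d : A) :
    ev₂₂ 1 fst₂ 1 snd₂ ((a ⊗ₜ b) ⊗ₜ (c ⊗ₜ d)) =
      (Coalgebra.counit (R := k) a * Coalgebra.counit (R := k) c) • (b ⊗ₜ[k] d) := by
  rw [ev₂₂_tmul, ev₂_tmul, ev₂_tmul, one_apply, one_apply, fst₂_apply, snd₂_apply,
    ← Algebra.smul_def, ← Algebra.smul_def, smul_mul_smul_comm, Algebra.TensorProduct.tmul_mul_tmul,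
    mul_one, one_mul]

theorem ev₂₂_fst_tmul (a b c d : A) :
    ev₂₂ fst₂ 1 fst₂ snd₂ ((a ⊗ₜ b) ⊗ₜ (c ⊗ₜ d)) =
      Coalgebra.counit (R := k) b • ((a * c) ⊗ₜ[k] d) := by
  rw [ev₂₂_tmul, ev₂_tmul, ev₂_tmul, one_apply, fst₂_apply, fst₂_apply, snd₂_apply,
    mul_comm _ (algebraMap _ _ _), ← Algebra.smul_def, smul_mul_assoc,
    Algebra.TensorProduct.tmul_mul_tmul, Algebra.TensorProduct.tmul_mul_tmul,
    mul_one, one_mul, one_mul]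

theorem apply_mul_integral {r : A} (hr : ∀ a, a * r = Coalgebra.counit (R := k) a • r) (a : A)
    (φ : Module.Dual k A) : dualAct k A a φ r = Coalgebra.counit (R := k) a * φ r := by
  rw [dualAct_apply, hr, map_smul, smul_eq_mul]

theorem contractRight_dualComul [Module.Finite k A] (φ : Module.Dual k A) (a : A) :
    contractRight (Module.Dual.eval k A a) (dualComul k A φ) = dualAct k A a φ := by
  have h : ∀ (E : Module.Dual k A ⊗[k] Module.Dual k A) (x : A),
      contractRight (Module.Dual.eval k A a) E x = TensorProduct.dualDistrib k A A E (x ⊗ₜ a) := by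
    intro E x
    induction E with
    | zero => simp
    | add a b ha hb => simp only [map_add, LinearMap.add_apply, ha, hb]
    | tmul a b => simp [mul_comm]
  have h1 : TensorProduct.dualDistrib k A A (dualComul k A φ) = φ ∘ₗ LinearMap.mul' k A :=
    (TensorProduct.dualDistribEquiv k A A).apply_symm_apply _
  ext x
  rw [h, h1]
  simp [mul_comm]

theorem contractLeft_dualComul [Module.Finite k A] (φ : Module.Dual k A) (a : A) :
    contractLeft (Module.Dual.eval k A a) (dualComul k A φ) = dualAct k A a φ := by
  have h : ∀ (E : Module.Dual k A ⊗[k] Module.Dual k A) (x : A),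
      contractLeft (Module.Dual.eval k A a) E x = TensorProduct.dualDistrib k A A E (a ⊗ₜ x) := by
    intro E x
    induction E with
    | zero => simp
    | add a b ha hb => simp only [map_add, LinearMap.add_apply, ha, hb]
    | tmul a b => simp
  have h1 : TensorProduct.dualDistrib k A A (dualComul k A φ) = φ ∘ₗ LinearMap.mul' k A :=
    (TensorProduct.dualDistribEquiv k A A).apply_symm_apply _
  ext x
  rw [h, h1]
  simp

theorem dualAct_integral {r : A} (hr : ∀ a, a * r = Coalgebra.counit (R := k) a • r)
    (φ : Module.Dual k A) : dualAct k A r φ = φ r • (Coalgebra.counit : Module.Dual k A) := by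
  ext a
  rw [dualAct_apply, mul_comm, hr]
  simp [mul_comm]

/-- Evaluating one leg of the coproduct of `φ` at `r` sets its point to 1, as `φ(ar) = ε(a) φ(r)`.
The other leg becomes `r ⇀ φ = φ(r) ε`, whose point is therefore set to 1 as well. Only the values
`F(1, g, 1, g')` matter. -/
theorem contractLeft_prodFunctional [Module.Finite k A] {r : A}
    (hr : ∀ a, a * r = Coalgebra.counit (R := k) a • r)
    (l : A →ₗ[k] k) (φ : Module.Dual k A) (F : (A ⊗[k] A) ⊗[k] (A ⊗[k] A)) (G : A ⊗[k] A) :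
    contractLeft (prodFunctional Q r l) (actDD Q F (shuffle Q (dualComul k A φ) G)) =
      φ r • bowtie Q Coalgebra.counit (contractLeft l (ev₂₂ 1 fst₂ 1 snd₂ F * G)) := by
  refine tensor_induction (p := fun F G => contractLeft (prodFunctional Q r l)
    (actDD Q F (shuffle Q (dualComul k A φ) G)) = φ r • bowtie Q Coalgebra.counit
      (contractLeft l (ev₂₂ 1 fst₂ 1 snd₂ F * G))) ?_ ?_ ?_ ?_ ?_ F G
  · intro G; simp
  · intro F; simp [shuffle_zero_right]
  · intro F F' G h h'
    simp only [map_add, add_mul, LinearMap.add_apply, smul_add, h, h']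
  · intro F G G' h h'
    simp only [shuffle_add_right, map_add, mul_add, smul_add, h, h']
  · intro a b c d x y
    have h : ∀ E : Module.Dual k A ⊗[k] Module.Dual k A,
        contractLeft (prodFunctional Q r l) (actDD Q ((a ⊗ₜ b) ⊗ₜ (c ⊗ₜ d))
          (shuffle Q E (x ⊗ₜ y))) = (Coalgebra.counit (R := k) a * l (b * x)) •
        bowtie Q (dualAct k A c (contractRight (Module.Dual.eval k A r) E)) (d * y) := by
      intro E
      induction E with
      | zero => simp [shuffle_zero_left]
      | add E E' h h' =>
        simp only [shuffle_add_left, map_add, LinearMap.add_apply, smul_add, h, h']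
      | tmul φ ψ =>
        rw [shuffle_tmul, actDD_tmul, contractLeft_tmul, actD_bowtie, actD_bowtie,
          prodFunctional_bowtie, apply_mul_integral hr, contractRight_tmul, map_smul, map_smul,
          LinearMap.smul_apply, smul_smul, Module.Dual.eval_apply]
        ring_nf
    rw [h, contractRight_dualComul, dualAct_integral hr, map_smul, dualAct_counit, ev₂₂_one_tmul,
      smul_mul_assoc, Algebra.TensorProduct.tmul_mul_tmul]
    simp only [map_smul, LinearMap.smul_apply, contractLeft_tmul, smul_smul]
    congr 1
    ring

theorem contractRight_prodFunctional [Module.Finite k A] {r : A}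
    (hr : ∀ a, a * r = Coalgebra.counit (R := k) a • r)
    (l : A →ₗ[k] k) (φ : Module.Dual k A) (F : (A ⊗[k] A) ⊗[k] (A ⊗[k] A)) (G : A ⊗[k] A) :
    contractRight (prodFunctional Q r l) (actDD Q F (shuffle Q (dualComul k A φ) G)) =
      φ r • bowtie Q Coalgebra.counit (contractRight l (ev₂₂ 1 fst₂ 1 snd₂ F * G)) := by
  refine tensor_induction (p := fun F G => contractRight (prodFunctional Q r l)
    (actDD Q F (shuffle Q (dualComul k A φ) G)) = φ r • bowtie Q Coalgebra.counit
      (contractRight l (ev₂₂ 1 fst₂ 1 snd₂ F * G))) ?_ ?_ ?_ ?_ ?_ F G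
  · intro G; simp
  · intro F; simp [shuffle_zero_right]
  · intro F F' G h h'
    simp only [map_add, add_mul, LinearMap.add_apply, smul_add, h, h']
  · intro F G G' h h'
    simp only [shuffle_add_right, map_add, mul_add, smul_add, h, h']
  · intro a b c d x y
    have h : ∀ E : Module.Dual k A ⊗[k] Module.Dual k A,
        contractRight (prodFunctional Q r l) (actDD Q ((a ⊗ₜ b) ⊗ₜ (c ⊗ₜ d))
          (shuffle Q E (x ⊗ₜ y))) = (Coalgebra.counit (R := k) c * l (d * y)) •
        bowtie Q (dualAct k A a (contractLeft (Module.Dual.eval k A r) E)) (b * x) := by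
      intro E
      induction E with
      | zero => simp [shuffle_zero_left]
      | add E E' h h' =>
        simp only [shuffle_add_left, map_add, LinearMap.add_apply, smul_add, h, h']
      | tmul φ ψ =>
        rw [shuffle_tmul, actDD_tmul, contractRight_tmul, actD_bowtie, actD_bowtie,
          prodFunctional_bowtie, apply_mul_integral hr, contractLeft_tmul, map_smul, map_smul,
          LinearMap.smul_apply, smul_smul, Module.Dual.eval_apply]
        ring_nf
    rw [h, contractLeft_dualComul, dualAct_integral hr, map_smul, dualAct_counit, ev₂₂_one_tmul,
      smul_mul_assoc, Algebra.TensorProduct.tmul_mul_tmul]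
    simp only [map_smul, LinearMap.smul_apply, contractRight_tmul, smul_smul]
    congr 1
    ring

/-- Evaluation of one leg of the coproduct of `φ` merges the points `x` and `x'`, since both then
act on the single functional `φ`; the counit sets `g = 1`. Only the values `F(x, 1, x, g')` matter.
-/
theorem contractLeft_counit_shuffle [Module.Finite k A] (z : A) (φ : Module.Dual k A)
    (F : (A ⊗[k] A) ⊗[k] (A ⊗[k] A)) (G : A ⊗[k] A) :
    contractLeft (prodFunctional Q z Coalgebra.counit)
        (actDD Q F (shuffle Q (dualComul k A φ) G)) =
      actD Q (ev₂₂ fst₂ 1 fst₂ snd₂ F)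
        (bowtie Q (dualAct k A z φ) (contractLeft Coalgebra.counit G)) := by
  refine tensor_induction (p := fun F G => contractLeft (prodFunctional Q z Coalgebra.counit)
        (actDD Q F (shuffle Q (dualComul k A φ) G)) =
      actD Q (ev₂₂ fst₂ 1 fst₂ snd₂ F)
        (bowtie Q (dualAct k A z φ) (contractLeft Coalgebra.counit G))) ?_ ?_ ?_ ?_ ?_ F G
  · intro G; simp
  · intro F; simp [shuffle_zero_right]
  · intro F F' G h h'
    simp only [map_add, LinearMap.add_apply, h, h']
  · intro F G G' h h'
    simp only [shuffle_add_right, map_add, h, h']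
  · intro a b c d x y
    have h : ∀ E : Module.Dual k A ⊗[k] Module.Dual k A,
        contractLeft (prodFunctional Q z Coalgebra.counit) (actDD Q ((a ⊗ₜ b) ⊗ₜ (c ⊗ₜ d))
          (shuffle Q E (x ⊗ₜ y))) =
        (Coalgebra.counit (R := k) b * Coalgebra.counit (R := k) x) •
        bowtie Q (dualAct k A c (contractRight (Module.Dual.eval k A (a * z)) E)) (d * y) := by
      intro E
      induction E with
      | zero => simp [shuffle_zero_left]
      | add E E' h h' =>
        simp only [shuffle_add_left, map_add, LinearMap.add_apply, smul_add, h, h']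
      | tmul φ ψ =>
        rw [shuffle_tmul, actDD_tmul, contractLeft_tmul, actD_bowtie, actD_bowtie,
          prodFunctional_bowtie, dualAct_apply, contractRight_tmul, map_smul, map_smul,
          LinearMap.smul_apply, smul_smul, Module.Dual.eval_apply, Bialgebra.counit_mul]
        ring_nf
    have h1 : dualAct k A c (dualAct k A (a * z) φ) = dualAct k A (a * c) (dualAct k A z φ) := by
      ext t
      simp only [dualAct_apply]
      ring_nf
    rw [h, contractRight_dualComul, ev₂₂_fst_tmul, h1]
    simp only [map_smul, LinearMap.smul_apply, contractLeft_tmul, smul_smul, actD_bowtie]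
    rw [mul_comm (Coalgebra.counit (R := k) x)]

end Contract

end DoubleComul

/-! ### Values of the comultiplication and of the antipode of the double. -/

section DoubleCoalgebra

open Point QuantumDouble

variable {k A : Type*} [Field k] [CommRing A] [HopfAlgebra k A]
variable {R : Type*} [CommRing R] [Algebra k R]

theorem Point.ev₂₂_map_ad (x g x' g' : Point k A R) (F : A ⊗[k] A) :
    ev₂₂ x g x' g' (Algebra.TensorProduct.map (ad k) (ad k) F) =
      ev₂ (x * g * x⁻¹) (x' * g' * x'⁻¹) F := by
  induction F with
  | zero => simp
  | add a b ha hb => simp only [map_add, ha, hb]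
  | tmul a b => simp [ev₂_ad]

/-- The function `(x, g, x', g') ↦ F(g, g')`. -/
def inclRight₂ (k A : Type*) [Field k] [CommRing A] [HopfAlgebra k A] :
    A ⊗[k] A →ₐ[k] (A ⊗[k] A) ⊗[k] (A ⊗[k] A) :=
  Algebra.TensorProduct.map Algebra.TensorProduct.includeRight Algebra.TensorProduct.includeRight

theorem inclRight₂_tmul (a b : A) : inclRight₂ k A (a ⊗ₜ b) = (1 ⊗ₜ a) ⊗ₜ (1 ⊗ₜ b) := rfl

theorem Point.ev₂₂_inclRight₂ (x g x' g' : Point k A R) (F : A ⊗[k] A) :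
    ev₂₂ x g x' g' (inclRight₂ k A F) = ev₂ g g' F := by
  induction F with
  | zero => simp
  | add a b ha hb => simp only [map_add, ha, hb]
  | tmul a b => simp [inclRight₂_tmul]

theorem ev₂₂_collapseComul_tmul (x g x' g' : Point k A R) (s a b c d e f : A) :
    ev₂₂ x g x' g' (collapseComul k A (s ⊗ₜ (((a ⊗ₜ b) ⊗ₜ c) ⊗ₜ ((d ⊗ₜ e) ⊗ₜ f)))) =
      (x * g * x⁻¹) s * (x a * x b * g c) * (x' d * x' e * g' f) := by
  rw [collapseComul_tmul, ev₂₂_tmul, map_mul, ev₂_ad]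
  simp

theorem act_eq (Q : QuasiHopfData k A) (u : Triple k A) :
    QuantumDouble.act Q u = actD Q (collapse k A u) := biactMul_eq u

/-- The map `s ⊗ u ↦ ad(s) u`, where the first two factors of `u` are multiplied. -/
def collapseAntipode (k A : Type*) [Field k] [CommRing A] [HopfAlgebra k A] :
    A ⊗[k] Triple k A →ₐ[k] A ⊗[k] A :=
  Algebra.TensorProduct.lift (ad k) (collapse k A) fun _ _ => .all _ _

theorem collapseAntipode_tmul (s : A) (u : Triple k A) :
    collapseAntipode k A (s ⊗ₜ u) = ad k s * collapse k A u := by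
  simp [collapseAntipode]

/-- The map `φ ⋈ h ↦ T(h) (φ ⋈ 1)`. -/
def actOne (Q : QuasiHopfData k A) (T : A →ₗ[k] A ⊗[k] A) : Module.End k (QuantumDouble Q) :=
  TensorProduct.lift
    ((LinearMap.applyₗ (R := k) (M := QuantumDouble Q) (M₂ := QuantumDouble Q)).compl₁₂
      ((bowtie Q).flip 1) ((actD Q).toLinearMap ∘ₗ T))

theorem actOne_bowtie (Q : QuasiHopfData k A) (T : A →ₗ[k] A ⊗[k] A) (φ : Module.Dual k A)
    (h : A) : actOne Q T (bowtie Q φ h) = actD Q (T h) (bowtie Q φ 1) := rfl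

theorem actOne_ad_actD (Q : QuasiHopfData k A) (F : A ⊗[k] A) (φ : Module.Dual k A) :
    actOne Q (ad k).toLinearMap (actD Q F (bowtie Q φ 1)) =
      actD Q (conj₂ k A F) (bowtie Q φ 1) := by
  induction F with
  | zero => simp
  | add a b ha hb => simp only [map_add, LinearMap.add_apply, ha, hb]
  | tmul a b =>
    rw [actD_bowtie, mul_one, actOne_bowtie, conj₂_tmul, mul_comm, map_mul, Module.End.mul_apply,
      actD_bowtie, mul_one]
    rfl

theorem actOne_coad_actD (Q : QuasiHopfData k A) (F : A ⊗[k] A) (φ : Module.Dual k A) :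
    actOne Q (coad k).toLinearMap (actD Q F (bowtie Q φ 1)) =
      actD Q (conjInv₂ k A F) (bowtie Q φ 1) := by
  induction F with
  | zero => simp
  | add a b ha hb => simp only [map_add, LinearMap.add_apply, ha, hb]
  | tmul a b =>
    rw [actD_bowtie, mul_one, actOne_bowtie, conjInv₂_tmul, mul_comm, map_mul,
      Module.End.mul_apply, actD_bowtie, mul_one]
    rfl

/-- The substitutions `g ↦ xgx⁻¹` and `g ↦ x⁻¹gx` are inverse to each other. -/
theorem isUnit_actOne_ad (Q : QuasiHopfData k A) : IsUnit (actOne Q (ad k).toLinearMap) := by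
  refine isUnit_iff_exists.mpr ⟨actOne Q (coad k).toLinearMap, ?_, ?_⟩
  · refine LinearMap.ext fun d => ?_
    induction d using QuantumDouble.induction_on with
    | add x y hx hy => rw [map_add, map_add, hx, hy]
    | bowtie φ h =>
      have h1 : conj₂ k A (coad k h) = 1 ⊗ₜ h := conj₂_conjInv₂ (1 ⊗ₜ h)
      rw [Module.End.mul_apply, actOne_bowtie, AlgHom.toLinearMap_apply, actOne_ad_actD, h1,
        actD_bowtie, map_one, mul_one]
      rfl
  · refine LinearMap.ext fun d => ?_
    induction d using QuantumDouble.induction_on with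
    | add x y hx hy => rw [map_add, map_add, hx, hy]
    | bowtie φ h =>
      have h1 : conjInv₂ k A (ad k h) = 1 ⊗ₜ h := conjInv₂_conj₂ (1 ⊗ₜ h)
      rw [Module.End.mul_apply, actOne_bowtie, AlgHom.toLinearMap_apply, actOne_coad_actD, h1,
        actD_bowtie, map_one, mul_one]
      rfl

/-- The map `φ ⋈ h ↦ φ ∘ S ⋈ S(h)`. -/
def antipodeTensor (Q : QuasiHopfData k A) : Module.End k (QuantumDouble Q) :=
  TensorProduct.map (Module.Dual.transpose (R := k) (HopfAlgebra.antipode k (A := A)))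
    (HopfAlgebra.antipode k)

theorem antipodeTensor_bowtie (Q : QuasiHopfData k A) (φ : Module.Dual k A) (h : A) :
    antipodeTensor Q (bowtie Q φ h) =
      bowtie Q (φ ∘ₗ HopfAlgebra.antipode k) (HopfAlgebra.antipode k h) := rfl

theorem isUnit_antipodeTensor (Q : QuasiHopfData k A) : IsUnit (antipodeTensor Q) := by
  have h : antipodeTensor Q * antipodeTensor Q = 1 := by
    refine LinearMap.ext fun d => ?_
    induction d using QuantumDouble.induction_on with
    | add x y hx hy => rw [map_add, map_add, hx, hy]
    | bowtie φ h =>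
      rw [Module.End.mul_apply, antipodeTensor_bowtie, antipodeTensor_bowtie, antipode_antipode,
        Module.End.one_apply]
      congr 2
      ext a
      simp [antipode_antipode]
  exact isUnit_iff_exists.mpr ⟨_, h, h⟩

theorem actD_counit_bowtie (Q : QuasiHopfData k A) (F : A ⊗[k] A) (h : A) :
    actD Q F (bowtie Q Coalgebra.counit h) =
      bowtie Q Coalgebra.counit (contractLeft Coalgebra.counit F * h) :=
  act₂_counit_tmul F h

theorem prodFunctional_actD {Q : QuasiHopfData k A} {r : A}
    (hr : ∀ a, a * r = Coalgebra.counit (R := k) a • r)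
    (l : A →ₗ[k] k) (F : A ⊗[k] A) (φ : Module.Dual k A) :
    prodFunctional Q r l (actD Q F (bowtie Q φ 1)) =
      φ r * l (contractLeft Coalgebra.counit F) := by
  induction F with
  | zero => simp
  | add a b ha hb => simp only [map_add, LinearMap.add_apply, mul_add, ha, hb]
  | tmul a b =>
    rw [actD_bowtie, prodFunctional_bowtie, apply_mul_integral hr, contractLeft_tmul, map_smul,
      mul_one, smul_eq_mul]
    ring

namespace IsTwist

variable {Q : QuasiHopfData k A} (hQ : IsTwist Q)

include hQ

theorem comulAct_eq (E : A ⊗[k] (Triple k A ⊗[k] Triple k A)) :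
    comulAct Q E = actDD Q (collapseComul k A E) := by
  induction E with
  | zero => simp
  | add a b ha hb => simp only [map_add, ha, hb]
  | tmul s F =>
    induction F with
    | zero => simp
    | add a b ha hb => simp only [TensorProduct.tmul_add, map_add, ha, hb]
    | tmul u v =>
      refine TensorProduct.ext' fun x y => ?_
      rw [comulAct_tmul, hQ.incl_mul, collapseComul_tmul, actDD_tmul, map_mul,
        Module.End.mul_apply, act_eq, act_eq]

/-- The tensor by which the comultiplication of the quantum double is given. -/
def _root_.QuasiHopf.comulTensor (Q : QuasiHopfData k A) : (A ⊗[k] A) ⊗[k] (A ⊗[k] A) :=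
  collapseComul k A (comulElt Q)

theorem double_comul_bowtie [Module.Finite k A] (φ : Module.Dual k A) (h : A) :
    QuantumDouble.comul Q (bowtie Q φ h) =
      actDD Q (comulTensor Q) (shuffle Q (dualComul k A φ) (Coalgebra.comul h)) := by
  rw [comulTensor, ← hQ.comulAct_eq, ← hQ.comul_eq]
  rfl

theorem map_comulEltIn {B : Type*} [Ring B] [Algebra k B] (e : B →ₐ[k] R)
    {i₀ i₁ i₂ i₃ i₄ i₅ i₆ : A →ₗ[k] B} {s x g x' g' : Point k A R}
    (h0 : ∀ a, e (i₀ a) = s a) (h1 : ∀ a, e (i₁ a) = x a) (h2 : ∀ a, e (i₂ a) = x a)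
    (h3 : ∀ a, e (i₃ a) = g a) (h4 : ∀ a, e (i₄ a) = x' a) (h5 : ∀ a, e (i₅ a) = x' a)
    (h6 : ∀ a, e (i₆ a) = g' a) : e (comulEltIn Q i₀ i₁ i₂ i₃ i₄ i₅ i₆) =
      v Q s (x' * g') x'⁻¹ * v Q s x g' * ev₂ (x * g) x⁻¹ Q.pR * w Q x g g' := by
  have h46 : ∀ a, e ((mulMap₂ i₄ i₆ ∘ₗ Q.comul) a) = (x' * g') a := fun a => by
    rw [hQ.comul_eq, LinearMap.comp_apply, map_mulMap₂ e h4 h6, ev₂_comul]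
  have h13 : ∀ a, e ((mulMap₂ i₁ i₃ ∘ₗ Q.comul) a) = (x * g) a := fun a => by
    rw [hQ.comul_eq, LinearMap.comp_apply, map_mulMap₂ e h1 h3, ev₂_comul]
  have h5' : ∀ a, e ((i₅ ∘ₗ Q.antipodeInv) a) = x'⁻¹ a := fun a => by
    rw [hQ.antipodeInv_eq, LinearMap.comp_apply, h5, apply_antipode]
  have h2' : ∀ a, e ((i₂ ∘ₗ Q.antipodeInv) a) = x⁻¹ a := fun a => by
    rw [hQ.antipodeInv_eq, LinearMap.comp_apply, h2, apply_antipode]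
  rw [comulEltIn, map_mul, map_mul, map_mul, map_mulMap₃ e h0 h46 h5', map_mulMap₃ e h0 h2 h6,
    map_mulMap₂ e h13 h2', map_mulMap₃ e h1 h3 h6]

/-- The leg `X¹Y¹` sits in a left factor `ε ⋈ X¹Y¹` and is therefore evaluated at `xgx⁻¹`. -/
theorem ev₂₂_comulTensor (x g x' g' : Point k A R) : ev₂₂ x g x' g' (comulTensor Q) =
    v Q (x * g * x⁻¹) (x' * g') x'⁻¹ * v Q (x * g * x⁻¹) x g' * ev₂ (x * g) x⁻¹ Q.pR *
      w Q x g g' := by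
  have he := ev₂₂_collapseComul_tmul x g x' g'
  let e : A ⊗[k] (Triple k A ⊗[k] Triple k A) →ₐ[k] R :=
    (ev₂₂ x g x' g').comp (collapseComul k A)
  refine hQ.map_comulEltIn e
    (fun a => ?_) (fun a => ?_) (fun a => ?_) (fun a => ?_) (fun a => ?_) (fun a => ?_)
    (fun a => ?_)
  · exact (he a 1 1 1 1 1 1).trans (by simp)
  · exact (he 1 a 1 1 1 1 1).trans (by simp)
  · exact (he 1 1 a 1 1 1 1).trans (by simp)
  · exact (he 1 1 1 a 1 1 1).trans (by simp)
  · exact (he 1 1 1 1 a 1 1).trans (by simp)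
  · exact (he 1 1 1 1 1 a 1).trans (by simp)
  · exact (he 1 1 1 1 1 1 a).trans (by simp)

theorem ev₂₂_comulTensor_one (g g' : Point k A R) : ev₂₂ 1 g 1 g' (comulTensor Q) = 1 := by
  rw [hQ.ev₂₂_comulTensor, hQ.ev₂_pR]
  simp [hQ.v_one_right, hQ.v_one_middle, hQ.w_one_left, hQ.w_one_right, one_apply, hQ.counit_β]

/-- At `g = 1` and `x' = x` normalization leaves only `p_R(x, x⁻¹) = ω(x, x⁻¹, x) β(x⁻¹) = β(x)
β(x⁻¹) = 1`. -/
theorem ev₂₂_comulTensor_one_right (x g' : Point k A R) :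
    ev₂₂ x 1 x g' (comulTensor Q) = 1 := by
  rw [hQ.ev₂₂_comulTensor, hQ.ev₂_pR]
  simp only [mul_one, mul_inv_cancel, hQ.v_one_left, hQ.w_one_middle, one_mul, inv_inv]
  rw [← hQ.β_apply, hQ.β_mul_β_inv]

theorem map_incl_mul (V : A ⊗[k] A) (Z : QuantumDouble Q ⊗[k] QuantumDouble Q) :
    TensorProduct.map (incl Q) (incl Q) V * Z =
      actDD Q (Algebra.TensorProduct.map (ad k) (ad k) V) Z := by
  induction V with
  | zero => simp
  | add a b ha hb => simp only [map_add, add_mul, LinearMap.add_apply, ha, hb]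
  | tmul a b =>
    induction Z with
    | zero => simp
    | add x y hx hy => rw [mul_add, hx, hy, map_add]
    | tmul x y =>
      rw [TensorProduct.map_tmul, Algebra.TensorProduct.tmul_mul_tmul, hQ.incl_mul, hQ.incl_mul,
        Algebra.TensorProduct.map_tmul, actDD_tmul]

theorem mul_map_incl (Z : QuantumDouble Q ⊗[k] QuantumDouble Q) (V : A ⊗[k] A) :
    Z * TensorProduct.map (incl Q) (incl Q) V = actDD Q (inclRight₂ k A V) Z := by
  induction V with
  | zero => simp
  | add a b ha hb => simp only [map_add, mul_add, LinearMap.add_apply, ha, hb]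
  | tmul a b =>
    induction Z with
    | zero => simp
    | add x y hx hy => rw [add_mul, hx, hy, map_add]
    | tmul x y =>
      rw [TensorProduct.map_tmul, Algebra.TensorProduct.tmul_mul_tmul, hQ.mul_incl, hQ.mul_incl,
        inclRight₂_tmul, actDD_tmul]

theorem map_incl_mul_comul_mul [Module.Finite k A] (V W : A ⊗[k] A) (φ : Module.Dual k A) (h : A) :
    TensorProduct.map (incl Q) (incl Q) V * QuantumDouble.comul Q (bowtie Q φ h) *
        TensorProduct.map (incl Q) (incl Q) W =
      actDD Q (inclRight₂ k A W * (Algebra.TensorProduct.map (ad k) (ad k) V * comulTensor Q))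
        (shuffle Q (dualComul k A φ) (Coalgebra.comul h)) := by
  rw [hQ.double_comul_bowtie, hQ.map_incl_mul, hQ.mul_map_incl, map_mul, map_mul]
  rfl

/-! The antipode -/

/-- The tensor by which the antipode of the quantum double is given. -/
def _root_.QuasiHopf.antipodeTwist (Q : QuasiHopfData k A) : A ⊗[k] A :=
  collapseAntipode k A (antipodeElt Q)

theorem antipodeAct_eq (h : A) (E : A ⊗[k] Triple k A) (d : QuantumDouble Q) :
    antipodeAct Q (h ⊗ₜ E) d =
      actD Q (collapseAntipode k A E) (actD Q (ad k (HopfAlgebra.antipode k h)) d) := by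
  induction E with
  | zero => simp
  | add a b ha hb => simp only [TensorProduct.tmul_add, map_add, LinearMap.add_apply, ha, hb]
  | tmul s u =>
    rw [antipodeAct_tmul, hQ.incl_mul, act_eq, collapseAntipode_tmul, hQ.antipode_eq,
      map_mul (ad k), ← Module.End.mul_apply, ← Module.End.mul_apply, ← map_mul (actD Q),
      ← map_mul (actD Q)]
    congr 2
    ring

/-- A factorization into invertible maps: the antipodes on both tensor factors, the substitution `g
↦ xgx⁻¹`, and multiplication by a function with unit values. -/
theorem double_antipode_eq : QuantumDouble.antipode Q =
    actD Q (antipodeTwist Q) * actOne Q (ad k).toLinearMap * antipodeTensor Q := by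
  refine LinearMap.ext fun d => ?_
  induction d using QuantumDouble.induction_on with
  | add x y hx hy => rw [map_add, map_add, hx, hy]
  | bowtie φ h =>
    rw [antipode_bowtie, hQ.antipodeAct_eq, Module.End.mul_apply, Module.End.mul_apply,
      antipodeTensor_bowtie, actOne_bowtie, hQ.antipodeInv_eq]
    rfl

theorem ev₂_antipodeTwist (x g : Point k A R) : ev₂ x g (antipodeTwist Q) =
    ev₂ (x * g * x⁻¹) x Q.f * ev₂ (x * g) x⁻¹ Q.pR * ev₂ x g Q.U := by
  let e : A ⊗[k] Triple k A →ₐ[k] R := (ev₂ x g).comp (collapseAntipode k A)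
  have he : ∀ s a b c : A, e (s ⊗ₜ ((a ⊗ₜ b) ⊗ₜ c)) = (x * g * x⁻¹) s * (x a * x b * g c) := by
    intro s a b c
    change ev₂ x g (collapseAntipode k A _) = _
    rw [collapseAntipode_tmul, map_mul, ev₂_ad]
    simp
  change e (antipodeElt Q) = _
  unfold antipodeElt
  extract_lets i₀ i₁ i₂ i₃
  have h0 : ∀ a, e (i₀ a) = (x * g * x⁻¹) a := fun a => (he a 1 1 1).trans (by simp)
  have h1 : ∀ a, e (i₁ a) = x a := fun a => (he 1 a 1 1).trans (by simp)
  have h2 : ∀ a, e (i₂ a) = x a := fun a => (he 1 1 a 1).trans (by simp)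
  have h3 : ∀ a, e (i₃ a) = g a := fun a => (he 1 1 1 a).trans (by simp)
  have h13 : ∀ a, e ((mulMap₂ i₁ i₃ ∘ₗ Q.comul) a) = (x * g) a := fun a => by
    rw [hQ.comul_eq, LinearMap.comp_apply, map_mulMap₂ e h1 h3, ev₂_comul]
  have h2' : ∀ a, e ((i₂ ∘ₗ Q.antipodeInv) a) = x⁻¹ a := fun a => by
    rw [hQ.antipodeInv_eq, LinearMap.comp_apply, h2, apply_antipode]
  rw [map_mul, map_mul, map_mulMap₂ e h0 h2, map_mulMap₂ e h13 h2', map_mulMap₂ e h1 h3]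

theorem isUnit_v (x y z : Point k A R) : IsUnit (v Q x y z) :=
  .of_mul_eq_one _ (hQ.v_mul_w x y z)

theorem isUnit_w (x y z : Point k A R) : IsUnit (w Q x y z) :=
  .of_mul_eq_one _ (hQ.w_mul_v x y z)

theorem isUnit_β (x : Point k A R) : IsUnit (x Q.β) :=
  .of_mul_eq_one _ (hQ.β_mul_β_inv x)

theorem isUnit_antipodeTwist : IsUnit (antipodeTwist Q) := by
  rw [← ev₂_universal (antipodeTwist Q), hQ.ev₂_antipodeTwist, hQ.ev₂_f, hQ.ev₂_pR, hQ.ev₂_U,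
    hQ.ev₂_fInv, hQ.ev₂_δ]
  exact (((hQ.isUnit_v _ _ _).mul (hQ.isUnit_w _ _ _)).mul
    ((hQ.isUnit_w _ _ _).mul (hQ.isUnit_β _))).mul
    (((hQ.isUnit_β _).mul (((hQ.isUnit_v _ _ _).mul (hQ.isUnit_w _ _ _)).mul
      ((hQ.isUnit_β _).mul (hQ.isUnit_β _)))).mul (hQ.isUnit_v _ _ _))

theorem U_one_left (g : Point k A R) : ev₂ 1 g Q.U = 1 := by
  rw [hQ.ev₂_U, hQ.ev₂_fInv, hQ.ev₂_δ]
  simp [hQ.v_one_right, hQ.w_one_left, one_apply, hQ.counit_β, hQ.β_inv_mul_β]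

theorem contractLeft_antipodeTwist : contractLeft Coalgebra.counit (antipodeTwist Q) = 1 := by
  refine eq_of_apply (k := k) fun x => ?_
  rw [← ev₂_one_left, hQ.ev₂_antipodeTwist, hQ.U_one_left, hQ.ev₂_pR, inv_one, mul_one,
    hQ.ev₂_f_one_right]
  simp [hQ.w_one_right, one_apply, hQ.counit_β]

omit hQ in
theorem contractLeft_counit_mul (F G : A ⊗[k] A) : contractLeft Coalgebra.counit (F * G) =
    contractLeft Coalgebra.counit F * contractLeft Coalgebra.counit G :=
  eq_of_apply (k := k) fun x => by
    rw [map_mul x, ← ev₂_one_left, map_mul (ev₂ 1 x), ev₂_one_left, ev₂_one_left]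

theorem double_antipode_bowtie (φ : Module.Dual k A) (h : A) :
    QuantumDouble.antipode Q (bowtie Q φ h) =
      actD Q (antipodeTwist Q * ad k (HopfAlgebra.antipode k h))
        (bowtie Q (φ ∘ₗ HopfAlgebra.antipode k) 1) := by
  rw [antipode_bowtie, hQ.antipodeAct_eq, hQ.antipodeInv_eq, map_mul]
  rfl

/-- Bijectivity is indispensable: `antipodeInv` is defined by `Ring.inverse` and would be 0
otherwise. -/
theorem isUnit_double_antipode :
    IsUnit (QuantumDouble.antipode Q : Module.End k (QuantumDouble Q)) := by
  rw [hQ.double_antipode_eq]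
  exact ((hQ.isUnit_antipodeTwist.map (actD Q)).mul (isUnit_actOne_ad Q)).mul
    (isUnit_antipodeTensor Q)

theorem double_antipode_incl (a : A) :
    QuantumDouble.antipode Q (incl Q a) = incl Q (HopfAlgebra.antipode k a) := by
  have h1 : (Coalgebra.counit : Module.Dual k A) ∘ₗ HopfAlgebra.antipode k = Coalgebra.counit := by
    ext a
    simp
  refine (hQ.double_antipode_bowtie _ a).trans ?_
  rw [hQ.counit_eq, h1, actD_counit_bowtie, contractLeft_counit_mul, hQ.contractLeft_antipodeTwist,
    contractLeft_counit_ad, one_mul, mul_one, incl, hQ.counit_eq]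

/-- Pairing with `r` sets `x = 1`, where the twist of the antipode is 1 and conjugation is trivial;
and `S(r) = r`. -/
theorem prodFunctional_antipode {m : A →ₗ[k] k} {r : A} (hI : IsIntegralPair m r)
    (l : A →ₗ[k] k) :
    prodFunctional Q r l ∘ₗ QuantumDouble.antipode Q =
      prodFunctional Q r (l ∘ₗ HopfAlgebra.antipode k) := by
  refine LinearMap.ext fun d => ?_
  induction d using QuantumDouble.induction_on with
  | add x y hx hy => rw [map_add, map_add, hx, hy]
  | bowtie φ h =>
    rw [LinearMap.comp_apply, hQ.double_antipode_bowtie, prodFunctional_actD hI.mul_eq,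
      contractLeft_counit_mul, hQ.contractLeft_antipodeTwist, contractLeft_counit_ad, one_mul,
      LinearMap.comp_apply, hI.antipode_integral, prodFunctional_bowtie]
    rfl

end IsTwist

end DoubleCoalgebra

/-! ### Maps of quasi-Hopf data -/

section Morphisms

set_option linter.unusedSectionVars false

variable {k A B : Type*} [Field k] [NonUnitalNonAssocRing A] [One A] [Module k A]
  [SMulCommClass k A A] [IsScalarTower k A A]
  [NonUnitalNonAssocRing B] [One B] [Module k B] [SMulCommClass k B B] [IsScalarTower k B B]

/-- A linear map compatible with all operations of a quasi-Hopf algebra. -/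
structure IsQuasiHopfHom (Q : QuasiHopfData k A) (Q' : QuasiHopfData k B) (i : A →ₗ[k] B) :
    Prop where
  map_mul : ∀ a b, i (a * b) = i a * i b
  map_one : i 1 = 1
  comul_map : ∀ a, Q'.comul (i a) = TensorProduct.map i i (Q.comul a)
  antipode_map : ∀ a, Q'.antipode (i a) = i (Q.antipode a)
  antipodeInv_map : ∀ a, Q'.antipodeInv (i a) = i (Q.antipodeInv a)
  Φ_eq : Q'.Φ = TensorProduct.map i (TensorProduct.map i i) Q.Φ
  Φinv_eq : Q'.Φinv = TensorProduct.map i (TensorProduct.map i i) Q.Φinv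
  α_eq : Q'.α = i Q.α
  β_eq : Q'.β = i Q.β

/-- Associativity is not assumed: the product of the double is used throughout without establishing
it. -/
theorem map_tensor_mul {A' B' : Type*} [NonUnitalNonAssocRing A'] [Module k A']
    [SMulCommClass k A' A'] [IsScalarTower k A' A']
    [NonUnitalNonAssocRing B'] [Module k B'] [SMulCommClass k B' B'] [IsScalarTower k B' B']
    {i : A →ₗ[k] B} {j : A' →ₗ[k] B'} (hi : ∀ a b, i (a * b) = i a * i b)
    (hj : ∀ a b, j (a * b) = j a * j b) (F G : A ⊗[k] A') :
    TensorProduct.map i j (F * G) = TensorProduct.map i j F * TensorProduct.map i j G := by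
  induction F with
  | zero => simp
  | add a b ha hb => simp only [map_add, add_mul, ha, hb]
  | tmul a b =>
    induction G with
    | zero => simp
    | add a b ha hb => simp only [map_add, mul_add, ha, hb]
    | tmul c d => simp [Algebra.TensorProduct.tmul_mul_tmul, hi, hj]

namespace IsQuasiHopfHom

open QuasiHopfData

variable {Q : QuasiHopfData k A} {Q' : QuasiHopfData k B} {i : A →ₗ[k] B}
  (h : IsQuasiHopfHom Q Q' i)

include h

theorem map₂_mul (F G : A ⊗[k] A) :
    TensorProduct.map i i (F * G) = TensorProduct.map i i F * TensorProduct.map i i G :=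
  map_tensor_mul h.map_mul h.map_mul F G

theorem evα_map (F : A ⊗[k] A) : Q'.evα (TensorProduct.map i i F) = i (Q.evα F) := by
  induction F with
  | zero => simp
  | add a b ha hb => simp only [map_add, ha, hb]
  | tmul a b => simp [h.map_mul, h.antipode_map, h.α_eq]

theorem evβ_map (F : A ⊗[k] A) : Q'.evβ (TensorProduct.map i i F) = i (Q.evβ F) := by
  induction F with
  | zero => simp
  | add a b ha hb => simp only [map_add, ha, hb]
  | tmul a b => simp [h.map_mul, h.antipode_map, h.β_eq]

/-- `p_R`, and likewise `q_R`, `γ`, `δ`, `f`, `f⁻¹`, `U` and `V`, are universal expressions in the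
operations, so their values in the double are images of those in `A`. -/
theorem pR_eq : Q'.pR = TensorProduct.map i i Q.pR := by
  have h1 : ∀ F : A ⊗[k] (A ⊗[k] A),
      LinearMap.lTensor B Q'.evβ (TensorProduct.map i (TensorProduct.map i i) F) =
        TensorProduct.map i i (LinearMap.lTensor A Q.evβ F) := by
    intro F
    induction F with
    | zero => simp
    | add a b ha hb => simp only [map_add, ha, hb]
    | tmul a b => simp [h.evβ_map]
  rw [pR, pR, h.Φinv_eq, h1]

theorem qR_eq : Q'.qR = TensorProduct.map i i Q.qR := by
  have h2 : ∀ F : A ⊗[k] A,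
      (mulMap₂ (Q'.antipodeInv ∘ₗ LinearMap.mulLeft k Q'.α) LinearMap.id ∘ₗ
      (TensorProduct.comm k B B).toLinearMap) (TensorProduct.map i i F) =
      i ((mulMap₂ (Q.antipodeInv ∘ₗ LinearMap.mulLeft k Q.α) LinearMap.id ∘ₗ
      (TensorProduct.comm k A A).toLinearMap) F) := by
    intro F
    induction F with
    | zero => simp
    | add a b ha hb => simp only [map_add, ha, hb]
    | tmul a b => simp [h.map_mul, ← h.antipodeInv_map, h.α_eq]
  have h1 : ∀ F : A ⊗[k] (A ⊗[k] A),
      LinearMap.lTensor B (mulMap₂ (Q'.antipodeInv ∘ₗ LinearMap.mulLeft k Q'.α) LinearMap.id ∘ₗ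
      (TensorProduct.comm k B B).toLinearMap) (TensorProduct.map i (TensorProduct.map i i) F) =
        TensorProduct.map i i (LinearMap.lTensor A (mulMap₂ (Q.antipodeInv ∘ₗ
          LinearMap.mulLeft k Q.α) LinearMap.id ∘ₗ (TensorProduct.comm k A A).toLinearMap) F) := by
    intro F
    induction F with
    | zero => simp
    | add a b ha hb => simp only [map_add, ha, hb]
    | tmul a b =>
      rw [TensorProduct.map_tmul, LinearMap.lTensor_tmul, LinearMap.lTensor_tmul, h2,
        TensorProduct.map_tmul]
  rw [qR, qR, h.Φ_eq, h1]

theorem appendOne_map (F : A ⊗[k] (A ⊗[k] A)) :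
    appendOne (TensorProduct.map i (TensorProduct.map i i) F) =
      TensorProduct.map i (TensorProduct.map i (TensorProduct.map i i)) (appendOne F) := by
  have h2 : ∀ F : A ⊗[k] A,
      LinearMap.lTensor B ((TensorProduct.mk k B B).flip 1) (TensorProduct.map i i F) =
      TensorProduct.map i (TensorProduct.map i i)
        (LinearMap.lTensor A ((TensorProduct.mk k A A).flip 1) F) := by
    intro F
    induction F with
    | zero => simp
    | add a b ha hb => simp only [map_add, ha, hb]
    | tmul a b => simp [h.map_one]
  induction F with
  | zero => simp
  | add a b ha hb => simp only [map_add, ha, hb]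
  | tmul a b => simp only [appendOne, TensorProduct.map_tmul, LinearMap.lTensor_tmul, h2]

omit h in
theorem assoc_map (F G : A ⊗[k] A) :
    TensorProduct.assoc k B B (B ⊗[k] B) (TensorProduct.map i i F ⊗ₜ TensorProduct.map i i G) =
      TensorProduct.map i (TensorProduct.map i (TensorProduct.map i i))
        (TensorProduct.assoc k A A (A ⊗[k] A) (F ⊗ₜ G)) := by
  induction F with
  | zero => simp
  | add a b ha hb => simp only [TensorProduct.add_tmul, map_add, ha, hb]
  | tmul a b => simp

theorem comulFirst_map (F : A ⊗[k] (A ⊗[k] A)) :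
    Q'.comulFirst (TensorProduct.map i (TensorProduct.map i i) F) =
      TensorProduct.map i (TensorProduct.map i (TensorProduct.map i i)) (Q.comulFirst F) := by
  induction F with
  | zero => simp
  | add a b ha hb => simp only [map_add, ha, hb]
  | tmul a b =>
    rw [TensorProduct.map_tmul, comulFirst, comulFirst, LinearMap.comp_apply, LinearMap.comp_apply,
      LinearMap.rTensor_tmul, LinearMap.rTensor_tmul, h.comul_map]
    exact assoc_map _ _

theorem γMap_map (F : A ⊗[k] (A ⊗[k] (A ⊗[k] A))) :
    Q'.γMap (TensorProduct.map i (TensorProduct.map i (TensorProduct.map i i)) F) =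
      TensorProduct.map i i (Q.γMap F) := by
  suffices H : Q'.γMap ∘ₗ TensorProduct.map i (TensorProduct.map i (TensorProduct.map i i)) =
      TensorProduct.map i i ∘ₗ Q.γMap from LinearMap.congr_fun H F
  refine TensorProduct.ext' fun a F => ?_
  induction F with
  | zero => simp
  | add a b ha hb => simp only [TensorProduct.tmul_add, map_add, ha, hb]
  | tmul b F =>
    induction F with
    | zero => simp
    | add a b ha hb => simp only [TensorProduct.tmul_add, map_add, ha, hb]
    | tmul c d => simp [γMap_tmul, h.map_mul, h.antipode_map, h.α_eq]

theorem δMap_map (F : A ⊗[k] (A ⊗[k] (A ⊗[k] A))) :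
    Q'.δMap (TensorProduct.map i (TensorProduct.map i (TensorProduct.map i i)) F) =
      TensorProduct.map i i (Q.δMap F) := by
  suffices H : Q'.δMap ∘ₗ TensorProduct.map i (TensorProduct.map i (TensorProduct.map i i)) =
      TensorProduct.map i i ∘ₗ Q.δMap from LinearMap.congr_fun H F
  refine TensorProduct.ext' fun a F => ?_
  induction F with
  | zero => simp
  | add a b ha hb => simp only [TensorProduct.tmul_add, map_add, ha, hb]
  | tmul b F =>
    induction F with
    | zero => simp
    | add a b ha hb => simp only [TensorProduct.tmul_add, map_add, ha, hb]
    | tmul c d => simp [δMap_tmul, h.map_mul, h.antipode_map, h.β_eq]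

theorem map₄_mul (F G : A ⊗[k] (A ⊗[k] (A ⊗[k] A))) :
    TensorProduct.map i (TensorProduct.map i (TensorProduct.map i i)) (F * G) =
      TensorProduct.map i (TensorProduct.map i (TensorProduct.map i i)) F *
        TensorProduct.map i (TensorProduct.map i (TensorProduct.map i i)) G :=
  map_tensor_mul h.map_mul (map_tensor_mul h.map_mul h.map₂_mul) F G

theorem γ_eq : Q'.γ = TensorProduct.map i i Q.γ := by
  rw [γ, γ, h.Φ_eq, h.Φinv_eq, h.appendOne_map, h.comulFirst_map, ← h.map₄_mul, h.γMap_map]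

theorem δ_eq : Q'.δ = TensorProduct.map i i Q.δ := by
  rw [δ, δ, h.Φ_eq, h.Φinv_eq, h.appendOne_map, h.comulFirst_map, ← h.map₄_mul, h.δMap_map]

theorem map_antipode_comm (F : A ⊗[k] A) :
    TensorProduct.map Q'.antipode Q'.antipode
        (TensorProduct.comm k B B (TensorProduct.map i i F)) =
      TensorProduct.map i i (TensorProduct.map Q.antipode Q.antipode
        (TensorProduct.comm k A A F)) := by
  induction F with
  | zero => simp
  | add a b ha hb => simp only [map_add, ha, hb]
  | tmul a b => simp [h.antipode_map]

theorem antipodeComulOp_map (a : A) :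
    Q'.antipodeComulOp (i a) = TensorProduct.map i i (Q.antipodeComulOp a) := by
  refine Eq.trans ?_ (h.map_antipode_comm _)
  rw [← h.comul_map]
  rfl

theorem f_eq : Q'.f = TensorProduct.map i i Q.f := by
  have h1 : ∀ F : A ⊗[k] (A ⊗[k] A),
      mulMap₂ (LinearMap.mulRight k Q'.γ ∘ₗ Q'.antipodeComulOp) (Q'.comul ∘ₗ Q'.evβ)
        (TensorProduct.map i (TensorProduct.map i i) F) =
      TensorProduct.map i i (mulMap₂ (LinearMap.mulRight k Q.γ ∘ₗ Q.antipodeComulOp)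
        (Q.comul ∘ₗ Q.evβ) F) := by
    intro F
    induction F with
    | zero => simp
    | add a b ha hb => simp only [map_add, ha, hb]
    | tmul a b => simp [h.map₂_mul, h.antipodeComulOp_map, h.evβ_map, h.comul_map, h.γ_eq]
  rw [f, f, h.Φinv_eq, h1]

theorem fInv_eq : Q'.fInv = TensorProduct.map i i Q.fInv := by
  have h0 : ∀ F : A ⊗[k] (A ⊗[k] A), (TensorProduct.assoc k B B B).symm
      (TensorProduct.map i (TensorProduct.map i i) F) =
      TensorProduct.map (TensorProduct.map i i) i ((TensorProduct.assoc k A A A).symm F) := by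
    intro F
    refine (LinearEquiv.symm_apply_eq _).mpr ?_
    obtain ⟨G, rfl⟩ := (TensorProduct.assoc k A A A).surjective F
    rw [LinearEquiv.symm_apply_apply, TensorProduct.map_map_assoc]
  have h1 : ∀ F : (A ⊗[k] A) ⊗[k] A,
      mulMap₂ (LinearMap.mulRight k Q'.δ ∘ₗ Q'.comul ∘ₗ Q'.evα) Q'.antipodeComulOp
        (TensorProduct.map (TensorProduct.map i i) i F) =
      TensorProduct.map i i (mulMap₂ (LinearMap.mulRight k Q.δ ∘ₗ Q.comul ∘ₗ Q.evα)
        Q.antipodeComulOp F) := by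
    intro F
    induction F with
    | zero => simp
    | add a b ha hb => simp only [map_add, ha, hb]
    | tmul a b => simp [h.map₂_mul, h.antipodeComulOp_map, h.evα_map, h.comul_map, h.δ_eq]
  rw [fInv, fInv, h.Φinv_eq, h0, h1]

theorem U_eq : Q'.U = TensorProduct.map i i Q.U := by
  rw [U, U, h.fInv_eq, h.qR_eq, h.map_antipode_comm, h.map₂_mul]

theorem V_eq : Q'.V = TensorProduct.map i i Q.V := by
  have h1 : ∀ F : A ⊗[k] A, TensorProduct.comm k B B
      (TensorProduct.map Q'.antipodeInv Q'.antipodeInv (TensorProduct.map i i F)) =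
      TensorProduct.map i i (TensorProduct.comm k A A
        (TensorProduct.map Q.antipodeInv Q.antipodeInv F)) := by
    intro F
    induction F with
    | zero => simp
    | add a b ha hb => simp only [map_add, ha, hb]
    | tmul a b => simp [h.antipodeInv_map]
  rw [V, V, h.f_eq, h.pR_eq, ← h.map₂_mul, h1]

end IsQuasiHopfHom

end Morphisms

/-! ### Cointegrals on the quantum double of a commutative twist -/

section DoubleCointegrals

open Point QuantumDouble

variable {k A : Type*} [Field k] [CommRing A] [HopfAlgebra k A]
variable {R : Type*} [CommRing R] [Algebra k R]

theorem dualComul_counit [Module.Finite k A] :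
    dualComul k A Coalgebra.counit =
      (Coalgebra.counit : Module.Dual k A) ⊗ₜ (Coalgebra.counit : Module.Dual k A) := by
  refine (LinearEquiv.symm_apply_eq _).mpr ?_
  refine TensorProduct.ext' fun a b => ?_
  change Coalgebra.counit (R := k) (a * b) = TensorProduct.dualDistrib k A A _ _
  simp

theorem incl_injective {Q : QuasiHopfData k A} {a b : A}
    (h : bowtie Q Coalgebra.counit a = bowtie Q Coalgebra.counit b) : a = b := by
  have h1 := congrArg (contractLeft (M := Module.Dual k A) (Module.Dual.eval k A 1)) h
  change contractLeft _ ((Coalgebra.counit : Module.Dual k A) ⊗ₜ a) =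
    contractLeft _ ((Coalgebra.counit : Module.Dual k A) ⊗ₜ b) at h1
  simpa using h1

namespace IsTwist

variable {Q : QuasiHopfData k A} (hQ : IsTwist Q)

include hQ

theorem actDD_map_incl (F : (A ⊗[k] A) ⊗[k] (A ⊗[k] A)) (G : A ⊗[k] A) :
    actDD Q F (TensorProduct.map (incl Q) (incl Q) G) =
      TensorProduct.map (incl Q) (incl Q) (ev₂₂ 1 fst₂ 1 snd₂ F * G) := by
  refine tensor_induction (p := fun F G => actDD Q F (TensorProduct.map (incl Q) (incl Q) G) =
      TensorProduct.map (incl Q) (incl Q) (ev₂₂ 1 fst₂ 1 snd₂ F * G)) ?_ ?_ ?_ ?_ ?_ F G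
  · intro G; simp
  · intro F; simp
  · intro F F' G h h'
    simp only [map_add, add_mul, LinearMap.add_apply, h, h']
  · intro F G G' h h'
    simp only [map_add, mul_add, h, h']
  · intro a b c d x y
    rw [TensorProduct.map_tmul, actDD_tmul, ev₂₂_one_tmul, incl, hQ.counit_eq, actD_bowtie,
      actD_bowtie, dualAct_counit, dualAct_counit, smul_mul_assoc,
      Algebra.TensorProduct.tmul_mul_tmul, map_smul, map_smul, map_smul, TensorProduct.map_tmul,
      LinearMap.smul_apply, LinearMap.smul_apply, TensorProduct.smul_tmul_smul]

/-- On elements `ε ⋈ a` both points of the dual factor are evaluated at 1, where the tensors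
twisting the coproduct and the antipode equal 1. -/
theorem isQuasiHopfHom_incl [Module.Finite k A] :
    IsQuasiHopfHom Q (quantumDouble Q) (incl Q) where
  map_mul a b := (hQ.bowtie_mul_incl _ a b).symm
  map_one := rfl
  comul_map a := by
    have h1 : ∀ G : A ⊗[k] A, shuffle Q ((Coalgebra.counit : Module.Dual k A) ⊗ₜ
        (Coalgebra.counit : Module.Dual k A)) G = TensorProduct.map (incl Q) (incl Q) G := by
      intro G
      induction G with
      | zero => rw [shuffle_zero_right, map_zero]
      | add a b ha hb => rw [shuffle_add_right, map_add, ha, hb]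
      | tmul a b => rw [shuffle_tmul, TensorProduct.map_tmul, incl, hQ.counit_eq]
    change QuantumDouble.comul Q (bowtie Q Q.counit a) = _
    rw [hQ.double_comul_bowtie, hQ.counit_eq, dualComul_counit, h1, hQ.actDD_map_incl,
      hQ.ev₂₂_comulTensor_one, one_mul, hQ.comul_eq]
  antipode_map a := by
    rw [hQ.antipode_eq]
    exact hQ.double_antipode_incl a
  -- The inverse antipode must be handled separately, through bijectivity of the antipode of the
  -- double.
  antipodeInv_map a := by
    rw [hQ.antipodeInv_eq]
    have h1 := hQ.double_antipode_incl (HopfAlgebra.antipode k a)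
    rw [antipode_antipode] at h1
    rw [← h1]
    exact LinearMap.congr_fun (Ring.inverse_mul_cancel _ hQ.isUnit_double_antipode) _
  Φ_eq := rfl
  Φinv_eq := rfl
  α_eq := rfl
  β_eq := rfl

theorem V_one_left (g : Point k A R) : ev₂ 1 g Q.V = 1 := by
  rw [hQ.ev₂_V, hQ.ev₂_pR, inv_one, hQ.ev₂_f_one_right]
  simp [hQ.w_one_right, one_apply, hQ.counit_β]

/-- The tensor that acts on `D ⊗ D` as `x ↦ V Δ(x) W`. -/
def _root_.QuasiHopf.sandwich (Q : QuasiHopfData k A) (V W : A ⊗[k] A) :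
    (A ⊗[k] A) ⊗[k] (A ⊗[k] A) :=
  inclRight₂ k A W * (Algebra.TensorProduct.map (ad k) (ad k) V * comulTensor Q)

theorem ev₂₂_sandwich_one (V W : A ⊗[k] A) :
    ev₂₂ 1 fst₂ 1 snd₂ (sandwich Q V W) = V * W := by
  rw [sandwich, map_mul, map_mul, ev₂₂_inclRight₂, ev₂₂_map_ad, hQ.ev₂₂_comulTensor_one]
  simp [ev₂_universal, mul_comm]

/-- With `g = 1` the first arguments of `V` and of `U` are 1 (for `V` it is `x · 1 · x⁻¹`), and both
elements are normalized there. -/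
theorem ev₂₂_sandwich_fst : ev₂₂ fst₂ 1 fst₂ snd₂ (sandwich Q Q.V Q.U) = 1 := by
  rw [sandwich, map_mul, map_mul, ev₂₂_inclRight₂, ev₂₂_map_ad, hQ.ev₂₂_comulTensor_one_right,
    mul_one, mul_one fst₂, mul_inv_cancel, hQ.V_one_left, hQ.U_one_left, mul_one]

variable {m : A →ₗ[k] k} {r : A}

/-- The right side of the cointegral equation of the double, once its modular functional is known to
be the counit. -/
theorem double_counit_contract [Module.Finite k A] (l : QuantumDouble Q →ₗ[k] k)
    (d : QuantumDouble Q) :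
    contractLeft (l ∘ₗ LinearMap.mulLeft k d ∘ₗ QuantumDouble.antipode Q)
      (contractLeft (QuantumDouble.counit Q) (quantumDouble Q).Φinv) = l d • incl Q 1 := by
  have h1 : ∀ F : A ⊗[k] (A ⊗[k] A), contractLeft (QuantumDouble.counit Q)
      (TensorProduct.map (incl Q) (TensorProduct.map (incl Q) (incl Q)) F) =
      TensorProduct.map (incl Q) (incl Q) (contractLeft Coalgebra.counit F) := by
    intro F
    induction F with
    | zero => simp
    | add a b ha hb => simp only [map_add, ha, hb]
    | tmul a b =>
      rw [TensorProduct.map_tmul, contractLeft_tmul, contractLeft_tmul, hQ.double_counit_incl,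
        map_smul]
  have h2 : d * incl Q 1 = d := by
    rw [hQ.mul_incl, ← Algebra.TensorProduct.one_def, map_one, Module.End.one_apply]
  change contractLeft _ (contractLeft _ (TensorProduct.map (incl Q)
    (TensorProduct.map (incl Q) (incl Q)) Q.Φinv)) = _
  rw [h1, hQ.normalized_left, Algebra.TensorProduct.one_def, TensorProduct.map_tmul,
    contractLeft_tmul, LinearMap.comp_apply, LinearMap.comp_apply, hQ.double_antipode_incl,
    HopfAlgebra.antipode_one, LinearMap.mulLeft_apply, h2]

theorem sandwich_comul [Module.Finite k A] (V W : A ⊗[k] A) (φ : Module.Dual k A) (h : A) :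
    TensorProduct.map (incl Q) (incl Q) V * (quantumDouble Q).comul (bowtie Q φ h) *
        TensorProduct.map (incl Q) (incl Q) W =
      actDD Q (sandwich Q V W) (shuffle Q (dualComul k A φ) (Coalgebra.comul h)) :=
  hQ.map_incl_mul_comul_mul V W φ h

theorem double_isLeftCointegral_iff_forall [Module.Finite k A] (hI : IsIntegralPair m r)
    {l : QuantumDouble Q →ₗ[k] k} : (quantumDouble Q).IsLeftCointegral l ↔
      ∀ (φ : Module.Dual k A) (h : A), contractRight l (actDD Q (sandwich Q Q.V Q.U)
        (shuffle Q (dualComul k A φ) (Coalgebra.comul h))) = l (bowtie Q φ h) • incl Q 1 := by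
  have hV : (quantumDouble Q).V = _ := hQ.isQuasiHopfHom_incl.V_eq
  have hU : (quantumDouble Q).U = _ := hQ.isQuasiHopfHom_incl.U_eq
  constructor
  · rintro ⟨μ, hμ, h1⟩ φ h
    obtain rfl := (hQ.isModularFunctional_double_iff hI).mp hμ
    rw [← hQ.sandwich_comul, ← hU, ← hV, h1]
    exact hQ.double_counit_contract l _
  · intro h1
    refine ⟨_, (hQ.isModularFunctional_double_iff hI).mpr rfl, fun d => ?_⟩
    refine Eq.trans ?_ (hQ.double_counit_contract l d).symm
    induction d using QuantumDouble.induction_on with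
    | add x y hx hy => rw [map_add, mul_add, add_mul, map_add, hx, hy, map_add, add_smul]
    | bowtie φ h => rw [hV, hU, hQ.sandwich_comul, h1]

/-- Pairing the equation with `φ ⋈ h ↦ φ(z) ε(h)` shows that `l( · ⋈ h)` transforms under `z ⇀` by
`ε(z)`. By finite-dimensionality it is evaluation at an element of `A`, which must be an integral,
hence a multiple of `r`. Thus `l = φ(r) n(h)`, and for such `l` the equation is the reduced one for
`n`. -/
theorem double_isLeftCointegral_iff [Module.Finite k A] (hI : IsIntegralPair m r)
    {l : QuantumDouble Q →ₗ[k] k} : (quantumDouble Q).IsLeftCointegral l ↔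
      ∃ n, IsReducedCointegral Q n ∧ l = prodFunctional Q r n := by
  have h0 : ∀ (n : A →ₗ[k] k) (φ : Module.Dual k A) (h : A),
      contractRight (prodFunctional Q r n) (actDD Q (sandwich Q Q.V Q.U)
        (shuffle Q (dualComul k A φ) (Coalgebra.comul h))) =
      φ r • bowtie Q Coalgebra.counit
        (contractRight n (Q.V * Q.U * Coalgebra.comul h)) := by
    intro n φ h
    rw [contractRight_prodFunctional hI.mul_eq, hQ.ev₂₂_sandwich_one]
  rw [hQ.double_isLeftCointegral_iff_forall hI]
  constructor
  · intro h1
    have h2 : ∀ (z : A) (φ : Module.Dual k A) (h : A), l (bowtie Q (dualAct k A z φ) h) =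
        Coalgebra.counit (R := k) z * l (bowtie Q φ h) := by
      intro z φ h
      -- This pairing is sensitive only to the values `(x, 1, x, g')` of the sandwiching tensor,
      -- which are 1.
      have h3 := congrArg (prodFunctional Q z Coalgebra.counit) (h1 φ h)
      rw [apply_contractRight, contractLeft_counit_shuffle, hQ.ev₂₂_sandwich_fst,
        contractLeft_counit_comul, map_one, Module.End.one_apply, map_smul, incl, hQ.counit_eq,
        prodFunctional_bowtie, Bialgebra.counit_one] at h3
      rw [h3, mul_one, smul_eq_mul, mul_comm]
    have h4 : ∀ (φ : Module.Dual k A) (h : A), l (bowtie Q φ h) = φ r * l (bowtie Q m h) := by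
      intro φ h
      obtain ⟨a, ha⟩ := (Module.evalEquiv k A).surjective (l ∘ₗ (bowtie Q).flip h)
      have h5 : ∀ φ : Module.Dual k A, l (bowtie Q φ h) = φ a := fun φ =>
        (LinearMap.congr_fun ha φ).symm
      have h6 : ∀ z, z * a = Coalgebra.counit (R := k) z • a := by
        intro z
        refine sub_eq_zero.mp ((Module.forall_dual_apply_eq_zero_iff k _).mp fun φ => ?_)
        rw [map_sub, map_smul, ← h5, smul_eq_mul, ← h2, h5, dualAct_apply, sub_self]
      rw [h5, h5, hI.eq_smul_of_integral h6, map_smul, map_smul, hI.apply_eq_one, smul_eq_mul,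
        smul_eq_mul]
      ring
    have h7 : l = prodFunctional Q r (l ∘ₗ bowtie Q m) := by
      refine LinearMap.ext fun d => ?_
      induction d using QuantumDouble.induction_on with
      | add x y hx hy => rw [map_add, map_add, hx, hy]
      | bowtie φ h => rw [h4, prodFunctional_bowtie, LinearMap.comp_apply]
    refine ⟨l ∘ₗ bowtie Q m, fun a => ?_, h7⟩
    have h8 := h1 m a
    have h9 := h0 (l ∘ₗ bowtie Q m) m a
    rw [← h7, h8, hI.apply_eq_one, one_smul, incl, hQ.counit_eq, ← map_smul] at h9
    exact (incl_injective h9).symm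
  · rintro ⟨n, hn, rfl⟩ φ h
    rw [h0, hn, prodFunctional_bowtie, map_smul, smul_smul, incl, hQ.counit_eq]

/-- With the integral `m ⋈ r` and the cointegral `φ(r) n(h)` the contraction sees the twists only at
`x = x' = 1`. What is left is `ε ⋈` the contraction computed in `A`. -/
theorem double_isModularElement_iff [Module.Finite k A] (hI : IsIntegralPair m r)
    {g : QuantumDouble Q} : (quantumDouble Q).IsModularElement g ↔
      g = incl Q (Q.β ^ 2 * modularElt m r) := by
  have h0 : ∀ n, IsReducedCointegral Q n → contractLeft (prodFunctional Q r n)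
      ((quantumDouble Q).V * (quantumDouble Q).comul (bowtie Q m r) * (quantumDouble Q).U) =
      n r • incl Q (Q.β ^ 2 * modularElt m r) := by
    intro n hn
    rw [hQ.isQuasiHopfHom_incl.V_eq, hQ.isQuasiHopfHom_incl.U_eq, hQ.sandwich_comul,
      contractLeft_prodFunctional hI.mul_eq, hQ.ev₂₂_sandwich_one, hQ.contractLeft_V_mul_U hI hn,
      hI.apply_eq_one, one_smul, map_smul, incl, hQ.counit_eq]
  constructor
  · rintro ⟨l, s, hl, hs, h2, rfl⟩
    obtain ⟨n, hn, rfl⟩ := (hQ.double_isLeftCointegral_iff hI).mp hl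
    obtain ⟨c, rfl⟩ := hQ.eq_smul_of_isRightIntegral_double hI hs
    rw [map_smul, prodFunctional_bowtie, hI.apply_eq_one, one_mul, smul_eq_mul] at h2
    rw [map_smul, mul_smul_comm, smul_mul_assoc, map_smul, h0 n hn, smul_smul, h2, one_smul]
  · rintro rfl
    have hn := hQ.isReducedCointegral_of_pair hI
    have h2 := hQ.reducedCointegral_apply hI
    refine ⟨_, bowtie Q m r, (hQ.double_isLeftCointegral_iff hI).mpr ⟨_, hn, rfl⟩,
      hQ.isRightIntegral_double hI, ?_, ?_⟩
    · rw [prodFunctional_bowtie, hI.apply_eq_one, h2, one_mul]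
    · rw [h0 _ hn, h2, one_smul]

theorem prodFunctional_antipodeInv [Module.Finite k A] (hI : IsIntegralPair m r)
    (n : A →ₗ[k] k) : prodFunctional Q r n ∘ₗ (quantumDouble Q).antipodeInv =
      prodFunctional Q r (n ∘ₗ HopfAlgebra.antipode k) := by
  have h1 : prodFunctional Q r n =
      prodFunctional Q r (n ∘ₗ HopfAlgebra.antipode k) ∘ₗ QuantumDouble.antipode Q := by
    rw [hQ.prodFunctional_antipode hI]
    congr 1
    ext a
    simp [antipode_antipode]
  have h2 : QuantumDouble.antipode Q ∘ₗ (quantumDouble Q).antipodeInv = LinearMap.id :=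
    Ring.mul_inverse_cancel _ hQ.isUnit_double_antipode
  rw [h1, LinearMap.comp_assoc, h2, LinearMap.comp_id]

theorem double_isLeftIntegralContraction_iff [Module.Finite k A] (hI : IsIntegralPair m r)
    {g : QuantumDouble Q} : (quantumDouble Q).IsLeftIntegralContraction g ↔
      g = incl Q (HopfAlgebra.antipode k (Q.β ^ 2 * modularElt m r)) := by
  have h0 : ∀ n, IsReducedCointegral Q n →
      contractRight (prodFunctional Q r n ∘ₗ (quantumDouble Q).antipodeInv)
      ((quantumDouble Q).qR * (quantumDouble Q).comul (bowtie Q m r) * (quantumDouble Q).pR) =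
      n r • incl Q (HopfAlgebra.antipode k (Q.β ^ 2 * modularElt m r)) := by
    intro n hn
    rw [hQ.isQuasiHopfHom_incl.qR_eq, hQ.isQuasiHopfHom_incl.pR_eq, hQ.sandwich_comul,
      hQ.prodFunctional_antipodeInv hI, contractRight_prodFunctional hI.mul_eq,
      hQ.ev₂₂_sandwich_one, hQ.contractRight_q_mul_p hI hn,
      hI.apply_eq_one, one_smul, map_smul, incl, hQ.counit_eq]
  have h3 : ∀ n, prodFunctional Q r n ((quantumDouble Q).antipodeInv (bowtie Q m r)) = n r := by
    intro n
    rw [← LinearMap.comp_apply, hQ.prodFunctional_antipodeInv hI, prodFunctional_bowtie,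
      hI.apply_eq_one, one_mul, LinearMap.comp_apply, hI.antipode_integral]
  constructor
  · rintro ⟨l, s, hl, hs, h2, rfl⟩
    obtain ⟨n, hn, rfl⟩ := (hQ.double_isLeftCointegral_iff hI).mp hl
    obtain ⟨c, rfl⟩ := hQ.eq_smul_of_isLeftIntegral_double hI hs
    rw [map_smul, map_smul, h3, smul_eq_mul] at h2
    rw [map_smul, mul_smul_comm, smul_mul_assoc, map_smul, h0 n hn, smul_smul, h2, one_smul]
  · rintro rfl
    have hn := hQ.isReducedCointegral_of_pair hI
    have h2 := hQ.reducedCointegral_apply hI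
    refine ⟨_, bowtie Q m r, (hQ.double_isLeftCointegral_iff hI).mpr ⟨_, hn, rfl⟩,
      hQ.isLeftIntegral_double hI, ?_, ?_⟩
    · rw [h3, h2]
    · rw [h0 _ hn, h2, one_smul]

end IsTwist

end DoubleCointegrals

/-! ### The dual of a cocommutative Hopf algebra -/

section HopfDualHopf

open WithConv

variable {k H : Type*} [Field k] [Ring H] [HopfAlgebra k H] [Module.Finite k H]

/-- The identification `H* ⊗ H* ⊗ H* ⊗ H* = (H ⊗ H ⊗ H ⊗ H)*`. -/
def dualTensor₄ (k H : Type*) [Field k] [Ring H] [HopfAlgebra k H] [Module.Finite k H] :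
    HopfDual k H ⊗[k] (HopfDual k H ⊗[k] (HopfDual k H ⊗[k] HopfDual k H)) ≃ₗ[k]
      Module.Dual k (H ⊗[k] (H ⊗[k] (H ⊗[k] H))) :=
  (TensorProduct.congr (toDual k H) (dualTensor₃ k H))
    ≪≫ₗ TensorProduct.dualDistribEquiv k H (H ⊗[k] (H ⊗[k] H))

theorem dualTensor₃_tmul_tmul (φ : HopfDual k H) (F : HopfDual k H ⊗[k] HopfDual k H) (x : H)
    (y : H ⊗[k] H) :
    dualTensor₃ k H (φ ⊗ₜ F) (x ⊗ₜ y) = toDual k H φ x * dualTensor₂ k H F y := by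
  simp [dualTensor₃, TensorProduct.dualDistribEquiv, TensorProduct.dualDistribEquivOfBasis]

theorem dualTensor₄_tmul_tmul (φ : HopfDual k H)
    (F : HopfDual k H ⊗[k] (HopfDual k H ⊗[k] HopfDual k H)) (x : H)
    (y : H ⊗[k] (H ⊗[k] H)) :
    dualTensor₄ k H (φ ⊗ₜ F) (x ⊗ₜ y) = toDual k H φ x * dualTensor₃ k H F y := by
  simp [dualTensor₄, TensorProduct.dualDistribEquiv, TensorProduct.dualDistribEquivOfBasis]

theorem dualTensor₂_eq_map (φ ψ : HopfDual k H) : dualTensor₂ k H (φ ⊗ₜ ψ) =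
    LinearMap.mul' k k ∘ₗ TensorProduct.map (toDual k H φ) (toDual k H ψ) :=
  TensorProduct.ext' fun x y => dualTensor₂_tmul φ ψ x y

theorem dualTensor₃_eq_map (φ : HopfDual k H) (F : HopfDual k H ⊗[k] HopfDual k H) :
    dualTensor₃ k H (φ ⊗ₜ F) =
      LinearMap.mul' k k ∘ₗ TensorProduct.map (toDual k H φ) (dualTensor₂ k H F) :=
  TensorProduct.ext' fun x y => dualTensor₃_tmul_tmul φ F x y

theorem dualTensor₄_eq_map (φ : HopfDual k H)
    (F : HopfDual k H ⊗[k] (HopfDual k H ⊗[k] HopfDual k H)) :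
    dualTensor₄ k H (φ ⊗ₜ F) =
      LinearMap.mul' k k ∘ₗ TensorProduct.map (toDual k H φ) (dualTensor₃ k H F) :=
  TensorProduct.ext' fun x y => dualTensor₄_tmul_tmul φ F x y

omit [Module.Finite k H] in
theorem mul'_map_convMul {C D : Type*} [AddCommGroup C] [Module k C] [Coalgebra k C]
    [AddCommGroup D] [Module k D] [Coalgebra k D] (f f' : WithConv (C →ₗ[k] k))
    (g g' : WithConv (D →ₗ[k] k)) :
    LinearMap.mul' k k ∘ₗ TensorProduct.map (f * f').ofConv (g * g').ofConv =
      (toConv (LinearMap.mul' k k ∘ₗ TensorProduct.map f.ofConv g.ofConv) *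
        toConv (LinearMap.mul' k k ∘ₗ TensorProduct.map f'.ofConv g'.ofConv)).ofConv := by
  have h1 : ((Algebra.TensorProduct.lmul' k (S := k) : k ⊗[k] k →ₐ[k] k) : k ⊗[k] k →ₗ[k] k) =
      LinearMap.mul' k k := rfl
  have h := LinearMap.algHom_comp_convMul_distrib (R := k) (C := C ⊗[k] D)
    (Algebra.TensorProduct.lmul' k (S := k) : k ⊗[k] k →ₐ[k] k)
    (toConv (TensorProduct.map f.ofConv g.ofConv)) (toConv (TensorProduct.map f'.ofConv g'.ofConv))
  rw [TensorProduct.map_convMul_map] at h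
  exact h

omit [Module.Finite k H] in
-- The inductive step from `n` to `n + 1` tensor factors: the algebra structure of `H* ⊗ ... ⊗ H*`
-- is convolution of functionals on `H ⊗ ... ⊗ H`.
theorem toConv_map_mul {B D : Type*} [Ring B] [Algebra k B] [AddCommGroup D] [Module k D]
    [Coalgebra k D] {e : B →ₗ[k] Module.Dual k D}
    (he : ∀ b c, toConv (e (b * c)) = toConv (e b) * toConv (e c))
    {E : HopfDual k H ⊗[k] B →ₗ[k] Module.Dual k (H ⊗[k] D)}
    (hE : ∀ φ b, E (φ ⊗ₜ b) = LinearMap.mul' k k ∘ₗ TensorProduct.map (toDual k H φ) (e b))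
    (F G : HopfDual k H ⊗[k] B) : toConv (E (F * G)) = toConv (E F) * toConv (E G) := by
  induction F with
  | zero => simp
  | add a b ha hb => simp only [add_mul, map_add, toConv_add, ha, hb]
  | tmul a b =>
    induction G with
    | zero => simp
    | add a b ha hb => simp only [mul_add, map_add, toConv_add, ha, hb]
    | tmul c d =>
      rw [Algebra.TensorProduct.tmul_mul_tmul, hE, hE, hE, ← ofConv_toConv (e (b * d)), he]
      exact congrArg toConv (mul'_map_convMul (toConv (toDual k H a)) (toConv (toDual k H c))
        (toConv (e b)) (toConv (e d)))

theorem dualTensor₂_mul (F G : HopfDual k H ⊗[k] HopfDual k H) :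
    toConv (dualTensor₂ k H (F * G)) = toConv (dualTensor₂ k H F) * toConv (dualTensor₂ k H G) :=
  toConv_map_mul (e := (toDual k H).toLinearMap) (E := (dualTensor₂ k H).toLinearMap)
    (fun _ _ => rfl) dualTensor₂_eq_map F G

theorem dualTensor₃_mul (F G : HopfDual k H ⊗[k] (HopfDual k H ⊗[k] HopfDual k H)) :
    toConv (dualTensor₃ k H (F * G)) = toConv (dualTensor₃ k H F) * toConv (dualTensor₃ k H G) :=
  toConv_map_mul (e := (dualTensor₂ k H).toLinearMap) (E := (dualTensor₃ k H).toLinearMap)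
    dualTensor₂_mul dualTensor₃_eq_map F G

theorem dualTensor₄_mul
    (F G : HopfDual k H ⊗[k] (HopfDual k H ⊗[k] (HopfDual k H ⊗[k] HopfDual k H))) :
    toConv (dualTensor₄ k H (F * G)) = toConv (dualTensor₄ k H F) * toConv (dualTensor₄ k H G) :=
  toConv_map_mul (e := (dualTensor₃ k H).toLinearMap) (E := (dualTensor₄ k H).toLinearMap)
    dualTensor₃_mul dualTensor₄_eq_map F G

theorem eq_of_dualTensor₂ {F G : HopfDual k H ⊗[k] HopfDual k H}
    (h : ∀ x y, dualTensor₂ k H F (x ⊗ₜ y) = dualTensor₂ k H G (x ⊗ₜ y)) : F = G :=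
  (dualTensor₂ k H).injective (TensorProduct.ext' h)

theorem eq_of_dualTensor₃ {F G : HopfDual k H ⊗[k] (HopfDual k H ⊗[k] HopfDual k H)}
    (h : ∀ x y z, dualTensor₃ k H F (x ⊗ₜ (y ⊗ₜ z)) = dualTensor₃ k H G (x ⊗ₜ (y ⊗ₜ z))) :
    F = G := by
  refine (dualTensor₃ k H).injective (TensorProduct.ext' fun x Y => ?_)
  induction Y with
  | zero => simp
  | add a b ha hb => simp only [TensorProduct.tmul_add, map_add, ha, hb]
  | tmul y z => exact h x y z

omit [Module.Finite k H] in
theorem eq_of_toDual {φ ψ : HopfDual k H} (h : ∀ x, toDual k H φ x = toDual k H ψ x) : φ = ψ :=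
  (toDual k H).injective (LinearMap.ext h)

/-- The comultiplication of `H*`. -/
def dualComulMap (k H : Type*) [Field k] [Ring H] [HopfAlgebra k H] [Module.Finite k H] :
    HopfDual k H →ₗ[k] HopfDual k H ⊗[k] HopfDual k H :=
  (dualTensor₂ k H).symm.toLinearMap ∘ₗ
    Module.Dual.transpose (R := k) (LinearMap.mul' k H) ∘ₗ (toDual k H).toLinearMap

/-- The counit of `H*`. -/
def dualCounitMap (k H : Type*) [Field k] [Ring H] [HopfAlgebra k H] : HopfDual k H →ₗ[k] k :=
  Module.Dual.eval k H 1 ∘ₗ (toDual k H).toLinearMap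

/-- The antipode of `H*`. -/
def dualAntipodeMap (k H : Type*) [Field k] [Ring H] [HopfAlgebra k H] :
    HopfDual k H →ₗ[k] HopfDual k H :=
  (toDual k H).symm.toLinearMap ∘ₗ
    Module.Dual.transpose (R := k) (HopfAlgebra.antipode k (A := H)) ∘ₗ (toDual k H).toLinearMap

theorem dualTensor₂_comul (φ : HopfDual k H) :
    dualTensor₂ k H (dualComulMap k H φ) = toDual k H φ ∘ₗ LinearMap.mul' k H :=
  (dualTensor₂ k H).apply_symm_apply _

theorem dualTensor₂_comul_apply (φ : HopfDual k H) (x y : H) :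
    dualTensor₂ k H (dualComulMap k H φ) (x ⊗ₜ y) = toDual k H φ (x * y) := by
  rw [dualTensor₂_comul]
  rfl

omit [Module.Finite k H] in
theorem dualCounitMap_apply (φ : HopfDual k H) : dualCounitMap k H φ = toDual k H φ 1 := rfl

omit [Module.Finite k H] in
theorem toDual_dualAntipodeMap (φ : HopfDual k H) (x : H) :
    toDual k H (dualAntipodeMap k H φ) x = toDual k H φ (HopfAlgebra.antipode k x) := rfl

theorem dualTensor₃_lTensor_comul (F : HopfDual k H ⊗[k] HopfDual k H) (x y z : H) :
    dualTensor₃ k H (LinearMap.lTensor _ (dualComulMap k H) F) (x ⊗ₜ (y ⊗ₜ z)) =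
      dualTensor₂ k H F (x ⊗ₜ (y * z)) := by
  induction F with
  | zero => simp
  | add a b ha hb => simp only [map_add, LinearMap.add_apply, ha, hb]
  | tmul a b =>
    rw [LinearMap.lTensor_tmul, dualTensor₃_tmul_tmul, dualTensor₂_comul_apply, dualTensor₂_tmul]

theorem dualTensor₃_assoc (G : HopfDual k H ⊗[k] HopfDual k H) (c : HopfDual k H) (x y z : H) :
    dualTensor₃ k H (TensorProduct.assoc k _ _ _ (G ⊗ₜ c)) (x ⊗ₜ (y ⊗ₜ z)) =
      dualTensor₂ k H G (x ⊗ₜ y) * toDual k H c z := by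
  induction G with
  | zero => simp
  | add a b ha hb => simp only [TensorProduct.add_tmul, map_add, LinearMap.add_apply, ha, hb,
      add_mul]
  | tmul a b => rw [TensorProduct.assoc_tmul, dualTensor₃_tmul, dualTensor₂_tmul, mul_assoc]

theorem dualTensor₃_assoc_comul (F : HopfDual k H ⊗[k] HopfDual k H) (x y z : H) :
    dualTensor₃ k H (TensorProduct.assoc k _ _ _ (LinearMap.rTensor _ (dualComulMap k H) F))
      (x ⊗ₜ (y ⊗ₜ z)) = dualTensor₂ k H F ((x * y) ⊗ₜ z) := by
  induction F with
  | zero => simp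
  | add a b ha hb => simp only [map_add, LinearMap.add_apply, ha, hb]
  | tmul a b =>
    rw [LinearMap.rTensor_tmul, dualTensor₃_assoc, dualTensor₂_comul_apply, dualTensor₂_tmul]

theorem toDual_mul' (F : HopfDual k H ⊗[k] HopfDual k H) (x : H) :
    toDual k H (LinearMap.mul' k _ F) x = dualTensor₂ k H F (Coalgebra.comul x) := by
  induction F with
  | zero => simp
  | add a b ha hb => simp only [map_add, LinearMap.add_apply, ha, hb]
  | tmul a b =>
    rw [LinearMap.mul'_apply, toDual_mul, dualTensor₂_eq_map]
    rfl

theorem dualTensor₂_rTensor_antipode (F : HopfDual k H ⊗[k] HopfDual k H) (X : H ⊗[k] H) :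
    dualTensor₂ k H (LinearMap.rTensor _ (dualAntipodeMap k H) F) X =
      dualTensor₂ k H F (LinearMap.rTensor H (HopfAlgebra.antipode k) X) := by
  induction F with
  | zero => simp
  | add a b ha hb => simp only [map_add, LinearMap.add_apply, ha, hb]
  | tmul a b =>
    induction X with
    | zero => simp
    | add x y hx hy => simp only [map_add, hx, hy]
    | tmul x y =>
      rw [LinearMap.rTensor_tmul, LinearMap.rTensor_tmul, dualTensor₂_tmul, dualTensor₂_tmul,
        toDual_dualAntipodeMap]

theorem dualTensor₂_lTensor_antipode (F : HopfDual k H ⊗[k] HopfDual k H) (X : H ⊗[k] H) :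
    dualTensor₂ k H (LinearMap.lTensor _ (dualAntipodeMap k H) F) X =
      dualTensor₂ k H F (LinearMap.lTensor H (HopfAlgebra.antipode k) X) := by
  induction F with
  | zero => simp
  | add a b ha hb => simp only [map_add, LinearMap.add_apply, ha, hb]
  | tmul a b =>
    induction X with
    | zero => simp
    | add x y hx hy => simp only [map_add, hx, hy]
    | tmul x y =>
      rw [LinearMap.lTensor_tmul, LinearMap.lTensor_tmul, dualTensor₂_tmul, dualTensor₂_tmul,
        toDual_dualAntipodeMap]

omit [Module.Finite k H] in
theorem toDual_algebraMap (c : k) (x : H) :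
    toDual k H (algebraMap k _ c) x = Coalgebra.counit (R := k) x * c := by
  rw [Algebra.algebraMap_eq_smul_one, map_smul, toDual_one, LinearMap.smul_apply, smul_eq_mul,
    mul_comm]

theorem dualTensor₂_contract_left (F : HopfDual k H ⊗[k] HopfDual k H) (c : H) (x : H) :
    toDual k H (contractLeft (evalHopfDual c) F) x = dualTensor₂ k H F (c ⊗ₜ x) := by
  induction F with
  | zero => simp
  | add a b ha hb => simp only [map_add, LinearMap.add_apply, ha, hb]
  | tmul a b =>
    rw [contractLeft_tmul, map_smul, dualTensor₂_tmul]
    rfl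

theorem dualTensor₂_contract_right (F : HopfDual k H ⊗[k] HopfDual k H) (c : H) (x : H) :
    toDual k H (contractRight (evalHopfDual c) F) x = dualTensor₂ k H F (x ⊗ₜ c) := by
  induction F with
  | zero => simp
  | add a b ha hb => simp only [map_add, LinearMap.add_apply, ha, hb]
  | tmul a b =>
    rw [contractRight_tmul, map_smul, dualTensor₂_tmul, mul_comm]
    rfl

theorem contractLeft_dualCounitMap (φ : HopfDual k H) :
    contractLeft (dualCounitMap k H) (dualComulMap k H φ) = φ :=
  eq_of_toDual fun x => (dualTensor₂_contract_left _ 1 x).trans (by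
    rw [dualTensor₂_comul_apply, one_mul])

theorem contractRight_dualCounitMap (φ : HopfDual k H) :
    contractRight (dualCounitMap k H) (dualComulMap k H φ) = φ :=
  eq_of_toDual fun x => (dualTensor₂_contract_right _ 1 x).trans (by
    rw [dualTensor₂_comul_apply, mul_one])

/-- The Hopf algebra structure of `H*`. -/
abbrev hopfDualHopfAlgebra (k H : Type*) [Field k] [Ring H] [HopfAlgebra k H] [Module.Finite k H] :
    HopfAlgebra k (HopfDual k H) where
  comul := dualComulMap k H
  counit := dualCounitMap k H
  antipode := dualAntipodeMap k H
  coassoc := LinearMap.ext fun φ => eq_of_dualTensor₃ fun x y z => by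
    simp only [LinearMap.comp_apply, LinearEquiv.coe_coe]
    rw [dualTensor₃_assoc_comul, dualTensor₃_lTensor_comul, dualTensor₂_comul_apply,
      dualTensor₂_comul_apply, mul_assoc]
  rTensor_counit_comp_comul := LinearMap.ext fun φ =>
    (TensorProduct.lid k (HopfDual k H)).injective
      ((contractLeft_dualCounitMap φ).trans (by simp))
  lTensor_counit_comp_comul := LinearMap.ext fun φ =>
    (TensorProduct.rid k (HopfDual k H)).injective
      ((contractRight_dualCounitMap φ).trans (by simp))
  counit_one := by
    rw [dualCounitMap_apply, toDual_one, Bialgebra.counit_one]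
  mul_compr₂_counit := by
    refine LinearMap.ext₂ fun φ ψ => ?_
    change toDual k H (φ * ψ) 1 = toDual k H φ 1 * toDual k H ψ 1
    rw [toDual_mul, LinearMap.comp_apply, LinearMap.comp_apply, Bialgebra.comul_one,
      Algebra.TensorProduct.one_def, TensorProduct.map_tmul, LinearMap.mul'_apply]
  comul_one := eq_of_dualTensor₂ fun x y => by
    rw [dualTensor₂_comul_apply, Algebra.TensorProduct.one_def, dualTensor₂_tmul, toDual_one,
      Bialgebra.counit_mul]
  mul_compr₂_comul := by
    refine LinearMap.ext₂ fun φ ψ => ?_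
    change dualComulMap k H (φ * ψ) = dualComulMap k H φ * dualComulMap k H ψ
    refine (dualTensor₂ k H).injective (toConv_injective ?_)
    rw [dualTensor₂_mul, dualTensor₂_comul, dualTensor₂_comul, dualTensor₂_comul]
    exact congrArg toConv (LinearMap.convMul_comp_coalgHom_distrib (toConv (toDual k H φ))
      (toConv (toDual k H ψ)) (Bialgebra.mulCoalgHom k H))
  mul_antipode_rTensor_comul := LinearMap.ext fun φ => eq_of_toDual fun x => by
    simp only [LinearMap.comp_apply, Algebra.linearMap_apply]
    rw [toDual_mul', dualTensor₂_rTensor_antipode, dualTensor₂_comul, LinearMap.comp_apply,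
      HopfAlgebra.mul_antipode_rTensor_comul_apply, toDual_algebraMap,
      Algebra.algebraMap_eq_smul_one, map_smul, smul_eq_mul, dualCounitMap_apply]
  mul_antipode_lTensor_comul := LinearMap.ext fun φ => eq_of_toDual fun x => by
    simp only [LinearMap.comp_apply, Algebra.linearMap_apply]
    rw [toDual_mul', dualTensor₂_lTensor_antipode, dualTensor₂_comul, LinearMap.comp_apply,
      HopfAlgebra.mul_antipode_lTensor_comul_apply, toDual_algebraMap,
      Algebra.algebraMap_eq_smul_one, map_smul, smul_eq_mul, dualCounitMap_apply]

/-- The convolution product on the dual of a cocommutative Hopf algebra is commutative. -/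
abbrev hopfDualCommRing (k H : Type*) [Field k] [Ring H] [HopfAlgebra k H]
    [Coalgebra.IsCocomm k H] : CommRing (HopfDual k H) where
  __ := (inferInstance : Ring (HopfDual k H))
  mul_comm := (LinearMap.convCommRing (R := k) (A := k) (C := H)).mul_comm

end HopfDualHopf

/-! ### `H*_ω` as a commutative twist, and the modular functional of `H`. -/

section HopfDualTwist

open WithConv

variable {k H : Type*} [Field k] [Ring H] [HopfAlgebra k H] [Module.Finite k H]

theorem dualTensor₃_symm_apply (F : H ⊗[k] (H ⊗[k] H) →ₗ[k] k) :
    dualTensor₃ k H ((dualTensor₃ k H).symm F) = F :=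
  (dualTensor₃ k H).apply_symm_apply F

theorem eq_of_dualTensor₄
    {F G : HopfDual k H ⊗[k] (HopfDual k H ⊗[k] (HopfDual k H ⊗[k] HopfDual k H))}
    (h : toConv (dualTensor₄ k H F) = toConv (dualTensor₄ k H G)) : F = G :=
  (dualTensor₄ k H).injective (toConv_injective h)

omit [Module.Finite k H] in
theorem dual_ext₄ {f g : H ⊗[k] (H ⊗[k] (H ⊗[k] H)) →ₗ[k] k}
    (h : ∀ x y z t, f (x ⊗ₜ (y ⊗ₜ (z ⊗ₜ t))) = g (x ⊗ₜ (y ⊗ₜ (z ⊗ₜ t)))) : f = g := by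
  refine TensorProduct.ext' fun x Y => ?_
  induction Y with
  | zero => simp
  | add a b ha hb => simp only [TensorProduct.tmul_add, map_add, ha, hb]
  | tmul y Z =>
    induction Z with
    | zero => simp
    | add a b ha hb => simp only [TensorProduct.tmul_add, map_add, ha, hb]
    | tmul z t => exact h x y z t

theorem dualTensor₄_assoc (F G : HopfDual k H ⊗[k] HopfDual k H) (x y z t : H) :
    dualTensor₄ k H (TensorProduct.assoc k _ _ _ (F ⊗ₜ G)) (x ⊗ₜ (y ⊗ₜ (z ⊗ₜ t))) =
      dualTensor₂ k H F (x ⊗ₜ y) * dualTensor₂ k H G (z ⊗ₜ t) := by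
  induction F with
  | zero => simp
  | add a b ha hb =>
    simp only [TensorProduct.add_tmul, map_add, LinearMap.add_apply, add_mul, ha, hb]
  | tmul a b =>
    rw [TensorProduct.assoc_tmul, dualTensor₄_tmul_tmul, dualTensor₃_tmul_tmul, dualTensor₂_tmul,
      mul_assoc]

theorem dualTensor₄_comulFirst (ω : (ThreeCochain k H)ˣ)
    (F : HopfDual k H ⊗[k] (HopfDual k H ⊗[k] HopfDual k H)) :
    dualTensor₄ k H ((hopfDual ω).comulFirst F) = dualTensor₃ k H F ∘ₗ
      LinearMap.rTensor (H ⊗[k] H) (LinearMap.mul' k H) ∘ₗ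
        (TensorProduct.assoc k H H (H ⊗[k] H)).symm.toLinearMap := by
  refine dual_ext₄ fun x y z t => ?_
  change _ = dualTensor₃ k H F ((x * y) ⊗ₜ (z ⊗ₜ t))
  induction F with
  | zero => simp
  | add a b ha hb => simp only [map_add, LinearMap.add_apply, ha, hb]
  | tmul a b =>
    change dualTensor₄ k H (TensorProduct.assoc k _ _ _ (dualComulMap k H a ⊗ₜ b)) _ = _
    rw [dualTensor₄_assoc, dualTensor₂_comul_apply, dualTensor₃_tmul_tmul]

theorem dualTensor₄_lTensor_lTensor_comul
    (F : HopfDual k H ⊗[k] (HopfDual k H ⊗[k] HopfDual k H)) :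
    dualTensor₄ k H (LinearMap.lTensor _ (LinearMap.lTensor _ (dualComulMap k H)) F) =
      dualTensor₃ k H F ∘ₗ LinearMap.lTensor H (LinearMap.lTensor H (LinearMap.mul' k H)) := by
  refine dual_ext₄ fun x y z t => ?_
  change _ = dualTensor₃ k H F (x ⊗ₜ (y ⊗ₜ (z * t)))
  induction F with
  | zero => simp
  | add a b ha hb => simp only [map_add, LinearMap.add_apply, ha, hb]
  | tmul a b =>
    rw [LinearMap.lTensor_tmul, dualTensor₄_tmul_tmul, dualTensor₃_lTensor_comul,
      dualTensor₃_tmul_tmul]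

theorem dualTensor₄_lTensor_assoc_comul
    (F : HopfDual k H ⊗[k] (HopfDual k H ⊗[k] HopfDual k H)) :
    dualTensor₄ k H (LinearMap.lTensor _ ((TensorProduct.assoc k _ _ _).toLinearMap ∘ₗ
        LinearMap.rTensor _ (dualComulMap k H)) F) =
      dualTensor₃ k H F ∘ₗ LinearMap.lTensor H (LinearMap.rTensor H (LinearMap.mul' k H) ∘ₗ
        (TensorProduct.assoc k H H H).symm.toLinearMap) := by
  refine dual_ext₄ fun x y z t => ?_
  change _ = dualTensor₃ k H F (x ⊗ₜ ((y * z) ⊗ₜ t))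
  induction F with
  | zero => simp
  | add a b ha hb => simp only [map_add, LinearMap.add_apply, ha, hb]
  | tmul a b =>
    rw [LinearMap.lTensor_tmul, dualTensor₄_tmul_tmul, LinearMap.comp_apply, LinearEquiv.coe_coe,
      dualTensor₃_assoc_comul, dualTensor₃_tmul_tmul]

theorem dualTensor₄_one_tmul
    (F : HopfDual k H ⊗[k] (HopfDual k H ⊗[k] HopfDual k H)) :
    dualTensor₄ k H (1 ⊗ₜ F) = dualTensor₃ k H F ∘ₗ contractLeft Coalgebra.counit := by
  refine dual_ext₄ fun x y z t => ?_
  rw [dualTensor₄_tmul_tmul, toDual_one, LinearMap.comp_apply, contractLeft_tmul, map_smul,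
    smul_eq_mul]

theorem dualTensor₃_appendOne (F : HopfDual k H ⊗[k] HopfDual k H) (y z t : H) :
    dualTensor₃ k H (LinearMap.lTensor _ ((TensorProduct.mk k _ _).flip 1) F)
      (y ⊗ₜ (z ⊗ₜ t)) = Coalgebra.counit (R := k) t * dualTensor₂ k H F (y ⊗ₜ z) := by
  induction F with
  | zero => simp
  | add a b ha hb => simp only [map_add, LinearMap.add_apply, mul_add, ha, hb]
  | tmul a b =>
    rw [LinearMap.lTensor_tmul, LinearMap.flip_apply, TensorProduct.mk_apply, dualTensor₃_tmul,
      dualTensor₂_tmul, toDual_one]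
    ring

theorem dualTensor₄_appendOne (F : HopfDual k H ⊗[k] (HopfDual k H ⊗[k] HopfDual k H)) :
    dualTensor₄ k H (QuasiHopfData.appendOne F) = dualTensor₃ k H F ∘ₗ
      LinearMap.lTensor H (LinearMap.lTensor H (contractRight Coalgebra.counit)) := by
  refine dual_ext₄ fun x y z t => ?_
  rw [LinearMap.comp_apply, LinearMap.lTensor_tmul, LinearMap.lTensor_tmul, contractRight_tmul,
    TensorProduct.tmul_smul, TensorProduct.tmul_smul, map_smul, smul_eq_mul]
  induction F with
  | zero => simp
  | add a b ha hb => simp only [map_add, LinearMap.add_apply, mul_add, ha, hb]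
  | tmul a b =>
    rw [QuasiHopfData.appendOne, LinearMap.lTensor_tmul, dualTensor₄_tmul_tmul,
      dualTensor₃_appendOne, dualTensor₃_tmul_tmul]
    ring

theorem dualTensor₂_contractLeft
    (F : HopfDual k H ⊗[k] (HopfDual k H ⊗[k] HopfDual k H)) (y : H ⊗[k] H) :
    dualTensor₂ k H (contractLeft (dualCounitMap k H) F) y = dualTensor₃ k H F (1 ⊗ₜ y) := by
  induction F with
  | zero => simp
  | add a b ha hb => simp only [map_add, LinearMap.add_apply, ha, hb]
  | tmul a b =>
    rw [contractLeft_tmul, map_smul, dualTensor₃_tmul_tmul]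
    rfl

theorem dualTensor₂_lTensor_contractLeft
    (F : HopfDual k H ⊗[k] (HopfDual k H ⊗[k] HopfDual k H)) (x y : H) :
    dualTensor₂ k H (LinearMap.lTensor _ (contractLeft (dualCounitMap k H)) F) (x ⊗ₜ y) =
      dualTensor₃ k H F (x ⊗ₜ (1 ⊗ₜ y)) := by
  induction F with
  | zero => simp
  | add a b ha hb => simp only [map_add, LinearMap.add_apply, ha, hb]
  | tmul a b =>
    rw [LinearMap.lTensor_tmul, dualTensor₂_tmul, dualTensor₃_tmul_tmul,
      ← dualTensor₂_contract_left]
    rfl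

theorem dualTensor₂_lTensor_contractRight
    (F : HopfDual k H ⊗[k] (HopfDual k H ⊗[k] HopfDual k H)) (x y : H) :
    dualTensor₂ k H (LinearMap.lTensor _ (contractRight (dualCounitMap k H)) F) (x ⊗ₜ y) =
      dualTensor₃ k H F (x ⊗ₜ (y ⊗ₜ 1)) := by
  induction F with
  | zero => simp
  | add a b ha hb => simp only [map_add, LinearMap.add_apply, ha, hb]
  | tmul a b =>
    rw [LinearMap.lTensor_tmul, dualTensor₂_tmul, dualTensor₃_tmul_tmul,
      ← dualTensor₂_contract_right]
    rfl

theorem toDual_mulMap₃ (F : HopfDual k H ⊗[k] (HopfDual k H ⊗[k] HopfDual k H)) (x : H) :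
    toDual k H (mulMap₃ LinearMap.id (dualAntipodeMap k H) LinearMap.id F) x =
      dualTensor₃ k H F (LinearMap.lTensor H (LinearMap.rTensor H (HopfAlgebra.antipode k) ∘ₗ
        Coalgebra.comul) (Coalgebra.comul x)) := by
  induction F with
  | zero => simp
  | add a b ha hb => simp only [map_add, LinearMap.add_apply, ha, hb]
  | tmul a G =>
    have h1 : mulMap₃ LinearMap.id (dualAntipodeMap k H) LinearMap.id (a ⊗ₜ G) =
        LinearMap.mul' k _ (a ⊗ₜ LinearMap.mul' k _
          (LinearMap.rTensor _ (dualAntipodeMap k H) G)) := rfl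
    rw [h1, toDual_mul']
    induction Coalgebra.comul (R := k) x with
    | zero => simp
    | add y z hy hz => simp only [map_add, hy, hz]
    | tmul y z =>
      rw [dualTensor₂_tmul, toDual_mul', dualTensor₂_rTensor_antipode, LinearMap.lTensor_tmul,
        dualTensor₃_tmul_tmul]
      rfl

variable [Coalgebra.IsCocomm k H]

-- Both structures extend the given convolution ring, so the operations of `hopfDual ω` agree with
-- theirs by definition.
attribute [local instance] hopfDualCommRing hopfDualHopfAlgebra

/-- Each condition is transported along `H* ⊗ ... ⊗ H* = (H ⊗ ... ⊗ H)*`, under which it becomes the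
corresponding property of `ω`. -/
theorem isTwist_hopfDual (ω : (ThreeCochain k H)ˣ) (hω : IsNormalizedThreeCocycle ω) :
    IsTwist (hopfDual ω) where
  comul_eq := rfl
  counit_eq := rfl
  antipode_eq := rfl
  α_eq := rfl
  β_eq := eq_of_toDual fun x => by
    refine Eq.trans ?_ (toDual_mulMap₃ _ x).symm
    change _ = dualTensor₃ k H ((dualTensor₃ k H).symm (ω : ThreeCochain k H).ofConv) _
    rw [dualTensor₃_symm_apply]
    rfl
  Φ_mul_Φinv := by
    refine (dualTensor₃ k H).injective (toConv_injective ?_)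
    refine (dualTensor₃_mul _ _).trans ?_
    have h1 : toConv (dualTensor₃ k H (hopfDual ω).Φ) *
        toConv (dualTensor₃ k H (hopfDual ω).Φinv) = (1 : ThreeCochain k H) := by
      rw [show dualTensor₃ k H (hopfDual ω).Φ = _ from dualTensor₃_symm_apply _,
        show dualTensor₃ k H (hopfDual ω).Φinv = _ from dualTensor₃_symm_apply _]
      exact ω.inv_mul
    refine h1.trans (congrArg toConv ?_)
    refine TensorProduct.ext' fun x Y => ?_
    induction Y with
    | zero => simp
    | add a b ha hb => simp only [TensorProduct.tmul_add, map_add, ha, hb]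
    | tmul y z =>
      refine Eq.trans ?_ (dualTensor₃_tmul 1 1 1 x y z).symm
      rw [toDual_one]
      change Coalgebra.counit (R := k) (x ⊗ₜ[k] (y ⊗ₜ[k] z)) = _
      rw [TensorProduct.counit_tmul, TensorProduct.counit_tmul]
      simp only [smul_eq_mul]
      ring
  cocycle := by
    refine eq_of_dualTensor₄ ?_
    refine (dualTensor₄_mul _ _).trans (Eq.trans ?_ (dualTensor₄_mul _ _).symm)
    refine Eq.trans ?_ (congrArg (· * _) (dualTensor₄_mul _ _).symm)
    have h1 := dualTensor₄_lTensor_lTensor_comul (hopfDual ω).Φinv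
    have h2 := dualTensor₄_comulFirst ω (hopfDual ω).Φinv
    have h3 := dualTensor₄_one_tmul (hopfDual ω).Φinv
    have h4 := dualTensor₄_lTensor_assoc_comul (hopfDual ω).Φinv
    have h5 := dualTensor₄_appendOne (hopfDual ω).Φinv
    have h6 : dualTensor₃ k H (hopfDual ω).Φinv = (ω : ThreeCochain k H).ofConv :=
      dualTensor₃_symm_apply _
    rw [h6] at h1 h2 h3 h4 h5
    exact (congrArg₂ (· * ·) (congrArg toConv h1) (congrArg toConv h2)).trans
      (hω.cocycle.trans (congrArg₂ (· * ·) (congrArg₂ (· * ·) (congrArg toConv h3)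
        (congrArg toConv h4)) (congrArg toConv h5)).symm)
  normalized_left := by
    refine eq_of_dualTensor₂ fun x y => (dualTensor₂_contractLeft _ _).trans ?_
    refine (LinearMap.congr_fun (dualTensor₃_symm_apply _) _).trans ?_
    exact (hω.normalized_left x y).trans (dualTensor₂_tmul 1 1 x y).symm
  normalized_middle := by
    refine eq_of_dualTensor₂ fun x y => (dualTensor₂_lTensor_contractLeft _ _ _).trans ?_
    refine (LinearMap.congr_fun (dualTensor₃_symm_apply _) _).trans ?_
    exact (hω.normalized_middle x y).trans (dualTensor₂_tmul 1 1 x y).symm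
  normalized_right := by
    refine eq_of_dualTensor₂ fun x y => (dualTensor₂_lTensor_contractRight _ _ _).trans ?_
    refine (LinearMap.congr_fun (dualTensor₃_symm_apply _) _).trans ?_
    exact (hω.normalized_right x y).trans (dualTensor₂_tmul 1 1 x y).symm

/-- Evaluation at `t` is a left invariant functional on `H*` exactly when `t` is a left integral of
`H`, and `t x = μ(x) t` is dual to `m(φ₁) φ₂ = m(φ) μ`. Uniqueness of `m` up to scalars gives
uniqueness of `μ`. -/
theorem isModularFunctional_iff {m : HopfDual k H →ₗ[k] k} {r : HopfDual k H}
    (hI : IsIntegralPair m r) {μ : HopfDual k H} :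
    IsModularFunctional Coalgebra.counit (toDual k H μ) ↔ μ = modularElt m r := by
  have h1 : ∀ (t x : H) (φ : HopfDual k H),
      toDual k H (contractLeft (evalHopfDual t) (Coalgebra.comul φ)) x = toDual k H φ (t * x) :=
    fun t x φ => (dualTensor₂_contract_left _ t x).trans (dualTensor₂_comul_apply φ t x)
  have h2 : ∀ (t x : H) (φ : HopfDual k H),
      toDual k H (contractRight (evalHopfDual t) (Coalgebra.comul φ)) x = toDual k H φ (x * t) :=
    fun t x φ => (dualTensor₂_contract_right _ t x).trans (dualTensor₂_comul_apply φ x t)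
  have h3 : ∀ {t s : H}, (∀ φ : HopfDual k H, toDual k H φ t = toDual k H φ s) → t = s := by
    intro t s h
    refine sub_eq_zero.mp ((Module.forall_dual_apply_eq_zero_iff k _).mp fun φ => ?_)
    rw [map_sub, sub_eq_zero]
    exact h ((toDual k H).symm φ)
  constructor
  · rintro ⟨t, h0, ht, hμ⟩
    have h4 : IsLeftInvariant (evalHopfDual (k := k) t) := fun φ => eq_of_toDual fun x => by
      rw [h2, ht, map_smul, map_smul, LinearMap.smul_apply, toDual_one, smul_eq_mul, smul_eq_mul,
        mul_comm]
      rfl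
    have h5 := hI.eq_smul_of_invariant h4
    have h6 : evalHopfDual t r ≠ 0 := by
      intro h
      refine h0 (h3 fun φ => ?_)
      have h7 := LinearMap.congr_fun h5 φ
      rw [h, zero_smul] at h7
      rw [map_zero]
      exact h7
    have h8 : contractLeft (evalHopfDual t) (Coalgebra.comul r) =
        evalHopfDual t r • modularElt m r := by
      have h9 : ∀ F : HopfDual k H ⊗[k] HopfDual k H, contractLeft (evalHopfDual t) F =
          evalHopfDual t r • contractLeft m F := by
        intro F
        conv_lhs => rw [h5]
        induction F with
        | zero => simp
        | add a b ha hb => simp only [map_add, ha, hb, smul_add]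
        | tmul a b => simp [mul_smul]
      exact h9 _
    have h10 : contractLeft (evalHopfDual t) (Coalgebra.comul r) = evalHopfDual t r • μ :=
      eq_of_toDual fun x => by
        rw [h1, hμ, map_smul, map_smul, LinearMap.smul_apply, smul_eq_mul, smul_eq_mul, mul_comm]
        rfl
    exact smul_right_injective _ h6 (h10.symm.trans h8)
  · rintro rfl
    -- By reflexivity of finite-dimensional spaces `m` is evaluation at some `t`, the required left
    -- integral.
    obtain ⟨t, ht⟩ := (Module.evalEquiv k H).surjective (m ∘ₗ (toDual k H).symm.toLinearMap)
    have h4 : evalHopfDual t = m := by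
      exact LinearMap.ext fun φ => LinearMap.congr_fun ht (toDual k H φ)
    have h5 : ∀ φ : HopfDual k H, toDual k H φ t = m φ := LinearMap.congr_fun h4
    refine ⟨t, ?_, fun x => h3 fun φ => ?_, fun x => h3 fun φ => ?_⟩
    · rintro rfl
      refine hI.ne_zero (LinearMap.ext fun φ => ?_)
      rw [← h5, map_zero, LinearMap.zero_apply]
    · have h6 := congrArg (fun ψ => toDual k H ψ x) (hI.invariant φ)
      simp only [← h4] at h6
      rw [h2, map_smul, LinearMap.smul_apply, toDual_one] at h6
      rw [h6, map_smul, smul_eq_mul, smul_eq_mul, mul_comm]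
      rfl
    · have h6 := congrArg (fun ψ => toDual k H ψ x) (hI.contractLeft_comul φ)
      rw [modularElt]
      nth_rw 1 [← h4] at h6
      rw [h1] at h6
      rw [h6, map_smul, map_smul, LinearMap.smul_apply, h5, smul_eq_mul, smul_eq_mul, mul_comm]

theorem modularElements_hopfDual (ω : (ThreeCochain k H)ˣ) (hω : IsNormalizedThreeCocycle ω) :
    ∃ μ₀ : HopfDual k H,
      (∀ μ : HopfDual k H,
        IsModularFunctional Coalgebra.counit (toDual k H μ) ↔ μ = μ₀) ∧
      (∀ g, (hopfDual ω).IsModularElement g ↔ g = cocycleβ ω ^ 2 * μ₀) ∧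
      (∀ g, (quantumDouble (hopfDual ω)).IsModularElement g ↔
        g = QuantumDouble.incl (hopfDual ω) (cocycleβ ω ^ 2 * μ₀)) ∧
      (∀ g, (hopfDual ω).IsLeftIntegralContraction g ↔
        g = dualAntipodeMap k H (cocycleβ ω ^ 2 * μ₀)) ∧
      (∀ g, (quantumDouble (hopfDual ω)).IsLeftIntegralContraction g ↔
        g = QuantumDouble.incl (hopfDual ω) (dualAntipodeMap k H (cocycleβ ω ^ 2 * μ₀))) := by
  obtain ⟨m, r, hI⟩ := exists_isIntegralPair k (HopfDual k H)
  have hQ := isTwist_hopfDual ω hω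
  exact ⟨modularElt m r, fun μ => isModularFunctional_iff hI,
    fun g => hQ.isModularElement_iff hI, fun g => hQ.double_isModularElement_iff hI,
    fun g => hQ.isLeftIntegralContraction_iff hI,
    fun g => hQ.double_isLeftIntegralContraction_iff hI⟩

end HopfDualTwist

end QuasiHopf

end

theorem mainTheorem6 {k H : Type*} [Field k] [Ring H] [HopfAlgebra k H]
    [Coalgebra.IsCocomm k H] [Module.Finite k H]
    (ω : (QuasiHopf.ThreeCochain k H)ˣ) (hω : QuasiHopf.IsNormalizedThreeCocycle ω) :
    (∃! μ : QuasiHopf.HopfDual k H,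
      QuasiHopf.IsModularFunctional Coalgebra.counit (QuasiHopf.toDual k H μ)) ∧
    ∀ μ : QuasiHopf.HopfDual k H, QuasiHopf.IsModularFunctional Coalgebra.counit (QuasiHopf.toDual k H μ) →
      (∀ g : QuasiHopf.HopfDual k H,
        (QuasiHopf.hopfDual ω).IsModularElement g ↔ g = QuasiHopf.cocycleβ ω ^ 2 * μ) ∧
      (∀ g : QuasiHopf.QuantumDouble (QuasiHopf.hopfDual ω),
        (QuasiHopf.quantumDouble (QuasiHopf.hopfDual ω)).IsModularElement g ↔
          g = QuasiHopf.QuantumDouble.bowtie (QuasiHopf.hopfDual ω)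
            (QuasiHopf.evalHopfDual 1) (QuasiHopf.cocycleβ ω ^ 2 * μ)) ∧
      (∀ g : QuasiHopf.HopfDual k H,
        (QuasiHopf.hopfDual ω).IsLeftIntegralContraction g ↔
          g = (QuasiHopf.hopfDual ω).antipode (QuasiHopf.cocycleβ ω ^ 2 * μ)) ∧
      (∀ g : QuasiHopf.QuantumDouble (QuasiHopf.hopfDual ω),
        (QuasiHopf.quantumDouble (QuasiHopf.hopfDual ω)).IsLeftIntegralContraction g ↔
          g = QuasiHopf.QuantumDouble.bowtie (QuasiHopf.hopfDual ω) (QuasiHopf.evalHopfDual 1)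
            ((QuasiHopf.hopfDual ω).antipode (QuasiHopf.cocycleβ ω ^ 2 * μ))) := by
  obtain ⟨μ₀, h, h1, h2, h3, h4⟩ := QuasiHopf.modularElements_hopfDual ω hω
  refine ⟨⟨μ₀, (h μ₀).mpr rfl, fun μ hμ => (h μ).mp hμ⟩, fun μ hμ => ?_⟩
  obtain rfl := (h μ).mp hμ
  -- By definition `incl` is `bowtie` with the counit of `H*_ω`, which is evaluation at 1.
  exact ⟨h1, h2, h3, h4⟩
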